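/- **Setting.** An *involutive category* $(\mathbf{C},J,j)$ is a category $\mathbf{C}$ with an endofunctor $J$ and a natural isomorphism $j:\mathrm{Id}\Rightarrow J^2$ such that $jJ=Jj$. An *involutive functor* $(F,\nu):(\mathbf{C},J,j)\to(\mathbf{C}',J',j')$ is a functor $F$ with a natural transformation $\nu:FJ\Rightarrow J'F$ such that $(J'\nu)(\nu J)(Fj)=j'F$. A natural transformation $\zeta:(F,\nu)\Rightarrow(G,\chi)$ is *involutive* if $\chi\,(\zeta J)=(J'\zeta)\,\nu$. An *involutive adjunction* is an adjunction between involutive functors whose unit and counit are involutive. A *$\ast$-object* of $(\mathbf{C},J,j)$ is a morphism $\ast:c\to Jc$ with $(J\ast)\ast=j_c$, and $\ast$-morphisms are the morphisms commuting with $\ast$. An involutive functor $(F,\nu)$ induces the functor $\ast\text{-}\mathbf{Obj}(F,\nu):(\ast:c\to Jc)\mapsto(\nu_c\circ F\ast:Fc\to J'Fc)$ between the categories of $\ast$-objects. Let $(\mathbf{M},J,j)$ be a cocomplete involutive closed symmetric monoidal category: $\mathbf{M}$ is a cocomplete closed symmetric monoidal category, $J$ is a (lax) symmetric monoidal endofunctor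 and $j$ is a monoidal natural isomorphism with $jJ=Jj$. For a set $\mathfrak{C}$ of colors, a *$\mathfrak{C}$-colored $\ast$-operad* is a $\mathfrak{C}$-colored symmetric operad $\mathcal{O}$ in $\mathbf{M}$, with objects of operations $\mathcal{O}\binom{t}{\underline{a}}$, together with morphisms $\ast:\mathcal{O}\binom{t}{\underline{a}}\to J\,\mathcal{O}\binom{t}{\underline{a}}$ that satisfy $(J\ast)\ast=j$ and are compatible with the permutation actions, the operadic units and the operadic compositions. A morphism $(f,\phi):(\mathfrak{C},\mathcal{O})\to(\mathfrak{D},\mathcal{P})$ of colored $\ast$-operads is a map $f:\mathfrak{C}\to\mathfrak{D}$ together with morphisms $\phi:\mathcal{O}\binom{t}{\underline{a}}\to\mathcal{P}\binom{f(t)}{f(\underline{a})}$ that are compatible with the permutation actions, units, compositions and $\ast$-involutions. Let $\mathbf{Alg}(\mathcal{O})$ be the category of $\mathcal{O}$-algebras in $\mathbf{M}$. It is an involutive category $(\mathbf{Alg}(\mathcal{O}),J_{\mathcal{O}},j_{\mathcal{O}})$: the functor $J_{\mathcal{O}}$ sends an algebra $A$ with action $\alpha$ to the colored object $JA=(JA_t)_t$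 with the action $$\mathcal{O}\tbinom{t}{\underline{a}}\otimes\bigotimes_i JA_{a_i}\xrightarrow{\ \ast\otimes\mathrm{id}\ }J\mathcal{O}\tbinom{t}{\underline{a}}\otimes\bigotimes_i JA_{a_i}\longrightarrow J\Big(\mathcal{O}\tbinom{t}{\underline{a}}\otimes\bigotimes_i A_{a_i}\Big)\xrightarrow{\ J\alpha\ }JA_t ,$$ and $j_{\mathcal{O}}$ is given by $j$ in each color. The category of $\ast$-algebras is $\ast\text{-}\mathbf{Alg}(\mathcal{O}):=\ast\text{-}\mathbf{Obj}(\mathbf{Alg}(\mathcal{O}),J_{\mathcal{O}},j_{\mathcal{O}})$. The pullback functor $(f,\phi)^\ast:\mathbf{Alg}(\mathcal{P})\to\mathbf{Alg}(\mathcal{O})$, $A\mapsto(A_{f(t)})_t$ with the action restricted along $\phi$, satisfies $(f,\phi)^\ast J_{\mathcal{P}}=J_{\mathcal{O}}(f,\phi)^\ast$ and is an involutive functor with the identity as its structure. **Theorem 6.5.** Let $(f,\phi):(\mathfrak{C},\mathcal{O})\to(\mathfrak{D},\mathcal{P})$ be a morphism of colored $\ast$-operads with values in $(\mathbf{M},J,j)$.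 Then there is an involutive adjunction $$\big((f,\phi)_!,\lambda_{(f,\phi)}\big):\big(\mathbf{Alg}(\mathcal{O}),J_{\mathcal{O}},j_{\mathcal{O}}\big)\rightleftarrows\big(\mathbf{Alg}(\mathcal{P}),J_{\mathcal{P}},j_{\mathcal{P}}\big):\big((f,\phi)^\ast,\mathrm{id}\big).$$ That is, the pullback functor has a left adjoint $(f,\phi)_!$ (operadic left Kan extension), with unit $\eta$ and counit $\epsilon$; the composition $$\lambda_{(f,\phi)}:(f,\phi)_!J_{\mathcal{O}}\xrightarrow{(f,\phi)_!J_{\mathcal{O}}\eta}(f,\phi)_!J_{\mathcal{O}}(f,\phi)^\ast(f,\phi)_!=(f,\phi)_!(f,\phi)^\ast J_{\mathcal{P}}(f,\phi)_!\xrightarrow{\epsilon J_{\mathcal{P}}(f,\phi)_!}J_{\mathcal{P}}(f,\phi)_!$$ makes $(f,\phi)_!$ an involutive functor; and $\eta$ and $\epsilon$ are involutive. Applying $\ast\text{-}\mathbf{Obj}$ yields an adjunction $$(f,\phi)_!:\ast\text{-}\mathbf{Alg}(\mathcal{O})\rightleftarrows\ast\text{-}\mathbf{Alg}(\mathcal{P}):(f,\phi)^\ast$$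 between the categories of $\ast$-algebras, between the functors $\ast\text{-}\mathbf{Obj}\big((f,\phi)_!,\lambda_{(f,\phi)}\big)$ and $\ast\text{-}\mathbf{Obj}\big((f,\phi)^\ast,\mathrm{id}\big)$, whose unit and counit have $\eta$ and $\epsilon$ as underlying morphisms. -/

import Mathlib

open CategoryTheory MonoidalCategory

universe v u w

namespace StarOp

/-! ### Involutive categories -/

/-- An involutive structure on a category: an endofunctor `J` with a natural isomorphism
`j : Id ≅ J²` such that `j J = J j`. -/
structure InvStr (X : Type*) [Category* X] where
  J : X ⥤ X
  j : 𝟭 X ≅ J ⋙ J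
  j_J : ∀ x : X, j.hom.app (J.obj x) = J.map (j.hom.app x)

section Involutive

variable {X : Type*} [Category* X] {Y : Type*} [Category* Y] {Z : Type*} [Category* Z]

/-- An involutive functor: a functor `F` with a natural transformation `ν : F J ⟶ J' F`
such that `(J' ν) (ν J) (F j) = j' F`. -/
structure InvFunctor (S : InvStr X) (T : InvStr Y) where
  functor : X ⥤ Y
  ν : S.J ⋙ functor ⟶ functor ⋙ T.J
  map_j : ∀ x : X, functor.map (S.j.hom.app x) ≫ ν.app (S.J.obj x) ≫ T.J.map (ν.app x) =
    T.j.hom.app (functor.obj x)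

/-- The identity involutive functor. -/
def InvFunctor.id (S : InvStr X) : InvFunctor S S where
  functor := 𝟭 X
  ν := { app := fun x => 𝟙 (S.J.obj x) }
  map_j := by intro x; simp

/-- The composition of involutive functors (in diagrammatic order). -/
def InvFunctor.comp {S : InvStr X} {T : InvStr Y} {U : InvStr Z}
    (F : InvFunctor S T) (G : InvFunctor T U) : InvFunctor S U where
  functor := F.functor ⋙ G.functor
  ν :=
    { app := fun x => G.functor.map (F.ν.app x) ≫ G.ν.app (F.functor.obj x)
      naturality := by
        intro x y f
        have h1 := F.ν.naturality f
        have h2 := G.ν.naturality (F.functor.map f)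
        simp only [Functor.comp_obj, Functor.comp_map] at h1 h2 ⊢
        rw [Category.assoc, ← h2, ← Category.assoc, ← G.functor.map_comp, h1,
          G.functor.map_comp, Category.assoc] }
  map_j := by
    intro x
    have h1 := G.map_j (F.functor.obj x)
    have h2 := G.ν.naturality (F.ν.app x)
    simp only [Functor.comp_obj, Functor.comp_map, Functor.map_comp, Category.assoc] at h1 h2 ⊢
    rw [← h1, ← F.map_j x]
    simp only [Functor.map_comp, Category.assoc]
    rw [reassoc_of% h2]

/-- A natural transformation `ζ : F ⟶ G` between involutive functors is involutive if
`χ (ζ J) = (J' ζ) ν`. -/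
def IsInvolutive {S : InvStr X} {T : InvStr Y} (F G : InvFunctor S T)
    (ζ : F.functor ⟶ G.functor) : Prop :=
  ∀ x : X, ζ.app (S.J.obj x) ≫ G.ν.app x = F.ν.app x ≫ T.J.map (ζ.app x)

/-- An involutive adjunction: an adjunction between the underlying functors of two involutive
functors, whose unit and counit are involutive natural transformations. -/
structure InvAdjunction {S : InvStr X} {T : InvStr Y} (L : InvFunctor S T)
    (R : InvFunctor T S) where
  adj : L.functor ⊣ R.functor
  unit_inv : IsInvolutive (InvFunctor.id S) (L.comp R) adj.unit
  counit_inv : IsInvolutive (R.comp L) (InvFunctor.id T) adj.counit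

/-- A `*`-object: a morphism `* : c ⟶ J c` with `(J *) * = j`. -/
structure StarObj (S : InvStr X) where
  obj : X
  star : obj ⟶ S.J.obj obj
  star_star : star ≫ S.J.map star = S.j.hom.app obj

/-- A `*`-morphism: a morphism commuting with the `*`-structures. -/
@[ext]
structure StarObj.Hom {S : InvStr X} (A B : StarObj S) where
  hom : A.obj ⟶ B.obj
  star_hom : A.star ≫ S.J.map hom = hom ≫ B.star

/-- The category of `*`-objects. -/
instance (S : InvStr X) : Category (StarObj S) where
  Hom A B := StarObj.Hom A B
  id A := ⟨𝟙 A.obj, by simp⟩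
  comp f g := ⟨f.hom ≫ g.hom, by
    rw [Functor.map_comp, reassoc_of% f.star_hom, g.star_hom, Category.assoc]⟩
  id_comp f := StarObj.Hom.ext (Category.id_comp _)
  comp_id f := StarObj.Hom.ext (Category.comp_id _)
  assoc f g h := StarObj.Hom.ext (Category.assoc _ _ _)

/-- The functor between categories of `*`-objects induced by an involutive functor `(F, ν)`,
sending `* : c ⟶ J c` to `F c ⟶ F J c ⟶ J' F c`. -/
def InvFunctor.starObj {S : InvStr X} {T : InvStr Y} (F : InvFunctor S T) :
    StarObj S ⥤ StarObj T where
  obj A :=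
    { obj := F.functor.obj A.obj
      star := F.functor.map A.star ≫ F.ν.app A.obj
      star_star := by
        have h := F.ν.naturality A.star
        simp only [Functor.comp_obj, Functor.comp_map] at h
        rw [← F.map_j, ← A.star_star]
        simp only [Functor.map_comp, Category.assoc]
        rw [reassoc_of% h] }
  map {A B} f :=
    { hom := F.functor.map f.hom
      star_hom := by
        have h := F.ν.naturality f.hom
        simp only [Functor.comp_obj, Functor.comp_map] at h
        change (F.functor.map A.star ≫ F.ν.app A.obj) ≫ T.J.map (F.functor.map f.hom) =
          F.functor.map f.hom ≫ F.functor.map B.star ≫ F.ν.app B.obj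
        rw [Category.assoc, ← h, ← Category.assoc, ← Functor.map_comp, f.star_hom,
          Functor.map_comp, Category.assoc] }
  map_id A := StarObj.Hom.ext (F.functor.map_id _)
  map_comp f g := StarObj.Hom.ext (F.functor.map_comp _ _)

end Involutive

/-- An involutive structure on a symmetric monoidal category: `J` is a (lax) symmetric monoidal
endofunctor and `j : Id ≅ J²` is a monoidal natural isomorphism with `j J = J j`. -/
structure InvMonStr (M : Type*) [Category* M] [MonoidalCategory M] [SymmetricCategory M]
    extends InvStr M where
  laxBraided : J.LaxBraided
  j_monoidal : NatTrans.IsMonoidal j.hom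

attribute [instance] InvMonStr.laxBraided InvMonStr.j_monoidal

/-! ### The groupoid of profiles -/

/-- Profiles: finite sequences of colors. -/
abbrev Profile (C : Type v) : Type v := List C

namespace Profile

variable {C : Type v} {D : Type v}

/-- A morphism of profiles `a ⟶ b`: a bijection `e` of positions such that the color of `a` in
position `i` is the color of `b` in position `e i`.  In terms of `σ := e⁻¹` this says that
`b = a σ = (a_{σ(1)}, …, a_{σ(n)})`. -/
@[ext]
structure Hom (a b : Profile C) : Type where
  e : Fin a.length ≃ Fin b.length
  get_e : ∀ i, b.get (e i) = a.get i

/-- The groupoid of profiles, with right permutations as morphisms. -/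
instance : Category.{0} (Profile C) where
  Hom a b := Hom a b
  id a := ⟨Equiv.refl _, fun _ => rfl⟩
  comp f g := ⟨f.e.trans g.e, fun i => (g.get_e _).trans (f.get_e i)⟩

theorem hom_ext {a b : Profile C} {f g : a ⟶ b} (h : ∀ i, f.e i = g.e i) : f = g :=
  Hom.ext (Equiv.ext h)

/-- The identity permutation between profiles that are equal. -/
def ofEq {a b : Profile C} (h : a = b) : a ⟶ b := eqToHom h

/-- The positions of a concatenation `a ++ b`. -/
def posAppend (a b : Profile C) : Fin a.length ⊕ Fin b.length ≃ Fin (a ++ b).length :=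
  finSumFinEquiv.trans (finCongr List.length_append.symm)

theorem get_posAppend (a b : Profile C) (x : Fin a.length ⊕ Fin b.length) :
    (a ++ b).get (posAppend a b x) = Sum.elim a.get b.get x := by
  rcases x with i | i <;> simp [posAppend]

/-- Concatenation of permutations (block sum). -/
def append {a a' b b' : Profile C} (σ : a ⟶ a') (τ : b ⟶ b') :
    a ++ b ⟶ a' ++ b' where
  e := (posAppend a b).symm.trans ((Equiv.sumCongr σ.e τ.e).trans (posAppend a' b'))
  get_e i := by
    obtain ⟨x, rfl⟩ := (posAppend a b).surjective i
    simp only [Equiv.trans_apply, Equiv.symm_apply_apply]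
    erw [get_posAppend, get_posAppend]
    rcases x with i | i
    · exact σ.get_e i
    · exact τ.get_e i

/-- The permutation exchanging the two leading blocks of a profile. -/
def blockSwap (a b l : Profile C) :
    a ++ (b ++ l) ⟶ b ++ (a ++ l) where
  e := ((posAppend a (b ++ l)).symm.trans
      (Equiv.sumCongr (Equiv.refl _) (posAppend b l).symm)).trans
    (((Equiv.sumAssoc _ _ _).symm.trans
      ((Equiv.sumCongr (Equiv.sumComm _ _) (Equiv.refl _)).trans (Equiv.sumAssoc _ _ _))).trans
    ((Equiv.sumCongr (Equiv.refl _) (posAppend a l)).trans (posAppend b (a ++ l))))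
  get_e i := by
    obtain ⟨x, rfl⟩ := (posAppend a (b ++ l)).surjective i
    rcases x with i | i
    · simp only [Equiv.trans_apply, Equiv.symm_apply_apply]
      erw [get_posAppend, get_posAppend]
      simp only [Equiv.sumCongr_apply, Sum.map_inl, Equiv.refl_apply,
        Equiv.sumAssoc_symm_apply_inl, Equiv.sumComm_apply, Sum.swap_inl,
        Equiv.sumAssoc_apply_inl_inr, Sum.map_inr, Sum.elim_inr, Sum.elim_inl]
      erw [get_posAppend]
      rfl
    · obtain ⟨y, rfl⟩ := (posAppend b l).surjective i
      simp only [Equiv.trans_apply, Equiv.symm_apply_apply]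
      erw [get_posAppend, get_posAppend]
      rcases y with i | i
      · simpa using (get_posAppend b l (Sum.inl i)).symm
      · simpa using (get_posAppend a l (Sum.inr i)).trans (get_posAppend b l (Sum.inr i)).symm

/-- The functor between groupoids of profiles induced by a map of colors. -/
def mapColors (f : C → D) : Profile C ⥤ Profile D where
  obj a := List.map f a
  map {a b} σ :=
    { e := (finCongr (List.length_map f)).trans (σ.e.trans (finCongr (List.length_map f).symm))
      get_e := fun i => by
        have := σ.get_e (finCongr (List.length_map f) i)
        simp at this ⊢
        rw [this] }
  map_id a := by apply hom_ext; intro i; rfl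
  map_comp f g := by apply hom_ext; intro i; rfl

end Profile

/-! ### Finite tensor products and their reordering -/

/-- Formal reorderings of lists, generated by permutations of the entries (in the same way as
`List.Perm`) and by edges `E k k'` acting on single entries. -/
inductive Reorder {K : Type v} (E : K → K → Type v) : List K → List K → Type v
  | refl (l : List K) : Reorder E l l
  | cons (k : K) {l l' : List K} (r : Reorder E l l') : Reorder E (k :: l) (k :: l')
  | swap (k k' : K) (l : List K) : Reorder E (k :: k' :: l) (k' :: k :: l)
  | act {k k' : K} (e : E k k') (l : List K) : Reorder E (k :: l) (k' :: l)
  | trans {l l' l'' : List K} (r : Reorder E l l') (r' : Reorder E l' l'') : Reorder E l l''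

/-- Reorderings without edges: words in elementary transpositions. -/
abbrev PermWord (C : Type v) : Profile C → Profile C → Type v :=
  Reorder (fun _ _ : C => PEmpty.{v + 1})

/-- The permutation described by a word. -/
def PermWord.perm {C : Type v} : {a b : Profile C} → PermWord C a b → (a ⟶ b)
  | _, _, .refl l => 𝟙 (l : Profile C)
  | _, _, .cons k r => Profile.append (𝟙 ([k] : Profile C)) (PermWord.perm r)
  | _, _, .swap k k' l => Profile.blockSwap [k] [k'] l
  | _, _, .trans r r' => PermWord.perm r ≫ PermWord.perm r'

section Tensor

variable {M : Type u} [Category.{v} M] [MonoidalCategory M]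
variable {K : Type w} {K' : Type w}

/-- The tensor product `F k₁ ⊗ (F k₂ ⊗ (… ⊗ I))` over a list. -/
def tensorList (F : K → M) : List K → M
  | [] => 𝟙_ M
  | k :: l => F k ⊗ tensorList F l

/-- The tensor product of a family of morphisms. -/
def tensorListHom {F G : K → M} (φ : ∀ k, F k ⟶ G k) :
    ∀ l : List K, tensorList F l ⟶ tensorList G l
  | [] => 𝟙 (𝟙_ M)
  | k :: l => φ k ⊗ₘ tensorListHom φ l

/-- The tensor product of a family of morphisms over a map `g` of index sets. -/
def tensorListMap {F : K → M} {G : K' → M} (g : K → K') (φ : ∀ k, F k ⟶ G (g k)) :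
    ∀ l : List K, tensorList F l ⟶ tensorList G (l.map g)
  | [] => 𝟙 (𝟙_ M)
  | k :: l => φ k ⊗ₘ tensorListMap g φ l

/-- Merging two finite tensor products by means of the associator. -/
def tensorListAppend (F : K → M) :
    ∀ l l' : List K, tensorList F l ⊗ tensorList F l' ⟶ tensorList F (l ++ l')
  | [], l' => (λ_ (tensorList F l')).hom
  | k :: l, l' => (α_ (F k) (tensorList F l) (tensorList F l')).hom ≫
      F k ◁ tensorListAppend F l l'

variable [SymmetricCategory M]

/-- The shuffle `⨂ₖ (F k ⊗ ⨂_{x ∈ s k} G x) ⟶ (⨂ₖ F k) ⊗ ⨂ₖ ⨂_{x ∈ s k} G x`. -/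
def tensorListShuffle (F : K → M) (G : K' → M) (s : K → List K') :
    ∀ l : List K, tensorList (fun k => F k ⊗ tensorList G (s k)) l ⟶
      tensorList F l ⊗ tensorList G (l.flatMap s)
  | [] => (λ_ (𝟙_ M)).inv
  | k :: l => (F k ⊗ tensorList G (s k)) ◁ tensorListShuffle F G s l ≫
      tensorμ (F k) (tensorList G (s k)) (tensorList F l) (tensorList G (l.flatMap s)) ≫
        (F k ⊗ tensorList F l) ◁ tensorListAppend G (s k) (l.flatMap s)

/-- The action of a reordering on a finite tensor product, by means of the braiding. -/
def Reorder.tensor {E : K → K → Type w} (F : K → M) (φ : ∀ {k k' : K}, E k k' → (F k ⟶ F k')) :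
    {l l' : List K} → Reorder E l l' → (tensorList F l ⟶ tensorList F l')
  | _, _, .refl l => 𝟙 (tensorList F l)
  | _, _, .cons k r => F k ◁ Reorder.tensor F φ r
  | _, _, .swap k k' l => (α_ (F k) (F k') (tensorList F l)).inv ≫
      (β_ (F k) (F k')).hom ▷ tensorList F l ≫ (α_ (F k') (F k) (tensorList F l)).hom
  | _, _, .act e l => φ e ▷ tensorList F l
  | _, _, .trans r r' => Reorder.tensor F φ r ≫ Reorder.tensor F φ r'

/-- The action of a word on a finite tensor product of colored objects. -/
def PermWord.tensor {C : Type v} (A : C → M) {a b : Profile C} (r : PermWord C a b) :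
    tensorList A a ⟶ tensorList A b :=
  Reorder.tensor A (fun e => e.elim) r

/-- The map `⨂ J (F k) ⟶ J (⨂ F k)` obtained by iterating the monoidal structure of `J`. -/
def tensorListLax (J : M ⥤ M) [J.LaxMonoidal] (F : K → M) :
    ∀ l : List K, tensorList (fun k => J.obj (F k)) l ⟶ J.obj (tensorList F l)
  | [] => Functor.LaxMonoidal.ε J
  | k :: l => J.obj (F k) ◁ tensorListLax J F l ≫ Functor.LaxMonoidal.μ J (F k) (tensorList F l)

end Tensor

section TensorLemmas

variable {M : Type u} [Category.{v} M] [MonoidalCategory M]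
variable {K : Type w} {K' : Type w}

theorem tensorListHom_id (F : K → M) (l : List K) :
    tensorListHom (fun k => 𝟙 (F k)) l = 𝟙 (tensorList F l) := by
  induction l with
  | nil => rfl
  | cons k l ih => simp [tensorListHom, ih, tensorList]

theorem tensorListHom_comp {F G H : K → M} (φ : ∀ k, F k ⟶ G k)
    (ψ : ∀ k, G k ⟶ H k) (l : List K) :
    tensorListHom (fun k => φ k ≫ ψ k) l = tensorListHom φ l ≫ tensorListHom ψ l := by
  induction l with
  | nil => exact (Category.comp_id (𝟙 (𝟙_ M))).symm
  | cons k l ih =>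
    simp only [tensorListHom, ih]
    exact (tensorHom_comp_tensorHom _ _ _ _).symm

theorem tensorListHom_map {F G : K → M} {H : K' → M} (g : K → K') (φ : ∀ k, F k ⟶ G k)
    (ψ : ∀ k, G k ⟶ H (g k)) (l : List K) :
    tensorListHom φ l ≫ tensorListMap g ψ l = tensorListMap g (fun k => φ k ≫ ψ k) l := by
  induction l with
  | nil => exact Category.comp_id (𝟙 (𝟙_ M))
  | cons k l ih =>
    simp only [tensorListMap, ← ih]
    exact tensorHom_comp_tensorHom _ _ _ _

theorem tensorListMap_hom {F : K → M} {G H : K' → M} (g : K → K') (φ : ∀ k, F k ⟶ G (g k))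
    (ψ : ∀ k, G k ⟶ H k) (l : List K) :
    tensorListMap g φ l ≫ tensorListHom ψ (l.map g) =
      tensorListMap g (fun k => φ k ≫ ψ (g k)) l := by
  induction l with
  | nil => exact Category.comp_id (𝟙 (𝟙_ M))
  | cons k l ih =>
    simp only [tensorListMap, ← ih]
    exact tensorHom_comp_tensorHom _ _ _ _

open Functor.LaxMonoidal

theorem lax_step_hom (J : M ⥤ M) [J.LaxMonoidal] {A A' X X' Y Y' : M} (f : A ⟶ A')
    (h : X ⟶ X') (x : X ⟶ J.obj Y) (x' : X' ⟶ J.obj Y') (k : Y ⟶ Y')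
    (ih : h ≫ x' = x ≫ J.map k) :
    (J.map f ⊗ₘ h) ≫ J.obj A' ◁ x' ≫ μ J A' Y' = (J.obj A ◁ x ≫ μ J A Y) ≫ J.map (f ⊗ₘ k) := by
  rw [Category.assoc, ← μ_natural, ← id_tensorHom, ← id_tensorHom,
    tensorHom_comp_tensorHom_assoc, tensorHom_comp_tensorHom_assoc, ih, Category.comp_id,
    Category.id_comp]

theorem lax_step_append (J : M ⥤ M) [J.LaxMonoidal] {A X Y Z X' Y' Z' : M}
    (t : X ⊗ Y ⟶ Z) (t' : X' ⊗ Y' ⟶ Z') (x : X ⟶ J.obj X') (y : Y ⟶ J.obj Y') (z : Z ⟶ J.obj Z')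
    (ih : t ≫ z = (x ⊗ₘ y) ≫ μ J X' Y' ≫ J.map t') :
    ((α_ (J.obj A) X Y).hom ≫ J.obj A ◁ t) ≫ J.obj A ◁ z ≫ μ J A Z' =
      ((J.obj A ◁ x ≫ μ J A X') ⊗ₘ y) ≫ μ J (A ⊗ X') Y' ≫ J.map ((α_ A X' Y').hom ≫ A ◁ t') := by
  rw [Category.assoc, ← whiskerLeft_comp_assoc, ih]
  simp only [whiskerLeft_comp, Category.assoc, Functor.map_comp, μ_natural_right]
  rw [MonoidalCategory.tensorHom_def (f := (J.obj A ◁ x ≫ μ J A X')), Category.assoc]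
  rw [← whisker_exchange_assoc]
  simp only [comp_whiskerRight, Category.assoc]
  have h := associativity J A X' Y'
  rw [reassoc_of% h]
  rw [MonoidalCategory.tensorHom_def' x y]
  simp

theorem lax_step_j {J : M ⥤ M} [J.LaxMonoidal] (j : 𝟭 M ⟶ J ⋙ J) [NatTrans.IsMonoidal j]
    {A X Y Z : M} (h : X ⟶ Y) (y : Y ⟶ J.obj Z) (x : Z ⟶ J.obj X)
    (ih : h ≫ y ≫ J.map x = j.app X) :
    (j.app A ⊗ₘ h) ≫ (J.obj (J.obj A) ◁ y ≫ μ J (J.obj A) Z) ≫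
      J.map (J.obj A ◁ x ≫ μ J A X) = j.app (A ⊗ X) := by
  have h1 := NatTrans.IsMonoidal.tensor (τ := j) A X
  simp only [Functor.LaxMonoidal.comp_μ, Functor.LaxMonoidal.id_μ] at h1
  erw [Category.id_comp] at h1
  rw [h1, ← ih]
  simp only [Functor.map_comp, Category.assoc, ← id_tensorHom]
  rw [tensorHom_comp_tensorHom_assoc, ← μ_natural_assoc, tensorHom_comp_tensorHom_assoc]
  simp

theorem lax_unit_j {J : M ⥤ M} [J.LaxMonoidal] (j : 𝟭 M ⟶ J ⋙ J) [NatTrans.IsMonoidal j] :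
    ε J ≫ J.map (ε J) = j.app (𝟙_ M) := by
  have h1 := NatTrans.IsMonoidal.unit (τ := j)
  simp only [Functor.LaxMonoidal.comp_ε, Functor.LaxMonoidal.id_ε] at h1
  erw [Category.id_comp] at h1
  exact h1.symm

theorem conj_step_hom (J : M ⥤ M) [J.LaxMonoidal] {X X' Y Y' U U' V V' B : M} {x : X ⟶ X'}
    {y : Y ⟶ Y'} {s : X ⟶ J.obj U} {s' : X' ⟶ J.obj U'} {l : Y ⟶ J.obj V} {l' : Y' ⟶ J.obj V'}
    {u : U ⟶ U'} {v : V ⟶ V'} (hx : x ≫ s' = s ≫ J.map u) (hy : y ≫ l' = l ≫ J.map v)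
    {m : U ⊗ V ⟶ B} {m' : U' ⊗ V' ⟶ B} (hm : (u ⊗ₘ v) ≫ m' = m) :
    (x ⊗ₘ y) ≫ (s' ⊗ₘ l') ≫ μ J U' V' ≫ J.map m' = (s ⊗ₘ l) ≫ μ J U V ≫ J.map m := by
  rw [tensorHom_comp_tensorHom_assoc, hx, hy, ← tensorHom_comp_tensorHom_assoc, μ_natural_assoc,
    ← J.map_comp, hm]

theorem tensorHom_comp_whisker {X X' X'' Y Y' Z : M} (f : X ⟶ X') (g : X' ⟶ X'') (h : Y ⟶ Y')
    (k : X'' ⊗ Y' ⟶ Z) : (f ≫ g ⊗ₘ h) ≫ k = f ▷ Y ≫ (g ⊗ₘ h) ≫ k := by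
  rw [← tensorHom_id, tensorHom_comp_tensorHom_assoc, Category.id_comp]

theorem conj_step_j {J : M ⥤ M} [J.LaxMonoidal] (j : 𝟭 M ⟶ J ⋙ J) [NatTrans.IsMonoidal j]
    {X Y Y' Y'' B : M} {s : X ⟶ J.obj X} (hs : s ≫ J.map s = j.app X) {y : Y ⟶ Y''}
    {l : Y'' ⟶ J.obj Y'} {l' : Y' ⟶ J.obj Y} (hy : y ≫ l ≫ J.map l' = j.app Y) (m : X ⊗ Y ⟶ B) :
    m ≫ j.app B = X ◁ y ≫ (s ⊗ₘ l) ≫ μ J X Y' ≫ J.map ((s ⊗ₘ l') ≫ μ J X Y ≫ J.map m) := by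
  have h1 := NatTrans.IsMonoidal.tensor (τ := j) X Y
  simp only [Functor.LaxMonoidal.comp_μ, Functor.LaxMonoidal.id_μ] at h1
  erw [Category.id_comp] at h1
  have h2 : m ≫ j.app B = j.app (X ⊗ Y) ≫ J.map (J.map m) := j.naturality m
  rw [h2, h1, ← hs, ← hy, J.map_comp, ← μ_natural_assoc, ← id_tensorHom,
    tensorHom_comp_tensorHom_assoc, tensorHom_comp_tensorHom_assoc]
  simp

theorem conj_step_one (J : M ⥤ M) [J.LaxMonoidal] {X A : M} {e : 𝟙_ M ⟶ X} {s : X ⟶ J.obj X}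
    (hs : e ≫ s = ε J ≫ J.map e) {m : X ⊗ (A ⊗ 𝟙_ M) ⟶ A}
    (hm : (λ_ A).inv ≫ (e ⊗ₘ (ρ_ A).inv) ≫ m = 𝟙 A) :
    (λ_ (J.obj A)).inv ≫ (e ⊗ₘ (ρ_ (J.obj A)).inv) ≫
      (s ⊗ₘ (J.obj A ◁ ε J ≫ μ J A (𝟙_ M))) ≫ μ J X (A ⊗ 𝟙_ M) ≫ J.map m = 𝟙 (J.obj A) := by
  have h : (ρ_ (J.obj A)).inv ≫ J.obj A ◁ ε J ≫ μ J A (𝟙_ M) = J.map (ρ_ A).inv :=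
    right_unitality_inv J A
  rw [tensorHom_comp_tensorHom_assoc, hs, h, ← J.map_id, ← hm, J.map_comp, J.map_comp,
    ← left_unitality_inv]
  simp only [Category.assoc]
  rw [← μ_natural_assoc, ← tensorHom_id, tensorHom_comp_tensorHom_assoc, Category.id_comp]

theorem conj_step_assoc (J : M ⥤ M) [J.LaxMonoidal] {X V W W' P P' Z Q Q' B : M}
    {sh : P' ⟶ V ⊗ W'} {c : X ⊗ V ⟶ Z} {s : X ⟶ J.obj X} {v : V ⟶ J.obj V} {z : Z ⟶ J.obj Z}
    {w : W' ⟶ J.obj W} {m : Z ⊗ W ⟶ B} {p : P' ⟶ J.obj P} {h : P ⟶ V ⊗ W} {q' : P' ⟶ Q'}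
    {l : Q' ⟶ J.obj Q} {q : P ⟶ Q} {n : X ⊗ Q ⟶ B}
    (hc : c ≫ z = (s ⊗ₘ v) ≫ μ J X V ≫ J.map c)
    (hsh : sh ≫ (v ⊗ₘ w) ≫ μ J V W = p ≫ J.map h)
    (hq : q' ≫ l = p ≫ J.map q)
    (ha : X ◁ h ≫ (α_ X V W).inv ≫ c ▷ W ≫ m = X ◁ q ≫ n) :
    X ◁ sh ≫ (α_ X V W').inv ≫ c ▷ W' ≫ (z ⊗ₘ w) ≫ μ J Z W ≫ J.map m =
      X ◁ q' ≫ (s ⊗ₘ l) ≫ μ J X Q ≫ J.map n := by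
  have e1 : c ▷ W' ≫ (z ⊗ₘ w) = ((s ⊗ₘ v) ⊗ₘ w) ≫ (μ J X V ≫ J.map c) ▷ J.obj W := by
    rw [← tensorHom_id, ← tensorHom_id, tensorHom_comp_tensorHom, tensorHom_comp_tensorHom, hc]
    simp
  have e2 : μ J X V ▷ J.obj W ≫ μ J (X ⊗ V) W =
      (α_ _ _ _).hom ≫ J.obj X ◁ μ J V W ≫ μ J X (V ⊗ W) ≫ J.map (α_ X V W).inv := by
    rw [← associativity_assoc, ← J.map_comp, Iso.hom_inv_id, J.map_id, Category.comp_id]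
  have e3 : X ◁ sh ≫ (s ⊗ₘ v ⊗ₘ w) ≫ J.obj X ◁ μ J V W =
     (s ⊗ₘ p) ≫ J.obj X ◁ J.map h := by
    rw [← id_tensorHom, ← id_tensorHom, tensorHom_comp_tensorHom, tensorHom_comp_tensorHom, hsh, ← id_tensorHom, tensorHom_comp_tensorHom]
    simp
  have e4 : X ◁ q' ≫ (s ⊗ₘ l) = (s ⊗ₘ p) ≫ J.obj X ◁ J.map q := by
    rw [← id_tensorHom, ← id_tensorHom, tensorHom_comp_tensorHom, tensorHom_comp_tensorHom, hq]
    simp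
  rw [reassoc_of% e1, reassoc_of% e4]
  simp only [comp_whiskerRight, Category.assoc, μ_natural_left_assoc]
  rw [reassoc_of% e2, associator_naturality_assoc, Iso.inv_hom_id_assoc, reassoc_of% e3]
  simp only [μ_natural_right_assoc, ← J.map_comp, ha]

theorem tensorListHom_lax (J : M ⥤ M) [J.LaxMonoidal] {F G : K → M} (φ : ∀ k, F k ⟶ G k)
    (l : List K) :
    tensorListHom (fun k => J.map (φ k)) l ≫ tensorListLax J G l =
      tensorListLax J F l ≫ J.map (tensorListHom φ l) := by
  induction l with
  | nil =>
    change 𝟙 (𝟙_ M) ≫ ε J = ε J ≫ J.map (𝟙 (𝟙_ M))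
    simp
  | cons k l ih => exact lax_step_hom J _ _ _ _ _ ih

theorem tensorListMap_lax (J : M ⥤ M) [J.LaxMonoidal] {F : K → M} {G : K' → M} (g : K → K')
    (φ : ∀ k, F k ⟶ G (g k)) (l : List K) :
    tensorListMap (G := fun k => J.obj (G k)) g (fun k => J.map (φ k)) l ≫
        tensorListLax J G (l.map g) =
      tensorListLax J F l ≫ J.map (tensorListMap g φ l) := by
  induction l with
  | nil =>
    change 𝟙 (𝟙_ M) ≫ ε J = ε J ≫ J.map (𝟙 (𝟙_ M))
    simp
  | cons k l ih => exact lax_step_hom J _ _ _ _ _ ih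

theorem tensorListAppend_lax (J : M ⥤ M) [J.LaxMonoidal] (F : K → M) (l l' : List K) :
    tensorListAppend (fun k => J.obj (F k)) l l' ≫ tensorListLax J F (l ++ l') =
      (tensorListLax J F l ⊗ₘ tensorListLax J F l') ≫ μ J _ _ ≫
        J.map (tensorListAppend F l l') := by
  induction l with
  | nil =>
    change (λ_ (tensorList (fun k => J.obj (F k)) l')).hom ≫ tensorListLax J F l' =
      (ε J ⊗ₘ tensorListLax J F l') ≫ μ J (𝟙_ M) _ ≫ J.map (λ_ (tensorList F l')).hom
    rw [MonoidalCategory.tensorHom_def', Category.assoc, ← left_unitality, leftUnitor_naturality]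
  | cons k l ih => exact lax_step_append J _ _ _ _ _ ih

theorem tensorListLax_j {J : M ⥤ M} [J.LaxMonoidal] (j : 𝟭 M ⟶ J ⋙ J) [NatTrans.IsMonoidal j]
    (F : K → M) (l : List K) :
    tensorListHom (G := fun k => J.obj (J.obj (F k))) (fun k => j.app (F k)) l ≫
      tensorListLax J (fun k => J.obj (F k)) l ≫
      J.map (tensorListLax J F l) = j.app (tensorList F l) := by
  induction l with
  | nil =>
    change 𝟙 (𝟙_ M) ≫ ε J ≫ J.map (ε J) = j.app (𝟙_ M)
    rw [Category.id_comp, lax_unit_j j]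
  | cons k l ih => exact lax_step_j j _ _ _ ih

variable [SymmetricCategory M]

theorem lax_step_swap (J : M ⥤ M) [J.LaxBraided] {A B X Y : M} (x : X ⟶ J.obj Y) :
   ((α_ (J.obj A) (J.obj B) X).inv ≫ (β_ (J.obj A) (J.obj B)).hom ▷ X ≫
      (α_ (J.obj B) (J.obj A) X).hom) ≫
      J.obj B ◁ (J.obj A ◁ x ≫ μ J A Y) ≫ μ J B (A ⊗ Y) =
    (J.obj A ◁ (J.obj B ◁ x ≫ μ J B Y) ≫ μ J A (B ⊗ Y)) ≫
      J.map ((α_ A B Y).inv ≫ (β_ A B).hom ▷ Y ≫ (α_ B A Y).hom) := by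
  have h1 := associativity J B A Y
  have h2 : J.obj A ◁ μ J B Y ≫ μ J A (B ⊗ Y) ≫ J.map (α_ A B Y).inv =
    (α_ _ _ _).inv ≫ μ J A B ▷ J.obj Y ≫ μ J (A ⊗ B) Y := by
    exact associativity_inv J A B Y
  simp only [whiskerLeft_comp, Category.assoc, Functor.map_comp]
  have h3 := Functor.LaxBraided.braided (F := J) A B
  rw [reassoc_of% h2, ← μ_natural_left_assoc, ← comp_whiskerRight_assoc, h3,
    comp_whiskerRight_assoc, h1, associator_inv_naturality_right_assoc,
    whisker_exchange_assoc, associator_naturality_right_assoc]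

theorem lax_step_shuffle (J : M ⥤ M) [J.LaxBraided] {A G G' R S S' Z Z' : M}
   (g : G ⟶ J.obj G') {X X' : M} (s : S ⟶ X ⊗ Z) (x : X ⟶ J.obj X') (z : Z ⟶ J.obj Z')
   (s1 : S' ⟶ X' ⊗ Z') (k : S ⟶ R) (r : R ⟶ J.obj S')
   {W W' : M} (w : W ⟶ J.obj W') (a : G ⊗ Z ⟶ W) (a' : G' ⊗ Z' ⟶ W')
   (ha : a ≫ w = (g ⊗ₘ z) ≫ μ J G' Z' ≫ J.map a')
   (ih : s ≫ (x ⊗ₘ z) ≫ μ J X' Z' = k ≫ r ≫ J.map s1) :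
   ((J.obj A ⊗ G) ◁ s ≫ tensorμ (J.obj A) G X Z ≫ (J.obj A ⊗ X) ◁ a) ≫
     ((J.obj A ◁ x ≫ μ J A X') ⊗ₘ w) ≫ μ J (A ⊗ X') W' =
   ((J.obj A ◁ g ≫ μ J A G') ⊗ₘ k) ≫ (J.obj (A ⊗ G') ◁ r ≫ μ J (A ⊗ G') S') ≫
     J.map ((A ⊗ G') ◁ s1 ≫ tensorμ A G' X' Z' ≫ (A ⊗ X') ◁ a') := by
  have h := tensorμ_comp_μ_tensorHom_μ_comp_μ J A G' X' Z'
  have e1 : (J.obj A ⊗ X) ◁ a ≫ ((J.obj A ◁ x ≫ μ J A X') ⊗ₘ w) ≫ μ J (A ⊗ X') W' =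
      ((J.obj A ◁ x) ⊗ₘ (g ⊗ₘ z)) ≫ (μ J A X' ⊗ₘ μ J G' Z') ≫ μ J (A ⊗ X') (G' ⊗ Z') ≫
        J.map ((A ⊗ X') ◁ a') := by
    rw [← μ_natural_right, tensorHom_comp_tensorHom_assoc, ← id_tensorHom,
      tensorHom_comp_tensorHom_assoc, ← id_tensorHom, ← id_tensorHom (J.obj (A ⊗ X')),
      tensorHom_comp_tensorHom_assoc, ha]
    simp
  simp only [Category.assoc, Functor.map_comp]
  rw [e1, ← id_tensorHom (J.obj A) x, ← tensorμ_natural_assoc, reassoc_of% h,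
    ← μ_natural_right_assoc, ← id_tensorHom, ← id_tensorHom (J.obj (A ⊗ G')),
    ← id_tensorHom (J.obj (A ⊗ G'))]
  simp only [← Category.assoc]
  congr 3
  simp only [tensorHom_comp_tensorHom, Category.id_comp, Category.comp_id, Category.assoc]
  rw [← ih, id_tensorHom]

theorem shuffle_step {A A' B B' X X' Y Y' Z Z' T T' : M} {f : A ⟶ A'} {b : B ⟶ B'} {x : X ⟶ X'}
    {y : Y ⟶ Y'} {h : Z ⟶ Z'} {s : Z ⟶ X ⊗ Y} {s' : Z' ⟶ X' ⊗ Y'} {a : B ⊗ Y ⟶ T}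
    {a' : B' ⊗ Y' ⟶ T'} {w : T ⟶ T'} (ha : a ≫ w = (b ⊗ₘ y) ≫ a')
    (ih : s ≫ (x ⊗ₘ y) = h ≫ s') :
    ((A ⊗ B) ◁ s ≫ tensorμ A B X Y ≫ (A ⊗ X) ◁ a) ≫ ((f ⊗ₘ x) ⊗ₘ w) =
      ((f ⊗ₘ b) ⊗ₘ h) ≫ (A' ⊗ B') ◁ s' ≫ tensorμ A' B' X' Y' ≫ (A' ⊗ X') ◁ a' := by
  have h1 : ((f ⊗ₘ b) ⊗ₘ h) ≫ (A' ⊗ B') ◁ s' = (A ⊗ B) ◁ s ≫ ((f ⊗ₘ b) ⊗ₘ (x ⊗ₘ y)) := by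
    rw [← id_tensorHom, ← id_tensorHom, tensorHom_comp_tensorHom, tensorHom_comp_tensorHom, ← ih]
    simp only [Category.id_comp, Category.comp_id]
  have h2 : (A ⊗ X) ◁ a ≫ ((f ⊗ₘ x) ⊗ₘ w) = ((f ⊗ₘ x) ⊗ₘ (b ⊗ₘ y)) ≫ (A' ⊗ X') ◁ a' := by
    rw [← id_tensorHom, ← id_tensorHom, tensorHom_comp_tensorHom, tensorHom_comp_tensorHom, ha]
    simp only [Category.id_comp, Category.comp_id]
  rw [reassoc_of% h1, tensorμ_natural_assoc, Category.assoc, Category.assoc, h2]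

theorem Reorder.tensor_lax (J : M ⥤ M) [J.LaxBraided] {E : K → K → Type w} (F : K → M)
    (φ : ∀ {k k' : K}, E k k' → (F k ⟶ F k')) {l l' : List K} (r : Reorder E l l') :
    r.tensor (fun k => J.obj (F k)) (fun e => J.map (φ e)) ≫ tensorListLax J F l' =
      tensorListLax J F l ≫ J.map (r.tensor F φ) := by
  induction r with
  | refl l =>
    change 𝟙 (tensorList (fun k => J.obj (F k)) l) ≫ _ = _ ≫ J.map (𝟙 _)
    simp
  | cons k r ih =>
    have := lax_step_hom J (𝟙 (F k)) _ _ _ _ ih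
    rw [J.map_id, id_tensorHom, id_tensorHom] at this
    exact this
  | swap k k' l => exact lax_step_swap J _
  | act e l =>
    have := lax_step_hom J (φ e) (𝟙 _) (tensorListLax J F l) (tensorListLax J F l) (𝟙 _) (by simp)
    rw [tensorHom_id, tensorHom_id] at this
    exact this
  | trans r r' ih ih' =>
    change (_ ≫ _) ≫ _ = _ ≫ J.map (_ ≫ _)
    rw [Category.assoc, ih', J.map_comp, reassoc_of% ih]

theorem tensorListShuffle_lax (J : M ⥤ M) [J.LaxBraided] (F : K → M) (G : K' → M)
    (s : K → List K') (l : List K) :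
    tensorListShuffle (fun k => J.obj (F k)) (fun k => J.obj (G k)) s l ≫
        (tensorListLax J F l ⊗ₘ tensorListLax J G (l.flatMap s)) ≫ μ J _ _ =
      tensorListHom (fun k => J.obj (F k) ◁ tensorListLax J G (s k) ≫ μ J _ _) l ≫
        tensorListLax J (fun k => F k ⊗ tensorList G (s k)) l ≫
          J.map (tensorListShuffle F G s l) := by
  induction l with
  | nil =>
    change (λ_ (𝟙_ M)).inv ≫ (ε J ⊗ₘ ε J) ≫ μ J (𝟙_ M) (𝟙_ M) =
      𝟙 (𝟙_ M) ≫ ε J ≫ J.map (λ_ (𝟙_ M)).inv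
    rw [Category.id_comp, ← left_unitality_inv, MonoidalCategory.tensorHom_def',
      Category.assoc, ← leftUnitor_inv_naturality_assoc]
  | cons k l ih =>
    exact lax_step_shuffle J _ _ _ _ _ _ _ _ _ _ (tensorListAppend_lax J G _ _) ih

theorem tensorListShuffle_natural_left {F F' : K → M} (φ : ∀ k, F k ⟶ F' k) (G : K' → M)
    (s : K → List K') (l : List K) :
    tensorListShuffle F G s l ≫ tensorListHom φ l ▷ tensorList G (l.flatMap s) =
      tensorListHom (fun k => φ k ▷ tensorList G (s k)) l ≫ tensorListShuffle F' G s l := by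
  induction l with
  | nil =>
    change (λ_ (𝟙_ M)).inv ≫ 𝟙 (𝟙_ M) ▷ _ = 𝟙 (𝟙_ M) ≫ (λ_ (𝟙_ M)).inv
    simp
  | cons k l ih =>
    have := shuffle_step (f := φ k) (b := 𝟙 (tensorList G (s k))) (h := tensorListHom
      (fun k => φ k ▷ tensorList G (s k)) l) (a := tensorListAppend G (s k) (l.flatMap s))
      (a' := tensorListAppend G (s k) (l.flatMap s)) (w := 𝟙 _) (y := 𝟙 _)
      (s := tensorListShuffle F G s l) (s' := tensorListShuffle F' G s l)
      (x := tensorListHom φ l) (by simp)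
      (by rw [tensorHom_id]; exact ih)
    rw [tensorHom_id, tensorHom_id] at this
    exact this

end TensorLemmas

/-! ### Colored operads -/

/-- The output color and the input profile of an operation. -/
abbrev Arity (C : Type v) : Type v := C × Profile C

/-- A permutation of the inputs of an operation. -/
inductive ArityHom {C : Type v} : Arity C → Arity C → Type v
  | mk (t : C) {b b' : Profile C} (τ : b ⟶ b') : ArityHom (t, b) (t, b')

/-- The profile of output colors of a list of operations. -/
abbrev outputs {C : Type v} (L : List (Arity C)) : Profile C := L.map Prod.fst

/-- The concatenation of the input profiles of a list of operations. -/
abbrev inputs {C : Type v} (L : List (Arity C)) : Profile C := L.flatMap Prod.snd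

/-- Reorderings of lists of operations: permutations of the list and permutations of the inputs
of its entries. -/
abbrev ArityWord (C : Type v) : List (Arity C) → List (Arity C) → Type v :=
  Reorder ArityHom

/-- The induced permutation of output colors. -/
def ArityWord.outputs {C : Type v} : {L L' : List (Arity C)} → ArityWord C L L' →
    PermWord C (StarOp.outputs L) (StarOp.outputs L')
  | _, _, .refl L => .refl (StarOp.outputs L)
  | _, _, .cons k r => .cons k.1 (ArityWord.outputs r)
  | _, _, .swap k k' L => .swap k.1 k'.1 (StarOp.outputs L)
  | _, _, .act (.mk t _) L => .refl (t :: StarOp.outputs L)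
  | _, _, .trans r r' => .trans (ArityWord.outputs r) (ArityWord.outputs r')

/-- The induced permutation of the concatenated inputs: blocks are permuted, and each block is
permuted internally. -/
def ArityWord.inputs {C : Type v} : {L L' : List (Arity C)} → ArityWord C L L' →
    (StarOp.inputs L ⟶ StarOp.inputs L')
  | _, _, .refl L => 𝟙 (StarOp.inputs L)
  | _, _, .cons k r => Profile.append (𝟙 k.2) (ArityWord.inputs r)
  | _, _, .swap k k' L => Profile.blockSwap k.2 k'.2 (StarOp.inputs L)
  | _, _, .act (.mk _ τ) L => Profile.append τ (𝟙 (StarOp.inputs L))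
  | _, _, .trans r r' => ArityWord.inputs r ≫ ArityWord.inputs r'

section Operads

variable (M : Type u) [Category.{v} M] [MonoidalCategory M] [SymmetricCategory M]

/-- Colored symmetric sequences: functors `Σ_C × C ⥤ M`, where `C` is a discrete category;
`X t` is the restriction to the output color `t`. -/
abbrev SymSeq (C : Type v) := C → Profile C ⥤ M

variable {M}

/-- The value of a symmetric sequence at an arity. -/
abbrev SymSeq.val {C : Type v} (X : SymSeq M C) (p : Arity C) : M := (X p.1).obj p.2

/-- The action of permutations of inputs. -/
def SymSeq.act {C : Type v} (X : SymSeq M C) : {p q : Arity C} → ArityHom p q → (X.val p ⟶ X.val q)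
  | _, _, .mk t τ => (X t).map τ

/-- The list of unary arities `(c ; c)`, for the colors `c` of a profile. -/
abbrev unaries {C : Type v} (a : Profile C) : List (Arity C) := List.map (fun c => (c, [c])) a

theorem outputs_unaries {C : Type v} (a : Profile C) : outputs (unaries a) = a := by
  simp [unaries, Function.comp_def]

theorem inputs_unaries {C : Type v} (a : Profile C) : inputs (unaries a) = a := by
  induction a with
  | nil => rfl
  | cons c a ih => exact congrArg (c :: ·) ih

theorem inputs_single {C : Type v} (t : C) (a : Profile C) : inputs [(t, a)] = a := by
  simp

/-- Two upper levels of operations, to be composed with an operation `(t ; t₁, …, tₘ)`: a list of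
pairs consisting of the output color `tᵢ` of an operation in the middle level and of the list of
arities of the operations in the top level that are to be inserted into it. -/
abbrev TwoLevels (C : Type v) : Type v := List (C × List (Arity C))

namespace TwoLevels

variable {C : Type v} (T : TwoLevels C)

/-- The arities of the operations in the middle level. -/
abbrev middle : List (Arity C) := List.map (fun p => (p.1, outputs p.2)) T

/-- The arities of the operations in the top level. -/
abbrev top : List (Arity C) := List.flatMap Prod.snd T

/-- The arities of the operations obtained by composing the middle and the top level. -/
abbrev merged : List (Arity C) := List.map (fun p => (p.1, inputs p.2)) T

theorem outputs_middle : outputs (middle T) = List.map Prod.fst T := by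
  simp [middle, Function.comp_def]

theorem outputs_merged : outputs (merged T) = List.map Prod.fst T := by
  simp [merged, Function.comp_def]

theorem inputs_middle : inputs (middle T) = outputs (top T) := by
  simp [middle, top, List.map_flatMap, List.flatMap_map]

theorem inputs_merged : inputs (merged T) = inputs (top T) := by
  simp [merged, top, List.flatMap_map, List.flatMap_assoc]

end TwoLevels

/-- The tensor product of a family `I ⟶ X (c ; c)` over a profile. -/
def unitsList {C : Type v} (X : SymSeq M C) (one : ∀ c, 𝟙_ M ⟶ X.val (c, [c])) :
    ∀ a : Profile C, 𝟙_ M ⟶ tensorList X.val (unaries a)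
  | [] => 𝟙 (𝟙_ M)
  | c :: a => (λ_ (𝟙_ M)).inv ≫ (one c ⊗ₘ unitsList X one a)

variable (M) in
/-- A `C`-colored operad: a `C`-colored symmetric sequence with units `I ⟶ O (t ; t)` and
compositions `O (t ; a₁, …, aₘ) ⊗ O (a₁ ; b₁) ⊗ … ⊗ O (aₘ ; bₘ) ⟶ O (t ; b₁ … bₘ)` that are
equivariant, unital and associative. -/
structure Operad (C : Type v) where
  ops : SymSeq M C
  one : ∀ t : C, 𝟙_ M ⟶ ops.val (t, [t])
  comp : ∀ (t : C) (L : List (Arity C)),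
    ops.val (t, outputs L) ⊗ tensorList ops.val L ⟶ ops.val (t, inputs L)
  equivariance : ∀ (t : C) {L L' : List (Arity C)} (r : ArityWord C L L'),
    ((ops t).map r.outputs.perm ⊗ₘ r.tensor ops.val (fun e => ops.act e)) ≫ comp t L' =
      comp t L ≫ (ops t).map r.inputs
  one_comp : ∀ (t : C) (a : Profile C),
    (λ_ (ops.val (t, a))).inv ≫ (one t ⊗ₘ (ρ_ (ops.val (t, a))).inv) ≫ comp t [(t, a)] ≫
      (ops t).map (Profile.ofEq (inputs_single t a)) = 𝟙 _
  comp_one : ∀ (t : C) (a : Profile C),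
    (ρ_ (ops.val (t, a))).inv ≫
      ((ops t).map (Profile.ofEq (outputs_unaries a).symm) ⊗ₘ unitsList ops one a) ≫
        comp t (unaries a) ≫ (ops t).map (Profile.ofEq (inputs_unaries a)) = 𝟙 _
  assoc : ∀ (t : C) (T : TwoLevels C),
    ops.val (t, List.map Prod.fst T) ◁
        tensorListShuffle (fun p => ops.val (p.1, outputs p.2)) ops.val Prod.snd T ≫
      (α_ _ _ _).inv ≫
      (((ops t).map (Profile.ofEq T.outputs_middle.symm) ⊗ₘ
          tensorListMap (fun p => (p.1, outputs p.2)) (fun _ => 𝟙 _) T) ≫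
        comp t T.middle ≫ (ops t).map (Profile.ofEq T.inputs_middle)) ▷
          tensorList ops.val T.top ≫
      comp t T.top =
    ((ops t).map (Profile.ofEq T.outputs_merged.symm) ⊗ₘ
        tensorListMap (fun p => (p.1, inputs p.2)) (fun p => comp p.1 p.2) T) ≫
      comp t T.merged ≫ (ops t).map (Profile.ofEq T.inputs_merged)

/-- A `C`-colored `*`-operad: a `C`-colored operad with a morphism of symmetric sequences
`* : O ⟶ J O` such that `(J *) * = j`, compatible with the units and the compositions. -/
structure StarOperad (S : InvMonStr M) (C : Type v) extends Operad M C where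
  star : ∀ t : C, ops t ⟶ ops t ⋙ S.J
  star_star : ∀ (t : C) (a : Profile C),
    (star t).app a ≫ S.J.map ((star t).app a) = S.j.hom.app (ops.val (t, a))
  one_star : ∀ t : C, one t ≫ (star t).app [t] = Functor.LaxMonoidal.ε S.J ≫ S.J.map (one t)
  comp_star : ∀ (t : C) (L : List (Arity C)),
    comp t L ≫ (star t).app (inputs L) =
      ((star t).app (outputs L) ⊗ₘ
        (tensorListHom (fun p => (star p.1).app p.2) L ≫ tensorListLax S.J ops.val L)) ≫
        Functor.LaxMonoidal.μ S.J _ _ ≫ S.J.map (comp t L)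

/-- The change of colors of a list of arities. -/
abbrev mapArities {C D : Type v} (f : C → D) (L : List (Arity C)) : List (Arity D) :=
  List.map (fun p => (f p.1, List.map f p.2)) L

theorem outputs_mapArities {C D : Type v} (f : C → D) (L : List (Arity C)) :
    outputs (mapArities f L) = List.map f (outputs L) := by
  simp [Function.comp_def]

theorem inputs_mapArities {C D : Type v} (f : C → D) (L : List (Arity C)) :
    inputs (mapArities f L) = List.map f (inputs L) := by
  simp [List.map_flatMap, List.flatMap_map]

/-- A morphism `(f, φ) : (C, O) ⟶ (D, P)` of colored `*`-operads: a map `f : C → D` and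
morphisms `O (t ; a) ⟶ P (f t ; f a)` that are compatible with permutations, units, compositions
and `*`-involutions. -/
structure StarOperad.Hom {S : InvMonStr M} {C D : Type v} (O : StarOperad S C)
    (P : StarOperad S D) where
  f : C → D
  φ : ∀ t : C, O.ops t ⟶ Profile.mapColors f ⋙ P.ops (f t)
  one_φ : ∀ t : C, O.one t ≫ (φ t).app [t] = P.one (f t)
  comp_φ : ∀ (t : C) (L : List (Arity C)),
    O.comp t L ≫ (φ t).app (inputs L) =
      (((φ t).app (outputs L) ≫ (P.ops (f t)).map (Profile.ofEq (outputs_mapArities f L).symm)) ⊗ₘ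
        tensorListMap (fun p => (f p.1, List.map f p.2)) (fun p => (φ p.1).app p.2) L) ≫
        P.comp (f t) (mapArities f L) ≫
          (P.ops (f t)).map (Profile.ofEq (inputs_mapArities f L))
  star_φ : ∀ (t : C) (a : Profile C),
    (O.star t).app a ≫ S.J.map ((φ t).app a) = (φ t).app a ≫ (P.star (f t)).app (List.map f a)

/-- An algebra over a `C`-colored operad: a `C`-colored object `A` with actions
`O (t ; a₁, …, aₘ) ⊗ A a₁ ⊗ … ⊗ A aₘ ⟶ A t` that are equivariant, unital and associative. -/
structure Algebra {C : Type v} (O : Operad M C) where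
  obj : C → M
  act : ∀ (t : C) (a : Profile C), O.ops.val (t, a) ⊗ tensorList obj a ⟶ obj t
  equivariance : ∀ (t : C) {a b : Profile C} (r : PermWord C a b),
    ((O.ops t).map r.perm ⊗ₘ r.tensor obj) ≫ act t b = act t a
  one_act : ∀ t : C,
    (λ_ (obj t)).inv ≫ (O.one t ⊗ₘ (ρ_ (obj t)).inv) ≫ act t [t] = 𝟙 (obj t)
  assoc : ∀ (t : C) (L : List (Arity C)),
    O.ops.val (t, outputs L) ◁ tensorListShuffle O.ops.val obj Prod.snd L ≫
      (α_ _ _ _).inv ≫ O.comp t L ▷ tensorList obj (inputs L) ≫ act t (inputs L) =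
    O.ops.val (t, outputs L) ◁ tensorListMap Prod.fst (fun p => act p.1 p.2) L ≫ act t (outputs L)

namespace Algebra

variable {C : Type v} {O : Operad M C}

/-- A morphism of algebras: a morphism of colored objects commuting with the actions. -/
@[ext]
structure Hom (A B : Algebra O) where
  hom : ∀ t : C, A.obj t ⟶ B.obj t
  act_hom : ∀ (t : C) (a : Profile C),
    A.act t a ≫ hom t = O.ops.val (t, a) ◁ tensorListHom hom a ≫ B.act t a

/-- The category of algebras over an operad. -/
instance : Category (Algebra O) where
  Hom A B := Hom A B
  id A := ⟨fun t => 𝟙 (A.obj t), fun t a => by simp [tensorListHom_id]⟩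
  comp f g := ⟨fun t => f.hom t ≫ g.hom t, fun t a => by
    rw [← Category.assoc, f.act_hom, Category.assoc, g.act_hom, tensorListHom_comp]
    simp⟩
  id_comp f := Hom.ext (funext fun t => Category.id_comp _)
  comp_id f := Hom.ext (funext fun t => Category.comp_id _)
  assoc f g h := Hom.ext (funext fun t => Category.assoc _ _ _)

end Algebra

/-! ### The involutive category of algebras -/

open Functor.LaxMonoidal

section Conjugate

variable {S : InvMonStr M} {C : Type v} (O : StarOperad S C)

/-- The action on the colored object `J A`: the composition
`O ⊗ ⨂ J A ⟶ J O ⊗ ⨂ J A ⟶ J (O ⊗ ⨂ A) ⟶ J A`. -/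
def StarOperad.conjAct (A : Algebra O.toOperad) (t : C) (a : Profile C) :
    O.ops.val (t, a) ⊗ tensorList (fun c => S.J.obj (A.obj c)) a ⟶ S.J.obj (A.obj t) :=
  ((O.star t).app a ⊗ₘ tensorListLax S.J A.obj a) ≫ μ S.J _ _ ≫ S.J.map (A.act t a)

/-- The conjugate `J_O (A, α)` of an algebra over a `*`-operad. -/
def StarOperad.conj (A : Algebra O.toOperad) : Algebra O.toOperad where
  obj t := S.J.obj (A.obj t)
  act := O.conjAct A
  equivariance t a b r := by
    have h := Reorder.tensor_lax S.J A.obj (E := fun _ _ : C => PEmpty.{v + 1})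
      (fun e => e.elim) r
    have h' : PermWord.tensor (fun c => S.J.obj (A.obj c)) r ≫ tensorListLax S.J A.obj b =
        tensorListLax S.J A.obj a ≫ S.J.map (PermWord.tensor A.obj r) := by
      rw [PermWord.tensor, PermWord.tensor, ← h]
      congr 2
      funext k k' e
      exact e.elim
    have hn := (O.star t).naturality r.perm
    exact conj_step_hom S.J hn h' (A.equivariance t r)
  one_act t := conj_step_one S.J (O.one_star t) (A.one_act t)
  assoc t L := by
    have h1 := tensorListShuffle_lax S.J O.ops.val A.obj Prod.snd L
    have h2 := tensorListShuffle_natural_left (F := O.ops.val)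
      (F' := fun p => S.J.obj (O.ops.val p)) (fun p => (O.star p.1).app p.2)
      (fun c => S.J.obj (A.obj c)) Prod.snd L
    have h3 := tensorListMap_lax S.J (F := fun p : Arity C => O.ops.val p ⊗ tensorList A.obj p.2)
      (G := A.obj) Prod.fst (fun p => A.act p.1 p.2) L
    refine conj_step_assoc S.J (p := tensorListHom
        (G := fun p : Arity C => S.J.obj (O.ops.val p ⊗ tensorList A.obj p.2))
        (fun p : Arity C => ((O.star p.1).app p.2 ⊗ₘ tensorListLax S.J A.obj p.2) ≫ μ S.J _ _) L ≫
        tensorListLax S.J (fun p : Arity C => O.ops.val p ⊗ tensorList A.obj p.2) L)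
      (O.comp_star t L) ?_ ?_ (A.assoc t L)
    · rw [tensorHom_comp_whisker, Category.assoc, reassoc_of% h2, h1,
        ← Category.assoc, ← tensorListHom_comp]
      congr 2
      funext p
      rw [MonoidalCategory.tensorHom_def, Category.assoc]
      rfl
    · rw [Category.assoc, ← h3, ← Category.assoc, tensorListHom_map]
      simp only [Category.assoc]
      rfl

theorem StarOperad.conj_map {A B : Algebra O.toOperad} (f : A ⟶ B) (t : C) (a : Profile C) :
    (O.conj A).act t a ≫ S.J.map (f.hom t) =
      O.ops.val (t, a) ◁ tensorListHom (fun c => S.J.map (f.hom c)) a ≫ (O.conj B).act t a := by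
  have h := conj_step_hom S.J (x := 𝟙 (O.ops.val (t, a))) (s := (O.star t).app a)
    (s' := (O.star t).app a) (u := 𝟙 (O.ops.val (t, a))) (by simp)
    (tensorListHom_lax S.J f.hom a) (m' := B.act t a) rfl
  rw [id_tensorHom, id_tensorHom, ← f.act_hom, S.J.map_comp] at h
  refine Eq.trans ?_ h.symm
  simp only [StarOperad.conj, StarOperad.conjAct, Category.assoc]

theorem StarOperad.conj_j (A : Algebra O.toOperad) (t : C) (a : Profile C) :
    A.act t a ≫ S.j.hom.app (A.obj t) =
      O.ops.val (t, a) ◁ tensorListHom (G := fun c => S.J.obj (S.J.obj (A.obj c)))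
        (fun c => S.j.hom.app (A.obj c)) a ≫ (O.conj (O.conj A)).act t a :=
  conj_step_j S.j.hom (O.star_star t a) (tensorListLax_j S.j.hom A.obj a) _

/-- An isomorphism of algebras from isomorphisms of the underlying objects. -/
def Algebra.isoMk {O : Operad M C} {A B : Algebra O} (e : ∀ t, A.obj t ≅ B.obj t)
    (h : ∀ (t : C) (a : Profile C), A.act t a ≫ (e t).hom =
      O.ops.val (t, a) ◁ tensorListHom (fun c => (e c).hom) a ≫ B.act t a) : A ≅ B where
  hom := ⟨fun t => (e t).hom, h⟩
  inv := ⟨fun t => (e t).inv, fun t a => by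
    rw [← cancel_mono (e t).hom, Category.assoc, Category.assoc, h t a, (e t).inv_hom_id,
      Category.comp_id, ← whiskerLeft_comp_assoc, ← tensorListHom_comp]
    simp [tensorListHom_id]⟩
  hom_inv_id := Algebra.Hom.ext (funext fun t => (e t).hom_inv_id)
  inv_hom_id := Algebra.Hom.ext (funext fun t => (e t).inv_hom_id)

/-- The involutive category `(Alg(O), J_O, j_O)` of algebras over a colored `*`-operad. -/
def StarOperad.algInv : InvStr (Algebra O.toOperad) where
  J :=
    { obj := fun A => O.conj A
      map := fun f => ⟨fun t => S.J.map (f.hom t), O.conj_map f⟩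
      map_id := fun A => Algebra.Hom.ext (funext fun t => S.J.map_id _)
      map_comp := fun f g => Algebra.Hom.ext (funext fun t => S.J.map_comp _ _) }
  j := NatIso.ofComponents
    (fun A => Algebra.isoMk (fun t => S.j.app (A.obj t)) (O.conj_j A))
    (fun f => Algebra.Hom.ext (funext fun t => S.j.hom.naturality (f.hom t)))
  j_J A := Algebra.Hom.ext (funext fun t => S.j_J (A.obj t))

/-- The category of `*`-algebras over a colored `*`-operad: the `*`-objects in the involutive
category of algebras. -/
abbrev StarOperad.StarAlg := StarObj O.algInv

end Conjugate

/-! ### Change of operad -/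

section Pullback

variable {S : InvMonStr M} {C D : Type v} {O : StarOperad S C} {P : StarOperad S D}
variable (Φ : StarOperad.Hom O P)

/-- The comparison of finite tensor products under a map of colors. -/
def tensorListPull (f : C → D) (A : D → M) (a : Profile C) :
    tensorList (fun c => A (f c)) a ⟶ tensorList A (List.map f a) :=
  tensorListMap f (fun c => 𝟙 (A (f c))) a

/-- The action on the pullback `f^* A`:
`O (t ; a) ⊗ ⨂ f^* A ⟶ P (f t ; f a) ⊗ ⨂ A ⟶ A (f t)`. -/
def StarOperad.Hom.pullAct (A : Algebra P.toOperad) (t : C) (a : Profile C) :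
    O.ops.val (t, a) ⊗ tensorList (fun c => A.obj (Φ.f c)) a ⟶ A.obj (Φ.f t) :=
  ((Φ.φ t).app a ⊗ₘ tensorListPull Φ.f A.obj a) ≫ A.act (Φ.f t) (List.map Φ.f a)

/-- The image of a word under a map of colors. -/
def PermWord.map (f : C → D) : {a b : Profile C} → PermWord C a b →
    PermWord D (List.map f a) (List.map f b)
  | _, _, .refl l => .refl (List.map f l)
  | _, _, .cons k r => .cons (f k) (PermWord.map f r)
  | _, _, .swap k k' l => .swap (f k) (f k') (List.map f l)
  | _, _, .trans r r' => .trans (PermWord.map f r) (PermWord.map f r')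

theorem mapColors_cons (f : C → D) (k : C) {a b : Profile C} (σ : a ⟶ b) :
    (Profile.mapColors f).map (Profile.append (𝟙 ([k] : Profile C)) σ) =
      Profile.append (𝟙 ([f k] : Profile D)) ((Profile.mapColors f).map σ) := by
  apply Profile.hom_ext
  intro i
  refine Fin.cases ?_ (fun i => ?_) i
  · rfl
  · apply Fin.ext
    have h : ∀ {E : Type v} (c : E) {x y : Profile E} (τ : x ⟶ y) (i : Fin x.length),
        (Profile.append (𝟙 ([c] : Profile E)) τ).e i.succ = (τ.e i).succ := by
      intro E c x y τ i
      have e : (i.succ : Fin (c :: x).length) = Profile.posAppend [c] x (Sum.inr i) := by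
        apply Fin.ext
        simp [Profile.posAppend, add_comm]
      rw [e]
      apply Fin.ext
      simp only [Profile.append, Equiv.trans_apply]
      erw [Equiv.symm_apply_apply]
      simp [Profile.posAppend, add_comm]
    erw [h (f k) ((Profile.mapColors f).map σ) i]
    have q := congrArg Fin.val (h k σ (finCongr (List.length_map f) i))
    exact q

theorem mapColors_swap (f : C → D) (k k' : C) (l : Profile C) :
    (Profile.mapColors f).map (Profile.blockSwap [k] [k'] l) =
      Profile.blockSwap [f k] [f k'] (List.map f l) := by
  have h : ∀ {E : Type v} (c c' : E) (x : Profile E) (i : Fin x.length),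
      ((Profile.blockSwap [c] [c'] x).e i.succ.succ).val = i.val + 2 := by
    intro E c c' x i
    have e : (i.succ.succ : Fin (c :: c' :: x).length) =
        Profile.posAppend [c] ([c'] ++ x) (Sum.inr (Profile.posAppend [c'] x (Sum.inr i))) := by
      apply Fin.ext
      simp [Profile.posAppend, add_comm]
    rw [e]
    simp only [Profile.blockSwap, Equiv.trans_apply]
    erw [Equiv.symm_apply_apply]
    simp only [Equiv.sumCongr_apply, Sum.map_inr]
    erw [Equiv.symm_apply_apply]
    simp [Profile.posAppend]
  apply Profile.hom_ext
  intro i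
  apply Fin.ext
  refine Fin.cases ?_ (fun i => ?_) i
  · rfl
  · refine Fin.cases ?_ (fun i => ?_) i
    · rfl
    · erw [h (f k) (f k') (List.map f l) i]
      exact h k k' l (finCongr (List.length_map f) i)

theorem PermWord.perm_map (f : C → D) {a b : Profile C} (r : PermWord C a b) :
    (r.map f).perm = (Profile.mapColors f).map r.perm := by
  induction r with
  | refl l => exact ((Profile.mapColors f).map_id l).symm
  | cons k r ih =>
    refine Eq.trans ?_ (mapColors_cons f k _).symm
    exact congrArg (Profile.append (𝟙 ([f k] : Profile D))) ih
  | swap k k' l => exact (mapColors_swap f k k' l).symm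
  | act e l => exact e.elim
  | trans r r' ih ih' =>
    refine Eq.trans ?_ ((Profile.mapColors f).map_comp _ _).symm
    rw [← ih, ← ih']
    rfl

theorem pull_step_swap {A B X Y : M} (x : X ⟶ Y) :
    ((α_ A B X).inv ≫ (β_ A B).hom ▷ X ≫ (α_ B A X).hom) ≫ (𝟙 B ⊗ₘ (𝟙 A ⊗ₘ x)) =
      (𝟙 A ⊗ₘ (𝟙 B ⊗ₘ x)) ≫ (α_ A B Y).inv ≫ (β_ A B).hom ▷ Y ≫ (α_ B A Y).hom := by
  simp only [id_tensorHom, Category.assoc]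
  rw [associator_inv_naturality_right_assoc, whisker_exchange_assoc,
    associator_naturality_right]

theorem PermWord.tensor_map (f : C → D) (A : D → M) {a b : Profile C} (r : PermWord C a b) :
    r.tensor (fun c => A (f c)) ≫ tensorListPull f A b =
      tensorListPull f A a ≫ (r.map f).tensor A := by
  induction r with
  | refl l => exact (Category.id_comp _).trans (Category.comp_id _).symm
  | cons k r ih =>
    change A (f k) ◁ _ ≫ (𝟙 (A (f k)) ⊗ₘ _) = (𝟙 (A (f k)) ⊗ₘ _) ≫ A (f k) ◁ _
    rw [id_tensorHom, id_tensorHom, ← whiskerLeft_comp, ← whiskerLeft_comp]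
    exact congrArg _ ih
  | swap k k' l => exact pull_step_swap _
  | act e l => exact e.elim
  | trans r r' ih ih' =>
    change (_ ≫ _) ≫ _ = _ ≫ (_ ≫ _)
    exact (Category.assoc _ _ _).trans ((congrArg _ ih').trans
      ((Category.assoc _ _ _).symm.trans ((congrArg (· ≫ _) ih).trans (Category.assoc _ _ _))))

/-- The identification of finite tensor products over equal lists. -/
def tensorListCast {K : Type v} (F : K → M) {l l' : List K} (h : l = l') :
    tensorList F l ⟶ tensorList F l' := eqToHom (congrArg (tensorList F) h)

theorem tensorListCast_cons {K : Type v} (F : K → M) (k : K) {l l' : List K} (h : l = l') :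
    tensorListCast F (congrArg (k :: ·) h) = F k ◁ tensorListCast F h := by
  subst h
  exact (whiskerLeft_id _ _).symm

theorem tensorListCast_append {K : Type v} (F : K → M) (a : List K) {l l' : List K} (h : l = l') :
    tensorListAppend F a l ≫ tensorListCast F (congrArg (a ++ ·) h) =
      tensorList F a ◁ tensorListCast F h ≫ tensorListAppend F a l' := by
  subst h
  simp [tensorListCast]

theorem tensorListCast_trans {K : Type v} (F : K → M) {l l' l'' : List K} (h : l = l')
    (h' : l' = l'') :
    tensorListCast F h ≫ tensorListCast F h' = tensorListCast F (h.trans h') := by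
  subst h h'
  simp [tensorListCast]

theorem pull_step_append {A X Y Z X' Y' Z' W' : M} {a : X ⊗ Y ⟶ Z} {z : Z ⟶ Z'} {c : Z' ⟶ W'}
    {x : X ⟶ X'} {y : Y ⟶ Y'} {a' : X' ⊗ Y' ⟶ W'} (ih : a ≫ z ≫ c = (x ⊗ₘ y) ≫ a') :
    ((α_ A X Y).hom ≫ A ◁ a) ≫ (𝟙 A ⊗ₘ z) ≫ A ◁ c =
      ((𝟙 A ⊗ₘ x) ⊗ₘ y) ≫ (α_ A X' Y').hom ≫ A ◁ a' := by
  rw [associator_naturality_assoc, id_tensorHom, id_tensorHom, Category.assoc,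
    ← whiskerLeft_comp, ← whiskerLeft_comp, ← whiskerLeft_comp, ih]

theorem tensorListPull_append (f : C → D) (A : D → M) (a b : Profile C) :
    tensorListAppend (fun c => A (f c)) a b ≫ tensorListPull f A (a ++ b) ≫
        tensorListCast A List.map_append =
      (tensorListPull f A a ⊗ₘ tensorListPull f A b) ≫
        tensorListAppend A (List.map f a) (List.map f b) := by
  induction a with
  | nil =>
    change (λ_ _).hom ≫ tensorListPull f A b ≫ 𝟙 _ =
      (𝟙 (𝟙_ M) ⊗ₘ tensorListPull f A b) ≫ (λ_ _).hom
    rw [id_tensorHom, leftUnitor_naturality, Category.comp_id]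
  | cons k a ih =>
    have := pull_step_append (A := A (f k)) ih
    rw [← tensorListCast_cons] at this
    exact this

theorem pull_step_cast {X Y Z Z' X' Y' Y'' W W' : M} {a : X ⊗ Y ⟶ Z} {p : Z ⟶ Z'} {c : Z' ⟶ W}
    {x : X ⟶ X'} {y : Y ⟶ Y'} {b : X' ⊗ Y' ⟶ W} {d : W ⟶ W'} {e : Y' ⟶ Y''} {b' : X' ⊗ Y'' ⟶ W'}
    (h1 : a ≫ p ≫ c = (x ⊗ₘ y) ≫ b) (h2 : b ≫ d = X' ◁ e ≫ b') :
    a ≫ (p ≫ c ≫ d) = (x ⊗ₘ (y ≫ e)) ≫ b' := by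
  rw [reassoc_of% h1, h2, ← id_tensorHom, tensorHom_comp_tensorHom_assoc, Category.comp_id]

theorem tensorListShuffle_pull {F : Arity C → M} {G : Arity D → M} (f : C → D) (A : D → M)
    (φ : ∀ p : Arity C, F p ⟶ G (f p.1, List.map f p.2)) (L : List (Arity C)) :
    tensorListShuffle F (fun c => A (f c)) Prod.snd L ≫
        (tensorListMap (fun p => (f p.1, List.map f p.2)) φ L ⊗ₘ
          (tensorListPull f A (inputs L) ≫ tensorListCast A (inputs_mapArities f L).symm)) =
      tensorListMap (G := fun p => G p ⊗ tensorList A p.2) (fun p => (f p.1, List.map f p.2))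
          (fun p => φ p ⊗ₘ tensorListPull f A p.2) L ≫
        tensorListShuffle G A Prod.snd (mapArities f L) := by
  induction L with
  | nil =>
    change (λ_ (𝟙_ M)).inv ≫ (𝟙 (𝟙_ M) ⊗ₘ (𝟙 (𝟙_ M) ≫ 𝟙 (𝟙_ M))) = 𝟙 (𝟙_ M) ≫ (λ_ (𝟙_ M)).inv
    simp
  | cons p L ih =>
    refine shuffle_step ?_ ih
    have h1 := tensorListPull_append f A p.2 (inputs L)
    have h2 := tensorListCast_append A (List.map f p.2) (inputs_mapArities f L).symm
    have h3 := tensorListCast_trans A (List.map_append (f := f) (l₁ := p.2) (l₂ := inputs L))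
      (congrArg (List.map f p.2 ++ ·) (inputs_mapArities f L).symm)
    have h4 := pull_step_cast h1 h2
    rw [h3] at h4
    exact h4

theorem Algebra.act_cast {O : Operad M D} (A : Algebra O) (t : D) {a b : Profile D} (h : a = b) :
    ((O.ops t).map (Profile.ofEq h) ⊗ₘ tensorListCast A.obj h) ≫ A.act t b = A.act t a := by
  subst h
  simp [Profile.ofEq, tensorListCast]

theorem pull_step_hom {X X' Y Y' U U' V V' B : M} {x : X ⟶ X'}
    {y : Y ⟶ Y'} {s : X ⟶ U} {s' : X' ⟶ U'} {l : Y ⟶ V} {l' : Y' ⟶ V'}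
    {u : U ⟶ U'} {v : V ⟶ V'} (hx : x ≫ s' = s ≫ u) (hy : y ≫ l' = l ≫ v)
    {m : U ⊗ V ⟶ B} {m' : U' ⊗ V' ⟶ B} (hm : (u ⊗ₘ v) ≫ m' = m) :
    (x ⊗ₘ y) ≫ (s' ⊗ₘ l') ≫ m' = (s ⊗ₘ l) ≫ m := by
  rw [tensorHom_comp_tensorHom_assoc, hx, hy, ← tensorHom_comp_tensorHom_assoc, hm]

theorem pull_step_one {X X' A : M} {e : 𝟙_ M ⟶ X} {s : X ⟶ X'} {e' : 𝟙_ M ⟶ X'}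
    (hs : e ≫ s = e') {m : X' ⊗ (A ⊗ 𝟙_ M) ⟶ A}
    (hm : (λ_ A).inv ≫ (e' ⊗ₘ (ρ_ A).inv) ≫ m = 𝟙 A) :
    (λ_ A).inv ≫ (e ⊗ₘ (ρ_ A).inv) ≫ (s ⊗ₘ (𝟙 A ⊗ₘ 𝟙 (𝟙_ M))) ≫ m = 𝟙 A := by
  rw [id_tensorHom_id, tensorHom_comp_tensorHom_assoc, hs, Category.comp_id, hm]

theorem pull_step_assoc {X X₁ X' V V' W W₁ W' Z Z₁ Z' Q Q₁ Q' R R' B : M}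
    {sh : R ⟶ V ⊗ W} {c : X ⊗ V ⟶ Z} {w : W ⟶ W₁} {z : Z ⟶ Z₁} {m : Z₁ ⊗ W₁ ⟶ B}
    {q : R ⟶ Q} {x : X ⟶ X₁} {o : Q ⟶ Q₁} {n : X₁ ⊗ Q₁ ⟶ B}
    {k : X₁ ⟶ X'} {d : Q₁ ⟶ Q'} {n' : X' ⊗ Q' ⟶ B} {k' : Z' ⟶ Z₁} {d' : W' ⟶ W₁}
    {m' : Z' ⊗ W' ⟶ B} {w' : W ⟶ W'} {c' : X' ⊗ V' ⟶ Z'} {v : V ⟶ V'} {p : R ⟶ R'}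
    {sh' : R' ⟶ V' ⊗ W'} {q' : R' ⟶ Q'}
    (hn : (k ⊗ₘ d) ≫ n' = n) (hm : (k' ⊗ₘ d') ≫ m = m') (hw : w' ≫ d' = w)
    (hc : c ≫ z = ((x ≫ k) ⊗ₘ v) ≫ c' ≫ k') (hsh : sh ≫ (v ⊗ₘ w') = p ≫ sh')
    (hq : q ≫ o ≫ d = p ≫ q')
    (ha : X' ◁ sh' ≫ (α_ X' V' W').inv ≫ c' ▷ W' ≫ m' = X' ◁ q' ≫ n') :
    X ◁ sh ≫ (α_ X V W).inv ≫ c ▷ W ≫ (z ⊗ₘ w) ≫ m = X ◁ q ≫ (x ⊗ₘ o) ≫ n := by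
  rw [← hn, ← hw, tensorHom_comp_tensorHom_assoc, ← id_tensorHom, ← id_tensorHom,
    tensorHom_comp_tensorHom_assoc, hq, ← tensorHom_id, tensorHom_comp_tensorHom_assoc, hc]
  have e1 : X' ◁ q' = 𝟙 X' ⊗ₘ q' := (id_tensorHom _ _).symm
  have e2 : (𝟙 X ≫ x ≫ k ⊗ₘ p ≫ q') = (x ≫ k ⊗ₘ p) ≫ X' ◁ q' := by
    rw [e1, tensorHom_comp_tensorHom]; simp
  have e3 : (((x ≫ k) ⊗ₘ v) ≫ c' ≫ k' ⊗ₘ 𝟙 W ≫ w' ≫ d') =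
      (((x ≫ k) ⊗ₘ v) ⊗ₘ w') ≫ c' ▷ W' ≫ (k' ⊗ₘ d') := by
    rw [← tensorHom_id, tensorHom_comp_tensorHom, tensorHom_comp_tensorHom]; simp
  rw [e2, e3]
  simp only [Category.assoc]
  rw [hm, id_tensorHom, ← ha,
    ← associator_inv_naturality_assoc, ← id_tensorHom, ← id_tensorHom,
    tensorHom_comp_tensorHom_assoc, tensorHom_comp_tensorHom_assoc, hsh, Category.id_comp,
    Category.comp_id]

theorem pull_step_map {X X' X₁ Y Y' Y₁ Z Z' : M} {a : X ⟶ X'} {q : Y ⟶ Y'} {o : Y' ⟶ Y₁}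
    {d : Y₁ ⟶ Z} {p : Y ⟶ Z'} {q' : Z' ⟶ Z} {s : X ⟶ X₁} {a' : X₁ ⟶ X'} (ha : a = s ≫ a')
    (hq : q ≫ o ≫ d = p ≫ q') :
    (a ⊗ₘ q) ≫ (𝟙 X' ⊗ₘ o) ≫ X' ◁ d = (s ⊗ₘ p) ≫ (a' ⊗ₘ q') := by
  rw [← id_tensorHom, tensorHom_comp_tensorHom, tensorHom_comp_tensorHom,
    tensorHom_comp_tensorHom, hq, ha]
  simp

theorem StarOperad.Hom.map_pullAct (A : Algebra P.toOperad) (L : List (Arity C)) :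
    tensorListMap (G := fun c => A.obj (Φ.f c)) Prod.fst (fun p => Φ.pullAct A p.1 p.2) L ≫
        tensorListPull Φ.f A.obj (outputs L) ≫
          tensorListCast A.obj (outputs_mapArities Φ.f L).symm =
      tensorListMap (G := fun p => P.ops.val p ⊗ tensorList A.obj p.2)
          (fun p => (Φ.f p.1, List.map Φ.f p.2))
          (fun p => (Φ.φ p.1).app p.2 ⊗ₘ tensorListPull Φ.f A.obj p.2) L ≫
        tensorListMap Prod.fst (fun p => A.act p.1 p.2) (mapArities Φ.f L) := by
  induction L with
  | nil =>
    change 𝟙 (𝟙_ M) ≫ 𝟙 (𝟙_ M) ≫ 𝟙 (𝟙_ M) = 𝟙 (𝟙_ M) ≫ 𝟙 (𝟙_ M)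
    simp
  | cons p L ih =>
    have := pull_step_map (a := Φ.pullAct A p.1 p.2) rfl ih
    rw [← tensorListCast_cons] at this
    exact this

/-- The pullback `(f, φ)^* A` of an algebra. -/
def StarOperad.Hom.pull (A : Algebra P.toOperad) : Algebra O.toOperad where
  obj t := A.obj (Φ.f t)
  act := Φ.pullAct A
  equivariance t a b r := by
    refine pull_step_hom ((Φ.φ t).naturality r.perm) (PermWord.tensor_map Φ.f A.obj r) ?_
    have h := A.equivariance (Φ.f t) (r.map Φ.f)
    rw [PermWord.perm_map] at h
    exact h
  one_act t := pull_step_one (Φ.one_φ t) (A.one_act (Φ.f t))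
  assoc t L := by
    refine pull_step_assoc (Algebra.act_cast A (Φ.f t) (outputs_mapArities Φ.f L).symm)
      (Algebra.act_cast A (Φ.f t) (inputs_mapArities Φ.f L)) ?_ (Φ.comp_φ t L)
      (tensorListShuffle_pull (F := O.ops.val) (G := P.ops.val) Φ.f A.obj
        (fun p => (Φ.φ p.1).app p.2) L)
      (Φ.map_pullAct A L) (A.assoc (Φ.f t) (mapArities Φ.f L))
    rw [Category.assoc, tensorListCast_trans]
    exact Category.comp_id _

theorem tensorListPull_hom (f : C → D) {A B : D → M} (h : ∀ d, A d ⟶ B d) (a : Profile C) :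
    tensorListHom (fun c => h (f c)) a ≫ tensorListPull f B a =
      tensorListPull f A a ≫ tensorListHom h (List.map f a) := by
  rw [tensorListPull, tensorListPull, tensorListHom_map, tensorListMap_hom]
  simp

theorem StarOperad.Hom.pull_map {A B : Algebra P.toOperad} (h : A ⟶ B) (t : C) (a : Profile C) :
    Φ.pullAct A t a ≫ h.hom (Φ.f t) =
      O.ops.val (t, a) ◁ tensorListHom (fun c => h.hom (Φ.f c)) a ≫ Φ.pullAct B t a := by
  have e := pull_step_hom (x := 𝟙 (O.ops.val (t, a))) (s := (Φ.φ t).app a)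
    (s' := (Φ.φ t).app a) (u := 𝟙 _) (by simp)
    (tensorListPull_hom Φ.f h.hom a) (m' := B.act (Φ.f t) (List.map Φ.f a)) rfl
  rw [id_tensorHom, id_tensorHom] at e
  refine Eq.trans ?_ e.symm
  exact (Category.assoc _ _ _).trans (congrArg _ (h.act_hom _ _))

/-- The pullback functor `(f, φ)^* : Alg(P) ⥤ Alg(O)`. -/
def StarOperad.Hom.pullFunctor : Algebra P.toOperad ⥤ Algebra O.toOperad where
  obj A := Φ.pull A
  map h := ⟨fun t => h.hom (Φ.f t), Φ.pull_map h⟩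
  map_id _ := rfl
  map_comp _ _ := rfl

theorem StarOperad.Hom.pull_conj (A : Algebra P.toOperad) (t : C) (a : Profile C) :
    (Φ.pull (P.conj A)).act t a = (O.conj (Φ.pull A)).act t a := by
  have h := tensorListMap_lax S.J (F := fun c => A.obj (Φ.f c)) (G := A.obj) Φ.f
    (fun c => 𝟙 (A.obj (Φ.f c))) a
  simp only [S.J.map_id] at h
  have hs := Φ.star_φ t a
  exact conj_step_hom S.J hs.symm h rfl

theorem whiskerLeft_id_step {X Y Z : M} {z : Y ⟶ Y} (h : z = 𝟙 Y) (m : X ⊗ Y ⟶ Z) :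
    X ◁ z ≫ m = m := by
  subst h
  simp

/-- The natural isomorphism `(f, φ)^* J_P ≅ J_O (f, φ)^*`, whose components are identities. -/
def StarOperad.Hom.pullComm :
    P.algInv.J ⋙ Φ.pullFunctor ≅ Φ.pullFunctor ⋙ O.algInv.J :=
  NatIso.ofComponents
    (fun A => Algebra.isoMk (A := Φ.pull (P.conj A)) (B := O.conj (Φ.pull A))
      (fun t => Iso.refl (S.J.obj (A.obj (Φ.f t))))
      (fun t a => by
        have h := tensorListHom_id (fun c => S.J.obj (A.obj (Φ.f c))) a
        rw [Φ.pull_conj A t a]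
        refine (Category.comp_id _).trans ?_
        exact (whiskerLeft_id_step h _).symm))
    (fun h => Algebra.Hom.ext (funext fun t => by
      exact (Category.comp_id _).trans (Category.id_comp _).symm))

/-- The pullback functor as an involutive functor `(Alg(P), J_P, j_P) ⟶ (Alg(O), J_O, j_O)`, whose
structure transformation is the identity. -/
def StarOperad.Hom.pullback : InvFunctor P.algInv O.algInv where
  functor := Φ.pullFunctor
  ν := Φ.pullComm.hom
  map_j A := Algebra.Hom.ext (funext fun t => by
    change S.j.hom.app (A.obj (Φ.f t)) ≫ 𝟙 _ ≫ S.J.map (𝟙 (S.J.obj (A.obj (Φ.f t)))) =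
      S.j.hom.app (A.obj (Φ.f t))
    simp)

end Pullback

end Operads

end StarOp

namespace StarOp

/-! ### Epimorphisms and reflexive coequalizers under tensor products -/

section Closed

variable {M : Type u} [Category.{v} M] [MonoidalCategory M] [MonoidalClosed M]

/-! The involutive half of the theorem is formal. If the structure transformation of an involutive
functor `R` is invertible and `F ⊣ R`, then the mate of its inverse makes `F` involutive, and the
unit and counit are involutive. All these identities are checked after transposition along the
adjunction, where the mate is governed by `unit_mate`. For the pullback functor the structure
transformation has identity components, so the mate is `λ`. An involutive adjunction then passes to
`*`-objects with the same unit and counit.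

What remains is a left adjoint of the pullback functor, obtained from the adjoint triangle theorem.
Pulling back and then forgetting to colored objects is the same as forgetting and then reindexing
along the map of colors. Reindexing has a left adjoint (coproducts over fibres,
`comap_isRightAdjoint`), and so has the forgetful functor (`freeAdjunction`). The theorem also asks
that every algebra be a regular quotient of a free one (`counitRegularEpi`) and that algebras have
reflexive coequalizers. The latter are computed color by color: since the tensor product is closed
and the pairs have common sections, finite tensor products of the coequalizers still have the
factorization property needed to descend the action (`exists_desc_tensorListHom`).

The bulk of the work is the free algebra. In color `t` it is the colimit of `O (t ; a) ⊗ X a₁ ⊗ … ⊗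
X aₘ` over the profiles `a`, modulo permutations of inputs. Tensor products preserve these colimits
in each variable, so a map out of a tensor product of free objects is given by an invariant family
on generating terms (`exists_orbitsDesc_tensorList`), and equations can be tested there
(`FibrewiseEpi.tensorList`). On generating terms the action shuffles operations away from labels and
composes the operations; the algebra axioms become the operad axioms together with naturality, unit
and associativity laws of the shuffle.

Permutations act on tensor products through words in transpositions. The colimit is therefore taken
over words, so that it is never needed that the action of a word depends only on its permutation.
Diagram chases are isolated in lemmas about arbitrary objects, named with `step`, and fed into
inductions over lists; `tensorListCast` mediates between lists that agree only propositionally. -/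

theorem epi_whiskerLeft (X : M) {A B : M} (f : A ⟶ B) [Epi f] : Epi (X ◁ f) where
  left_cancellation g h e := by
    apply MonoidalClosed.curry_injective
    rw [← cancel_epi f, ← MonoidalClosed.curry_natural_left, ← MonoidalClosed.curry_natural_left, e]

/-- Tensoring with `X` is a left adjoint, so factorizations may be found after currying. Only
existence is recorded; uniqueness is supplied separately by epimorphisms. -/
theorem exists_whiskerLeft_desc {X A B Q : M} {f g : A ⟶ B} {p : B ⟶ Q}
    (hp : ∀ {Z : M} (m : B ⟶ Z), f ≫ m = g ≫ m → ∃ k, p ≫ k = m) {Z : M} (m : X ⊗ B ⟶ Z)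
    (h : X ◁ f ≫ m = X ◁ g ≫ m) : ∃ k, X ◁ p ≫ k = m := by
  obtain ⟨k, hk⟩ := hp (MonoidalClosed.curry m) (by
    rw [← MonoidalClosed.curry_natural_left, h, MonoidalClosed.curry_natural_left])
  refine ⟨MonoidalClosed.uncurry k, ?_⟩
  rw [← MonoidalClosed.uncurry_natural_left, hk, MonoidalClosed.uncurry_curry]

variable [SymmetricCategory M]

theorem epi_whiskerRight (X : M) {A B : M} (f : A ⟶ B) [Epi f] : Epi (f ▷ X) := by
  have := epi_whiskerLeft X f
  have e : f ▷ X = (β_ A X).hom ≫ X ◁ f ≫ (β_ B X).inv := by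
    rw [BraidedCategory.braiding_inv_naturality_right, Iso.hom_inv_id_assoc]
  rw [e]
  infer_instance

theorem epi_tensorListHom {K : Type w} {F G : K → M} (φ : ∀ k, F k ⟶ G k) [∀ k, Epi (φ k)]
    (l : List K) : Epi (tensorListHom φ l) := by
  induction l with
  | nil => exact inferInstanceAs (Epi (𝟙 (𝟙_ M)))
  | cons k l ih =>
    have h1 := epi_whiskerRight (tensorList F l) (φ k)
    have h2 := epi_whiskerLeft (G k) (tensorListHom φ l)
    change Epi (φ k ⊗ₘ tensorListHom φ l)
    rw [MonoidalCategory.tensorHom_def]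
    infer_instance

/-- The common sections split the condition on the pair `f ⊗ₘ f'`, `g ⊗ₘ g'` into one condition per
factor. The morphism then descends along `p'` and along `p` in turn. -/
theorem exists_desc_tensorHom {A A' B B' Q Q' X Z : M} {f g : A ⟶ B} {s : B ⟶ A} {p : B ⟶ Q}
    {f' g' : A' ⟶ B'} {s' : B' ⟶ A'} {p' : B' ⟶ Q'} [Epi p'] (hf : s ≫ f = 𝟙 _)
    (hg : s ≫ g = 𝟙 _) (hf' : s' ≫ f' = 𝟙 _) (hg' : s' ≫ g' = 𝟙 _)
    (hp : ∀ {Z : M} (m : B ⟶ Z), f ≫ m = g ≫ m → ∃ n, p ≫ n = m)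
    (hp' : ∀ {X Z : M} (m : X ⊗ B' ⟶ Z), X ◁ f' ≫ m = X ◁ g' ≫ m → ∃ n, X ◁ p' ≫ n = m)
    (m : X ⊗ B ⊗ B' ⟶ Z) (h : X ◁ (f ⊗ₘ f') ≫ m = X ◁ (g ⊗ₘ g') ≫ m) :
    ∃ n, X ◁ (p ⊗ₘ p') ≫ n = m := by
  -- Reflexivity enters here: the section `s` is a common right inverse, so precomposing with it
  -- replaces `f` and `g` by the identity.
  have h1 : X ◁ B ◁ f' ≫ m = X ◁ B ◁ g' ≫ m := by
    have := congrArg (X ◁ (s ▷ A') ≫ ·) h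
    simpa only [← whiskerLeft_comp_assoc, whiskerRight_comp_tensorHom, hf, hg,
      id_tensorHom] using this
  have h2 : X ◁ f ▷ B' ≫ m = X ◁ g ▷ B' ≫ m := by
    have := congrArg (X ◁ (A ◁ s') ≫ ·) h
    simpa only [← whiskerLeft_comp_assoc, whiskerLeft_comp_tensorHom, hf', hg',
      tensorHom_id] using this
  -- Descend in the second factor first. The result still identifies `f` and `g`, because `p'`
  -- remains epi after tensoring.
  obtain ⟨n, hn⟩ := hp' (X := X ⊗ B) ((α_ _ _ _).hom ≫ m) (by
    rw [associator_naturality_right_assoc, associator_naturality_right_assoc, h1])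
  have e (t : A ⟶ B) : (X ⊗ A) ◁ p' ≫ (X ◁ t) ▷ Q' ≫ n = (α_ _ _ _).hom ≫ X ◁ t ▷ B' ≫ m := by
    rw [whisker_exchange_assoc, hn, associator_naturality_middle_assoc]
  have h3 : (X ◁ f) ▷ Q' ≫ n = (X ◁ g) ▷ Q' ≫ n := by
    have := epi_whiskerLeft (X ⊗ A) p'
    rw [← cancel_epi ((X ⊗ A) ◁ p'), e, e, h2]
  have e' (t : A ⟶ B) : (X ⊗ Q') ◁ t ≫ (α_ _ _ _).hom ≫ X ◁ (β_ _ _).hom ≫ (α_ _ _ _).inv ≫ n =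
      (α_ _ _ _).hom ≫ X ◁ (β_ _ _).hom ≫ (α_ _ _ _).inv ≫ (X ◁ t) ▷ Q' ≫ n := by
    rw [associator_naturality_right_assoc, ← whiskerLeft_comp_assoc,
      BraidedCategory.braiding_naturality_right, whiskerLeft_comp_assoc,
      associator_inv_naturality_middle_assoc]
  -- The braiding moves the first factor to the last place, where the closed structure applies.
  obtain ⟨r, hr⟩ := exists_whiskerLeft_desc hp
    ((α_ X Q' B).hom ≫ X ◁ (β_ Q' B).hom ≫ (α_ X B Q').inv ≫ n) (by rw [e', e', h3])
  refine ⟨X ◁ (β_ Q Q').hom ≫ (α_ X Q' Q).inv ≫ r, ?_⟩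
  rw [← whiskerLeft_comp_assoc, BraidedCategory.braiding_naturality, whiskerLeft_comp_assoc,
    MonoidalCategory.tensorHom_def, whiskerLeft_comp_assoc, associator_inv_naturality_right_assoc,
    hr, associator_inv_naturality_middle_assoc, associator_naturality_middle_assoc,
    Iso.inv_hom_id_assoc, ← whiskerLeft_comp_assoc, ← whiskerLeft_comp_assoc, Category.assoc,
    BraidedCategory.braiding_naturality_left, SymmetricCategory.symmetry_assoc,
    associator_inv_naturality_right_assoc, hn, Iso.inv_hom_id_assoc]

/-- The context `X` is quantified inside the induction because each step absorbs the head of the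
list into it. -/
theorem exists_desc_tensorListHom {K : Type w} {A B Q : K → M} (f g : ∀ k, A k ⟶ B k)
    (s : ∀ k, B k ⟶ A k) (p : ∀ k, B k ⟶ Q k) [∀ k, Epi (p k)] (hf : ∀ k, s k ≫ f k = 𝟙 _)
    (hg : ∀ k, s k ≫ g k = 𝟙 _)
    (hp : ∀ k {Z : M} (m : B k ⟶ Z), f k ≫ m = g k ≫ m → ∃ n, p k ≫ n = m) (l : List K) :
    ∀ {X Z : M} (m : X ⊗ tensorList B l ⟶ Z),
      X ◁ tensorListHom f l ≫ m = X ◁ tensorListHom g l ≫ m →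
        ∃ n, X ◁ tensorListHom p l ≫ n = m := by
  have hs : ∀ {h : ∀ k, A k ⟶ B k} (_ : ∀ k, s k ≫ h k = 𝟙 _) (l : List K),
      tensorListHom s l ≫ tensorListHom h l = 𝟙 _ := fun h l => by
    rw [← tensorListHom_comp, ← tensorListHom_id]
    congr 1
    exact funext h
  induction l with
  | nil => exact fun m _ => ⟨m, whiskerLeft_id_step rfl m⟩
  | cons k l ih =>
    intro X Z m h
    have := epi_tensorListHom p l
    exact exists_desc_tensorHom (hf k) (hg k) (hs hf l) (hs hg l) (hp k) ih m h

end Closed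

/-! ### Naturality of concatenation, shuffle and reordering -/

section Naturality

variable {M : Type u} [Category.{v} M] [MonoidalCategory M] {K : Type w} {K' : Type w}

theorem append_step {A A' X X' Y Y' Z Z' : M} {a : X ⊗ Y ⟶ Z} {a' : X' ⊗ Y' ⟶ Z'} {f : A ⟶ A'}
    {x : X ⟶ X'} {y : Y ⟶ Y'} {z : Z ⟶ Z'} (h : a ≫ z = (x ⊗ₘ y) ≫ a') :
    ((α_ A X Y).hom ≫ A ◁ a) ≫ (f ⊗ₘ z) = ((f ⊗ₘ x) ⊗ₘ y) ≫ (α_ A' X' Y').hom ≫ A' ◁ a' := by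
  rw [associator_naturality_assoc, Category.assoc, whiskerLeft_comp_tensorHom, h,
    ← id_tensorHom, tensorHom_comp_tensorHom, Category.comp_id]

theorem tensorListAppend_natural {F G : K → M} (φ : ∀ k, F k ⟶ G k) (l l' : List K) :
    tensorListAppend F l l' ≫ tensorListHom φ (l ++ l') =
      (tensorListHom φ l ⊗ₘ tensorListHom φ l') ≫ tensorListAppend G l l' := by
  induction l with
  | nil =>
    change (λ_ _).hom ≫ tensorListHom φ l' = (𝟙 (𝟙_ M) ⊗ₘ tensorListHom φ l') ≫ (λ_ _).hom
    rw [id_tensorHom, leftUnitor_naturality]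
  | cons k l ih => exact append_step ih

/-- This and the next two lemmas are the diagram chases transferring the algebra axioms along a
projection `p`; the operations are left untouched and only the inputs are projected. -/
theorem quotient_step_equivariance {X X' Y Y' Z Z' A B : M} {x : X ⟶ X'} {y : Y ⟶ Y'} {z : Z ⟶ Z'}
    {y' : Z ⟶ Y} {z' : Z' ⟶ Y'} (h : y' ≫ y = z ≫ z') {m : X ⊗ Z ⟶ A} {m' : X' ⊗ Z' ⟶ A}
    (hm : (x ⊗ₘ z) ≫ m' = m) {p : A ⟶ B} {n : X ⊗ Y ⟶ B} {n' : X' ⊗ Y' ⟶ B}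
    (hn : X ◁ y' ≫ n = m ≫ p) (hn' : X' ◁ z' ≫ n' = m' ≫ p) :
    X ◁ y' ≫ (x ⊗ₘ y) ≫ n' = X ◁ y' ≫ n := by
  rw [hn, ← hm, Category.assoc, ← hn', whiskerLeft_comp_tensorHom_assoc, h,
    ← id_tensorHom X', tensorHom_comp_tensorHom_assoc, Category.comp_id]

theorem quotient_step_one {X A Q : M} {e : 𝟙_ M ⟶ X} {p : A ⟶ Q} {m : X ⊗ (A ⊗ 𝟙_ M) ⟶ A}
    {n : X ⊗ (Q ⊗ 𝟙_ M) ⟶ Q} (hn : X ◁ (p ⊗ₘ 𝟙 (𝟙_ M)) ≫ n = m ≫ p)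
    (h : (λ_ A).inv ≫ (e ⊗ₘ (ρ_ A).inv) ≫ m = 𝟙 A) :
    p ≫ (λ_ Q).inv ≫ (e ⊗ₘ (ρ_ Q).inv) ≫ n = p ≫ 𝟙 Q := by
  have h1 : p ≫ (λ_ Q).inv ≫ (e ⊗ₘ (ρ_ Q).inv) ≫ n =
      (λ_ A).inv ≫ (e ⊗ₘ (ρ_ A).inv) ≫ X ◁ (p ⊗ₘ 𝟙 (𝟙_ M)) ≫ n := by
    rw [leftUnitor_inv_naturality_assoc, whiskerLeft_comp_tensorHom_assoc,
      rightUnitor_inv_naturality, tensorHom_id, tensorHom_comp_whiskerLeft_assoc]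
  rw [h1, hn, reassoc_of% h, Category.comp_id]

theorem quotient_step_assoc {X V W R Q Z W' R' Q' B B' : M} {sh : R ⟶ V ⊗ W}
    {sh' : R' ⟶ V ⊗ W'} {r : R ⟶ R'} {w : W ⟶ W'} (hsh : sh ≫ V ◁ w = r ≫ sh') {c : X ⊗ V ⟶ Z}
    {m : Z ⊗ W ⟶ B} {m' : Z ⊗ W' ⟶ B'} {p : B ⟶ B'} (hm : Z ◁ w ≫ m' = m ≫ p)
    {k : R ⟶ Q} {k' : R' ⟶ Q'} {q : Q ⟶ Q'} (hk : r ≫ k' = k ≫ q) {n : X ⊗ Q ⟶ B}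
    {n' : X ⊗ Q' ⟶ B'} (hn : X ◁ q ≫ n' = n ≫ p)
    (h : X ◁ sh ≫ (α_ X V W).inv ≫ c ▷ W ≫ m = X ◁ k ≫ n) :
    X ◁ r ≫ X ◁ sh' ≫ (α_ X V W').inv ≫ c ▷ W' ≫ m' = X ◁ r ≫ X ◁ k' ≫ n' := by
  rw [← whiskerLeft_comp_assoc, ← hsh, whiskerLeft_comp_assoc,
    associator_inv_naturality_right_assoc, whisker_exchange_assoc, hm, reassoc_of% h,
    ← whiskerLeft_comp_assoc, hk, whiskerLeft_comp_assoc, hn]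

variable [SymmetricCategory M]

theorem tensorListShuffle_natural {F F' : K → M} (φ : ∀ k, F k ⟶ F' k) {G G' : K' → M}
    (ψ : ∀ k, G k ⟶ G' k) (s : K → List K') (l : List K) :
    tensorListShuffle F G s l ≫ (tensorListHom φ l ⊗ₘ tensorListHom ψ (l.flatMap s)) =
      tensorListHom (fun k => φ k ⊗ₘ tensorListHom ψ (s k)) l ≫ tensorListShuffle F' G' s l := by
  induction l with
  | nil =>
    change (λ_ (𝟙_ M)).inv ≫ (𝟙 (𝟙_ M) ⊗ₘ 𝟙 (𝟙_ M)) = 𝟙 (𝟙_ M) ≫ (λ_ (𝟙_ M)).inv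
    simp
  | cons k l ih => exact shuffle_step (tensorListAppend_natural ψ (s k) (l.flatMap s)) ih

theorem swap_step {A B A' B' X Y : M} (f : A ⟶ A') (g : B ⟶ B') (x : X ⟶ Y) :
    (f ⊗ₘ (g ⊗ₘ x)) ≫ (α_ A' B' Y).inv ≫ (β_ A' B').hom ▷ Y ≫ (α_ B' A' Y).hom =
      ((α_ A B X).inv ≫ (β_ A B).hom ▷ X ≫ (α_ B A X).hom) ≫ (g ⊗ₘ (f ⊗ₘ x)) := by
  rw [associator_inv_naturality_assoc, tensorHom_comp_whiskerRight_assoc,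
    BraidedCategory.braiding_naturality]
  simp only [Category.assoc]
  rw [← associator_naturality, whiskerRight_comp_tensorHom_assoc]

theorem Reorder.tensor_natural {E : K → K → Type w} {F G : K → M}
    {φ : ∀ {k k' : K}, E k k' → (F k ⟶ F k')} {ψ : ∀ {k k' : K}, E k k' → (G k ⟶ G k')}
    (η : ∀ k, F k ⟶ G k) (h : ∀ {k k' : K} (e : E k k'), φ e ≫ η k' = η k ≫ ψ e)
    {l l' : List K} (r : Reorder E l l') :
    tensorListHom η l ≫ r.tensor G ψ = r.tensor F φ ≫ tensorListHom η l' := by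
  induction r with
  | refl l => exact (Category.comp_id _).trans (Category.id_comp _).symm
  | cons k r ih =>
    change (η k ⊗ₘ _) ≫ G k ◁ _ = F k ◁ _ ≫ (η k ⊗ₘ _)
    rw [whiskerLeft_comp_tensorHom, ← id_tensorHom, tensorHom_comp_tensorHom, Category.comp_id, ih]
  | swap k k' l => exact swap_step _ _ _
  | act e l =>
    change (η _ ⊗ₘ _) ≫ ψ e ▷ _ = φ e ▷ _ ≫ (η _ ⊗ₘ _)
    rw [whiskerRight_comp_tensorHom, ← tensorHom_id, tensorHom_comp_tensorHom, Category.comp_id, h]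
  | trans r r' ih ih' =>
    change _ ≫ (_ ≫ _) = (_ ≫ _) ≫ _
    rw [reassoc_of% ih, ih', Category.assoc]

theorem PermWord.tensor_natural {C : Type v} {A B : C → M} (η : ∀ c, A c ⟶ B c)
    {a b : Profile C} (r : PermWord C a b) :
    tensorListHom η a ≫ r.tensor B = r.tensor A ≫ tensorListHom η b :=
  Reorder.tensor_natural η (fun e => e.elim) r

end Naturality

/-! ### Reflexive coequalizers of algebras -/

section ReflexiveCoequalizers

variable {M : Type u} [Category.{v} M] [MonoidalCategory M] [SymmetricCategory M]
  [MonoidalClosed M] {C : Type v} {O : Operad M C}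

/-- The algebra structure on a levelwise quotient of an algebra. -/
def Algebra.quotient (B : Algebra O) {Q : C → M} (p : ∀ c, B.obj c ⟶ Q c) [∀ c, Epi (p c)]
    (act : ∀ (t : C) (a : Profile C), O.ops.val (t, a) ⊗ tensorList Q a ⟶ Q t)
    (h : ∀ t a, O.ops.val (t, a) ◁ tensorListHom p a ≫ act t a = B.act t a ≫ p t) :
    Algebra O where
  obj := Q
  act := act
  equivariance t a b r := by
    have := epi_tensorListHom p a
    have := epi_whiskerLeft (O.ops.val (t, a)) (tensorListHom p a)
    rw [← cancel_epi (O.ops.val (t, a) ◁ tensorListHom p a)]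
    exact quotient_step_equivariance (PermWord.tensor_natural p r) (B.equivariance t r)
      (h t a) (h t b)
  one_act t := by
    rw [← cancel_epi (p t)]
    exact quotient_step_one (h t [t]) (B.one_act t)
  assoc t L := by
    have (q : Arity C) : Epi (O.ops.val q ◁ tensorListHom p q.2) :=
      have := epi_tensorListHom p q.2
      epi_whiskerLeft _ _
    have := epi_tensorListHom (fun q : Arity C => O.ops.val q ◁ tensorListHom p q.2) L
    have := epi_whiskerLeft (O.ops.val (t, outputs L))
      (tensorListHom (fun q : Arity C => O.ops.val q ◁ tensorListHom p q.2) L)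
    rw [← cancel_epi (O.ops.val (t, outputs L) ◁
      (tensorListHom (fun q : Arity C => O.ops.val q ◁ tensorListHom p q.2) L))]
    have hsh := tensorListShuffle_natural (fun q => 𝟙 (O.ops.val q)) p Prod.snd L
    simp only [tensorListHom_id, id_tensorHom] at hsh
    refine quotient_step_assoc hsh (h t (inputs L)) ?_ (h t (outputs L)) (B.assoc t L)
    rw [tensorListHom_map]
    simp only [h]
    exact (tensorListMap_hom (F := fun q : Arity C => O.ops.val q ⊗ tensorList B.obj q.2)
      Prod.fst (fun q => B.act q.1 q.2) p L).symm

/-- The projection onto a levelwise quotient of an algebra. -/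
def Algebra.quotientMap (B : Algebra O) {Q : C → M} (p : ∀ c, B.obj c ⟶ Q c) [∀ c, Epi (p c)]
    (act : ∀ (t : C) (a : Profile C), O.ops.val (t, a) ⊗ tensorList Q a ⟶ Q t)
    (h : ∀ t a, O.ops.val (t, a) ◁ tensorListHom p a ≫ act t a = B.act t a ≫ p t) :
    B ⟶ B.quotient p act h :=
  ⟨p, fun t a => (h t a).symm⟩

/-- A levelwise factorization of a morphism of algebras through a levelwise epimorphic morphism of
algebras is a morphism of algebras. -/
theorem Algebra.act_hom_of_epi {A B Z : Algebra O} (p : A ⟶ B) [∀ c, Epi (p.hom c)] (g : A ⟶ Z)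
    (k : ∀ c, B.obj c ⟶ Z.obj c) (hk : ∀ c, p.hom c ≫ k c = g.hom c) (t : C) (a : Profile C) :
    B.act t a ≫ k t = O.ops.val (t, a) ◁ tensorListHom k a ≫ Z.act t a := by
  have := epi_tensorListHom p.hom a
  have := epi_whiskerLeft (O.ops.val (t, a)) (tensorListHom p.hom a)
  rw [← cancel_epi (O.ops.val (t, a) ◁ tensorListHom p.hom a), ← Category.assoc,
    ← p.act_hom, Category.assoc, hk, g.act_hom, ← whiskerLeft_comp_assoc, ← tensorListHom_comp]
  simp only [hk]

/-- The coequalizer is formed in each color. The action descends because the pair has a common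
section; the algebra axioms and the universal property follow since the projection is epi in each
color. -/
instance [Limits.HasCoequalizers M] : Limits.HasReflexiveCoequalizers (Algebra O) where
  has_coeq A B f g _ := by
    obtain ⟨s, hf, hg⟩ := IsReflexivePair.common_section f g
    have hf (c : C) : s.hom c ≫ f.hom c = 𝟙 _ := congrFun (congrArg Algebra.Hom.hom hf) c
    have hg (c : C) : s.hom c ≫ g.hom c = 𝟙 _ := congrFun (congrArg Algebra.Hom.hom hg) c
    let p (c : C) := Limits.coequalizer.π (f.hom c) (g.hom c)
    have hp (c : C) {Z : M} (m : B.obj c ⟶ Z) (h : f.hom c ≫ m = g.hom c ≫ m) :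
        ∃ n, p c ≫ n = m := ⟨Limits.coequalizer.desc m h, Limits.coequalizer.π_desc m h⟩
    -- Acting and then projecting coequalizes the tensor products of `f` and `g`, because both are
    -- morphisms of algebras.
    have H (t : C) (a : Profile C) := exists_desc_tensorListHom f.hom g.hom s.hom p hf hg hp a
      (X := O.ops.val (t, a)) (B.act t a ≫ p t) (by
        rw [← reassoc_of% f.act_hom t a, ← reassoc_of% g.act_hom t a, Limits.coequalizer.condition])
    choose act h using H
    refine ⟨⟨⟨Limits.Cofork.ofπ (B.quotientMap p act h) ?_, Limits.Cofork.IsColimit.mk' _ ?_⟩⟩⟩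
    · exact Algebra.Hom.ext (funext fun c => Limits.coequalizer.condition _ _)
    · intro z
      have hz (c : C) : f.hom c ≫ z.π.hom c = g.hom c ≫ z.π.hom c :=
        congrFun (congrArg Algebra.Hom.hom z.condition) c
      have (c : C) : Epi ((B.quotientMap p act h).hom c) := inferInstanceAs (Epi (p c))
      refine ⟨⟨fun c => Limits.coequalizer.desc (z.π.hom c) (hz c),
        Algebra.act_hom_of_epi (B.quotientMap p act h) z.π _
          fun c => Limits.coequalizer.π_desc _ (hz c)⟩,
        Algebra.Hom.ext (funext fun c => Limits.coequalizer.π_desc _ (hz c)), ?_⟩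
      intro m hm
      refine Algebra.Hom.ext (funext fun c => ?_)
      apply Limits.coequalizer.hom_ext
      exact (congrFun (congrArg Algebra.Hom.hom hm) c).trans
        (Limits.coequalizer.π_desc _ (hz c)).symm

end ReflexiveCoequalizers
-- Block permutations, computed on positions
namespace Profile

variable {C : Type v}

theorem posAppend_inl_val (a b : Profile C) (i : Fin a.length) :
    (posAppend a b (Sum.inl i)).val = i.val := by
  simp [posAppend]

theorem posAppend_inr_val (a b : Profile C) (i : Fin b.length) :
    (posAppend a b (Sum.inr i)).val = a.length + i.val := by
  simp [posAppend]

theorem append_e_inl {a a' b b' : Profile C} (σ : a ⟶ a') (τ : b ⟶ b') (i : Fin a.length) :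
    (append σ τ).e (posAppend a b (Sum.inl i)) = posAppend a' b' (Sum.inl (σ.e i)) := by
  simp only [append, Equiv.trans_apply, Equiv.symm_apply_apply]
  rfl

theorem append_e_inr {a a' b b' : Profile C} (σ : a ⟶ a') (τ : b ⟶ b') (i : Fin b.length) :
    (append σ τ).e (posAppend a b (Sum.inr i)) = posAppend a' b' (Sum.inr (τ.e i)) := by
  simp only [append, Equiv.trans_apply, Equiv.symm_apply_apply]
  rfl

theorem blockSwap_e_inl (a b l : Profile C) (i : Fin a.length) :
    (blockSwap a b l).e (posAppend a (b ++ l) (Sum.inl i)) =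
      posAppend b (a ++ l) (Sum.inr (posAppend a l (Sum.inl i))) := by
  simp only [blockSwap, Equiv.trans_apply, Equiv.symm_apply_apply]
  rfl

theorem blockSwap_e_mid (a b l : Profile C) (i : Fin b.length) :
    (blockSwap a b l).e (posAppend a (b ++ l) (Sum.inr (posAppend b l (Sum.inl i)))) =
      posAppend b (a ++ l) (Sum.inl i) := by
  simp only [blockSwap, Equiv.trans_apply, Equiv.symm_apply_apply, Equiv.sumCongr_apply,
    Sum.map_inr]
  rfl

theorem blockSwap_e_inr (a b l : Profile C) (i : Fin l.length) :
    (blockSwap a b l).e (posAppend a (b ++ l) (Sum.inr (posAppend b l (Sum.inr i)))) =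
      posAppend b (a ++ l) (Sum.inr (posAppend a l (Sum.inr i))) := by
  simp only [blockSwap, Equiv.trans_apply, Equiv.symm_apply_apply, Equiv.sumCongr_apply,
    Sum.map_inr]
  rfl

/-- Values and an auxiliary position `j` are used so that profiles bracketed differently can be
compared by arithmetic, without transport. -/
theorem append_val_lt {a a' b b' : Profile C} (σ : a ⟶ a') (τ : b ⟶ b')
    (i : Fin (a ++ b).length) (j : Fin a.length) (h : i.val = j.val) :
    ((append σ τ).e i).val = (σ.e j).val := by
  obtain rfl : i = posAppend a b (Sum.inl j) := Fin.ext (h.trans (posAppend_inl_val a b j).symm)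
  rw [append_e_inl, posAppend_inl_val]

theorem append_val_ge {a a' b b' : Profile C} (σ : a ⟶ a') (τ : b ⟶ b')
    (i : Fin (a ++ b).length) (j : Fin b.length) (h : i.val = a.length + j.val) :
    ((append σ τ).e i).val = a'.length + (τ.e j).val := by
  obtain rfl : i = posAppend a b (Sum.inr j) := Fin.ext (h.trans (posAppend_inr_val a b j).symm)
  rw [append_e_inr, posAppend_inr_val]

theorem blockSwap_val_lt (a b l : Profile C) (i : Fin (a ++ (b ++ l)).length)
    (h : i.val < a.length) : ((blockSwap a b l).e i).val = b.length + i.val := by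
  obtain ⟨j, hj⟩ : ∃ j, i = posAppend a (b ++ l) (Sum.inl j) :=
    ⟨⟨i.val, h⟩, Fin.ext (by rw [posAppend_inl_val])⟩
  have hv := congrArg Fin.val hj
  rw [posAppend_inl_val] at hv
  rw [hj, blockSwap_e_inl, posAppend_inr_val, posAppend_inl_val, posAppend_inl_val]

theorem blockSwap_val_mid (a b l : Profile C) (i : Fin (a ++ (b ++ l)).length)
    (h : a.length ≤ i.val) (h' : i.val < a.length + b.length) :
    ((blockSwap a b l).e i).val = i.val - a.length := by
  obtain ⟨j, hj⟩ : ∃ j, i = posAppend a (b ++ l) (Sum.inr (posAppend b l (Sum.inl j))) :=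
    ⟨⟨i.val - a.length, by omega⟩, Fin.ext (by
      rw [posAppend_inr_val, posAppend_inl_val]
      simp only
      omega)⟩
  rw [hj, blockSwap_e_mid, posAppend_inr_val, posAppend_inl_val, posAppend_inl_val]
  omega

theorem blockSwap_val_ge (a b l : Profile C) (i : Fin (a ++ (b ++ l)).length)
    (h : a.length + b.length ≤ i.val) : ((blockSwap a b l).e i).val = i.val := by
  have hi := i.2
  simp only [List.length_append] at hi
  obtain ⟨j, hj⟩ : ∃ j, i = posAppend a (b ++ l) (Sum.inr (posAppend b l (Sum.inr j))) :=
    ⟨⟨i.val - a.length - b.length, by omega⟩, Fin.ext (by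
      rw [posAppend_inr_val, posAppend_inr_val]
      simp only
      omega)⟩
  rw [hj, blockSwap_e_inr, posAppend_inr_val, posAppend_inr_val, posAppend_inr_val,
    posAppend_inr_val]
  omega

theorem length_eq {a b : Profile C} (σ : a ⟶ b) : a.length = b.length := by
  simpa using Fintype.card_congr σ.e

/-- Case distinction on the positions of a concatenation. -/
theorem pos_cases {a b : Profile C} (i : Fin (a ++ b).length) :
    (∃ j : Fin a.length, i.val = j.val) ∨ ∃ j : Fin b.length, i.val = a.length + j.val := by
  have hi := i.2
  simp only [List.length_append] at hi
  by_cases h : i.val < a.length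
  · exact Or.inl ⟨⟨i.val, h⟩, rfl⟩
  · refine Or.inr ⟨⟨i.val - a.length, by omega⟩, ?_⟩
    simp only
    omega

theorem append_comp {a a' a'' b b' b'' : Profile C} (σ : a ⟶ a') (σ' : a' ⟶ a'') (τ : b ⟶ b')
    (τ' : b' ⟶ b'') : append (σ ≫ σ') (τ ≫ τ') = append σ τ ≫ append σ' τ' := by
  apply hom_ext
  intro i
  obtain ⟨x, rfl⟩ := (posAppend a b).surjective i
  rcases x with i | i
  · rw [append_e_inl]
    exact ((congrArg _ (append_e_inl σ τ i)).trans (append_e_inl σ' τ' _)).symm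
  · rw [append_e_inr]
    exact ((congrArg _ (append_e_inr σ τ i)).trans (append_e_inr σ' τ' _)).symm

theorem append_id (a b : Profile C) : append (𝟙 a) (𝟙 b) = 𝟙 (a ++ b : Profile C) := by
  apply hom_ext
  intro i
  obtain ⟨x, rfl⟩ := (posAppend a b).surjective i
  rcases x with i | i
  · rw [append_e_inl]; rfl
  · rw [append_e_inr]; rfl

/-- The two source profiles differ by bracketing, hence the two positions of equal value. When the
first block is a single color the bracketings agree definitionally, which yields the two equalities
of morphisms that follow. -/
theorem append_assoc_val {a a' b b' c c' : Profile C} (σ : a ⟶ a') (τ : b ⟶ b') (ρ : c ⟶ c')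
    (i : Fin (a ++ (b ++ c)).length) (j : Fin ((a ++ b) ++ c).length) (h : i.val = j.val) :
    ((append σ (append τ ρ)).e i).val = ((append (append σ τ) ρ).e j).val := by
  have hl := length_eq σ
  rcases pos_cases i with ⟨k, hk⟩ | ⟨k, hk⟩
  · rw [append_val_lt _ _ i k hk, append_val_lt _ _ j (posAppend a b (Sum.inl k))
      (by rw [posAppend_inl_val]; omega), append_val_lt _ _ _ k (posAppend_inl_val _ _ _)]
  · rw [append_val_ge _ _ i k hk]
    rcases pos_cases k with ⟨m, hm⟩ | ⟨m, hm⟩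
    · rw [append_val_lt _ _ k m hm, append_val_lt _ _ j (posAppend a b (Sum.inr m))
        (by rw [posAppend_inr_val]; omega), append_val_ge _ _ _ m (posAppend_inr_val _ _ _)]
    · rw [append_val_ge _ _ k m hm, append_val_ge _ _ j m
        (by simp only [List.length_append]; omega)]
      simp only [List.length_append]
      omega

theorem append_id_cons (c : C) (a : Profile C) {b b' : Profile C} (σ : b ⟶ b') :
    append (𝟙 ([c] : Profile C)) (append (𝟙 a) σ) =
      append (𝟙 (([c] ++ a : List C) : Profile C)) σ := by
  apply hom_ext
  intro i
  apply Fin.ext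
  rw [← append_id]
  exact append_assoc_val _ _ _ _ _ rfl

theorem append_cons_id (c : C) {a a' : Profile C} (σ : a ⟶ a') (b : Profile C) :
    append (𝟙 ([c] : Profile C)) (append σ (𝟙 b)) =
      append (append (𝟙 ([c] : Profile C)) σ) (𝟙 b) := by
  apply hom_ext
  intro i
  apply Fin.ext
  exact append_assoc_val _ _ _ _ _ rfl

theorem append_blockSwap_id (a b l m : Profile C) (i : Fin ((a ++ (b ++ l)) ++ m).length)
    (j : Fin (a ++ (b ++ (l ++ m))).length) (h : i.val = j.val) :
    ((append (blockSwap a b l) (𝟙 m)).e i).val = ((blockSwap a b (l ++ m)).e j).val := by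
  rcases pos_cases i with ⟨k, hk⟩ | ⟨k, hk⟩
  · rw [append_val_lt _ _ i k hk]
    by_cases h1 : k.val < a.length
    · rw [blockSwap_val_lt _ _ _ _ h1, blockSwap_val_lt _ _ _ j (by omega)]
      omega
    · by_cases h2 : k.val < a.length + b.length
      · rw [blockSwap_val_mid _ _ _ _ (by omega) h2, blockSwap_val_mid _ _ _ j (by omega) (by omega)]
        omega
      · rw [blockSwap_val_ge _ _ _ _ (by omega), blockSwap_val_ge _ _ _ j (by omega)]
        omega
  · rw [append_val_ge _ _ i k hk]
    simp only [List.length_append] at hk ⊢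
    rw [blockSwap_val_ge _ _ _ j (by omega)]
    change _ + k.val = _
    omega

/-- A hexagon identity for permutations: moving `c` past `d` and then past `b`. It matches the
recursion of `Reorder.move`. -/
theorem blockSwap_cons_right (c d : C) (b l : Profile C) :
    blockSwap [c] [d] (b ++ l) ≫ append (𝟙 ([d] : Profile C)) (blockSwap [c] b l) =
      blockSwap [c] ([d] ++ b) l := by
  apply hom_ext
  intro i
  apply Fin.ext
  change ((append (𝟙 ([d] : Profile C)) (blockSwap [c] b l)).e _).val = _
  have hi := i.2
  simp only [List.length_append, List.length_singleton] at hi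
  -- Position 0 is the moved color `c`, position 1 is `d`; the block `b` and the tail `l` follow.
  by_cases h1 : i.val < 1
  · have e1 := blockSwap_val_lt [c] [d] (b ++ l) i h1
    simp only [List.length_singleton] at e1
    rw [append_val_ge _ _ _ ⟨0, by simp⟩ (by simp only [List.length_singleton]; omega),
      blockSwap_val_lt [c] b l _ (by simp)]
    erw [blockSwap_val_lt [c] ([d] ++ b) l i h1]
    simp only [List.length_singleton, List.length_append]
    omega
  · by_cases h2 : i.val < 2
    · have e1 := blockSwap_val_mid [c] [d] (b ++ l) i (by simp only [List.length_singleton]; omega) (by simpa using h2)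
      simp only [List.length_singleton] at e1
      rw [append_val_lt _ _ _ ⟨0, by simp⟩ (by simp only; omega)]
      erw [blockSwap_val_mid [c] ([d] ++ b) l i (by simp only [List.length_singleton]; omega) (by simp; omega)]
      simp only [List.length_singleton]
      change 0 = _
      omega
    · have e1 := blockSwap_val_ge [c] [d] (b ++ l) i (by simp; omega)
      rw [append_val_ge _ _ _ ⟨i.val - 1, by simp; omega⟩
        (by simp only [List.length_singleton]; omega)]
      by_cases h3 : i.val < b.length + 2
      · rw [blockSwap_val_mid [c] b l _ (by simp; omega) (by simp; omega)]
        erw [blockSwap_val_mid [c] ([d] ++ b) l i (by simp; omega) (by simp; omega)]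
        simp only [List.length_singleton]
        omega
      · rw [blockSwap_val_ge [c] b l _ (by simp; omega)]
        erw [blockSwap_val_ge [c] ([d] ++ b) l i (by simp; omega)]
        simp only [List.length_singleton]
        omega

/-- The other hexagon: first the block `a` passes `b`, then `c` does. It matches the recursion of
`Reorder.blockSwap`. -/
theorem blockSwap_cons_left (c : C) (a b l : Profile C) :
    append (𝟙 ([c] : Profile C)) (blockSwap a b l) ≫ blockSwap [c] b (a ++ l) =
      blockSwap ([c] ++ a) b l := by
  apply hom_ext
  intro i
  apply Fin.ext
  change ((blockSwap [c] b (a ++ l)).e _).val = _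
  have hi := i.2
  simp only [List.length_append, List.length_singleton] at hi
  by_cases h1 : i.val < 1
  · have e1 := append_val_lt (𝟙 ([c] : Profile C)) (blockSwap a b l) i ⟨0, by simp⟩
      (by simp only; omega)
    change _ = 0 at e1
    rw [blockSwap_val_lt _ _ _ _ (by rw [e1]; simp), e1]
    erw [blockSwap_val_lt ([c] ++ a) b l i (by simp; omega)]
    omega
  · have e1 := append_val_ge (𝟙 ([c] : Profile C)) (blockSwap a b l) i
      ⟨i.val - 1, by simp; omega⟩ (by simp only [List.length_singleton]; omega)
    simp only [List.length_singleton] at e1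
    by_cases h2 : i.val < 1 + a.length
    · rw [blockSwap_val_lt a b l _ (by simp only; omega)] at e1
      simp only at e1
      rw [blockSwap_val_ge _ _ _ _ (by rw [e1]; simp), e1]
      erw [blockSwap_val_lt ([c] ++ a) b l i (by simp; omega)]
      omega
    · by_cases h3 : i.val < 1 + a.length + b.length
      · rw [blockSwap_val_mid a b l _ (by simp only; omega) (by simp only; omega)] at e1
        simp only at e1
        rw [blockSwap_val_mid _ _ _ _ (by rw [e1]; simp) (by rw [e1]; simp; omega), e1]
        erw [blockSwap_val_mid ([c] ++ a) b l i (by simp; omega) (by simp; omega)]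
        simp only [List.length_append, List.length_singleton]
        omega
      · rw [blockSwap_val_ge a b l _ (by simp only; omega)] at e1
        simp only at e1
        rw [blockSwap_val_ge _ _ _ _ (by rw [e1]; simp; omega), e1]
        erw [blockSwap_val_ge ([c] ++ a) b l i (by simp; omega)]
        omega

theorem blockSwap_nil_left (b l : Profile C) :
    blockSwap [] b l = 𝟙 ((b ++ l : List C) : Profile C) := by
  apply hom_ext
  intro i
  apply Fin.ext
  by_cases h : i.val < b.length
  · erw [blockSwap_val_mid [] b l i (by simp) (by simpa using h)]
    rfl
  · erw [blockSwap_val_ge [] b l i (by simpa using h)]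
    rfl

theorem blockSwap_nil_right (c : C) (l : Profile C) :
    blockSwap [c] [] l = 𝟙 (([c] ++ l : List C) : Profile C) := by
  apply hom_ext
  intro i
  apply Fin.ext
  by_cases h : i.val < 1
  · erw [blockSwap_val_lt [c] [] l i (by simpa using h)]
    change _ = i.val
    simp
  · erw [blockSwap_val_ge [c] [] l i (by simp only [List.length_singleton, List.length_nil]; omega)]
    rfl

end Profile
-- Coherence for exchanging tensor factors
section Symmetric

variable {M : Type u} [Category.{v} M] [MonoidalCategory M] [SymmetricCategory M]

/-- On the right, the braiding of the pairs crosses `A` with `B'` and the interchange crosses them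
back; symmetry makes the two crossings cancel. -/
theorem tensorμ_braiding (A B A' B' : M) :
    tensorμ A B A' B' ≫ ((β_ A A').hom ⊗ₘ (β_ B B').hom) =
      (β_ (A ⊗ B) (A' ⊗ B')).hom ≫ tensorμ A' B' A B := by
  simp [tensorμ, SymmetricCategory.braiding_swap_eq_inv_braiding B' A, MonoidalCategory.tensorHom_def]

/-- Exchanging the first two factors of a tensor product of three objects. -/
def swapTwo (A B X : M) : A ⊗ (B ⊗ X) ⟶ B ⊗ (A ⊗ X) :=
  (α_ A B X).inv ≫ (β_ A B).hom ▷ X ≫ (α_ B A X).hom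

/-- Two leading pairs may be exchanged before or after separating first from second components. This
combines associativity of the interchange with `tensorμ_braiding`. -/
theorem tensorμ_swapTwo (A B A' B' V U : M) :
    (A ⊗ B) ◁ tensorμ A' B' V U ≫ tensorμ A B (A' ⊗ V) (B' ⊗ U) ≫
        (swapTwo A A' V ⊗ₘ swapTwo B B' U) =
      swapTwo (A ⊗ B) (A' ⊗ B') (V ⊗ U) ≫ (A' ⊗ B') ◁ tensorμ A B V U ≫
        tensorμ A' B' (A ⊗ V) (B ⊗ U) := by
  have h := tensor_associativity A B A' B' V U
  have h' := tensor_associativity A' B' A B V U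
  have e : swapTwo A A' V ⊗ₘ swapTwo B B' U = ((α_ A A' V).inv ⊗ₘ (α_ B B' U).inv) ≫
      ((β_ A A').hom ▷ V ⊗ₘ (β_ B B').hom ▷ U) ≫ ((α_ A' A V).hom ⊗ₘ (α_ B' B U).hom) := by
    simp [swapTwo]
  rw [← Iso.inv_comp_eq] at h h'
  rw [e, ← reassoc_of% h, tensorHom_comp_tensorHom_assoc, Iso.hom_inv_id, Iso.hom_inv_id,
    id_tensorHom_id, Category.id_comp, ← tensorμ_natural_left_assoc, ← comp_whiskerRight_assoc,
    tensorμ_braiding, comp_whiskerRight_assoc, swapTwo, Category.assoc, Category.assoc, ← h',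
    Iso.hom_inv_id_assoc]

/-- The transposition case of the compatibility of the shuffle with reorderings; `h` is the exchange
of the two blocks of labels. -/
theorem shuffle_step_swap {A B A' B' V U Z W W' T T' : M} {sh : Z ⟶ V ⊗ U} {a' : B' ⊗ U ⟶ W'}
    {b : B ⊗ W' ⟶ T} {a : B ⊗ U ⟶ W} {b' : B' ⊗ W ⟶ T'} {s : T ⟶ T'}
    (h : B ◁ a' ≫ b ≫ s = swapTwo B B' U ≫ B' ◁ a ≫ b') :
    ((A ⊗ B) ◁ ((A' ⊗ B') ◁ sh ≫ tensorμ A' B' V U ≫ (A' ⊗ V) ◁ a') ≫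
        tensorμ A B (A' ⊗ V) W' ≫ (A ⊗ (A' ⊗ V)) ◁ b) ≫ (swapTwo A A' V ⊗ₘ s) =
      swapTwo (A ⊗ B) (A' ⊗ B') Z ≫ (A' ⊗ B') ◁ ((A ⊗ B) ◁ sh ≫ tensorμ A B V U ≫
        (A ⊗ V) ◁ a) ≫ tensorμ A' B' (A ⊗ V) W ≫ (A' ⊗ (A ⊗ V)) ◁ b' := by
  have e1 : (A ⊗ B) ◁ (A' ⊗ V) ◁ a' ≫ tensorμ A B (A' ⊗ V) W' =
      tensorμ A B (A' ⊗ V) (B' ⊗ U) ≫ (A ⊗ (A' ⊗ V)) ◁ (B ◁ a') := by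
    have := tensorμ_natural_right A B (𝟙 (A' ⊗ V)) a'
    simpa using this
  have e2 : (A' ⊗ B') ◁ (A ⊗ V) ◁ a ≫ tensorμ A' B' (A ⊗ V) W =
      tensorμ A' B' (A ⊗ V) (B ⊗ U) ≫ (A' ⊗ (A ⊗ V)) ◁ (B' ◁ a) := by
    have := tensorμ_natural_right A' B' (𝟙 (A ⊗ V)) a
    simpa using this
  have e3 : (A ⊗ (A' ⊗ V)) ◁ (B ◁ a') ≫ (A ⊗ (A' ⊗ V)) ◁ b ≫ (swapTwo A A' V ⊗ₘ s) =
      (swapTwo A A' V ⊗ₘ swapTwo B B' U) ≫ (A' ⊗ (A ⊗ V)) ◁ (B' ◁ a) ≫ (A' ⊗ (A ⊗ V)) ◁ b' := by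
    rw [whiskerLeft_comp_tensorHom, whiskerLeft_comp_tensorHom, h, ← whiskerLeft_comp,
      tensorHom_comp_whiskerLeft]
  have e4 : (A ⊗ B) ◁ (A' ⊗ B') ◁ sh ≫ swapTwo (A ⊗ B) (A' ⊗ B') (V ⊗ U) =
      swapTwo (A ⊗ B) (A' ⊗ B') Z ≫ (A' ⊗ B') ◁ (A ⊗ B) ◁ sh := by
    have := swap_step (𝟙 (A ⊗ B)) (𝟙 (A' ⊗ B')) sh
    simp only [id_tensorHom] at this
    exact this
  simp only [whiskerLeft_comp, Category.assoc]
  rw [reassoc_of% e1, e3, reassoc_of% (tensorμ_swapTwo A B A' B' V U), reassoc_of% e4,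
    reassoc_of% e2]

theorem swapTwo_unit_left (A X : M) : swapTwo A (𝟙_ M) X = A ◁ (λ_ X).hom ≫ (λ_ (A ⊗ X)).inv := by
  simp [swapTwo]

theorem swapTwo_unit (A X : M) : swapTwo (𝟙_ M) A X = (λ_ (A ⊗ X)).hom ≫ A ◁ (λ_ X).inv := by
  simp [swapTwo]

/-- The hexagon identities in terms of exchanging factors. -/
theorem swapTwo_tensor_right (A B B' X : M) :
    A ◁ (α_ B B' X).hom ≫ swapTwo A B (B' ⊗ X) ≫ B ◁ swapTwo A B' X =
      swapTwo A (B ⊗ B') X ≫ (α_ B B' (A ⊗ X)).hom := by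
  simp only [swapTwo, BraidedCategory.braiding_tensor_right_hom]
  monoidal

theorem swapTwo_tensor_left (A A' B X : M) :
    (α_ A A' (B ⊗ X)).hom ≫ A ◁ swapTwo A' B X ≫ swapTwo A B (A' ⊗ X) =
      swapTwo (A ⊗ A') B X ≫ B ◁ (α_ A A' X).hom := by
  simp only [swapTwo, BraidedCategory.braiding_tensor_left_hom]
  monoidal

end Symmetric

/-! ### Words reordering concatenated blocks -/

section Words

variable {K : Type w} {E : K → K → Type w}

/-- A reordering of the end of a list. -/
def Reorder.appendLeft : (a : List K) → {l l' : List K} → Reorder E l l' →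
    Reorder E (a ++ l) (a ++ l')
  | [], _, _, r => r
  | k :: a, _, _, r => .cons k (Reorder.appendLeft a r)

/-- A reordering of the beginning of a list. -/
def Reorder.appendRight : {l l' : List K} → Reorder E l l' → (m : List K) →
    Reorder E (l ++ m) (l' ++ m)
  | _, _, .refl l, m => .refl (l ++ m)
  | _, _, .cons k r, m => .cons k (Reorder.appendRight r m)
  | _, _, .swap k k' l, m => .swap k k' (l ++ m)
  | _, _, .act e l, m => .act e (l ++ m)
  | _, _, .trans r r', m => .trans (Reorder.appendRight r m) (Reorder.appendRight r' m)

/-- The reordering moving an entry over a block. -/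
def Reorder.move (E : K → K → Type w) (k : K) : (b m : List K) →
    Reorder E (k :: (b ++ m)) (b ++ k :: m)
  | [], m => .refl (k :: m)
  | k' :: b, m => .trans (.swap k k' (b ++ m)) (.cons k' (Reorder.move E k b m))

/-- The reordering exchanging the two leading blocks. -/
def Reorder.blockSwap (E : K → K → Type w) : (a b m : List K) →
    Reorder E (a ++ (b ++ m)) (b ++ (a ++ m))
  | [], b, m => .refl (b ++ m)
  | k :: a, b, m => .trans (.cons k (Reorder.blockSwap E a b m)) (Reorder.move E k b (a ++ m))

/-- The reordering of a concatenation of blocks induced by a reordering of the blocks and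
reorderings of the entries of the blocks. -/
def Reorder.flatMap {K' : Type w} {E' : K' → K' → Type w} (s : K → List K')
    (e : ∀ {k k' : K}, E k k' → Reorder E' (s k) (s k')) :
    {l l' : List K} → Reorder E l l' → Reorder E' (l.flatMap s) (l'.flatMap s)
  | _, _, .refl l => .refl (l.flatMap s)
  | _, _, .cons k r => Reorder.appendLeft (s k) (Reorder.flatMap s e r)
  | _, _, .swap k k' l => Reorder.blockSwap E' (s k) (s k') (l.flatMap s)
  | _, _, .act x l => Reorder.appendRight (e x) (l.flatMap s)
  | _, _, .trans r r' => .trans (Reorder.flatMap s e r) (Reorder.flatMap s e r')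

end Words

/-! ### The permutations described by these words -/

section WordPerm

variable {C : Type v}

theorem PermWord.perm_cons (c : C) {a b : Profile C} (r : PermWord C a b) :
    PermWord.perm (Reorder.cons c r) = Profile.append (𝟙 ([c] : Profile C)) r.perm := rfl

theorem PermWord.perm_trans {a b c : Profile C} (r : PermWord C a b) (r' : PermWord C b c) :
    PermWord.perm (Reorder.trans r r') = r.perm ≫ r'.perm := rfl

theorem PermWord.perm_appendLeft (a : Profile C) {b b' : Profile C} (r : PermWord C b b') :
    PermWord.perm (Reorder.appendLeft a r) = Profile.append (𝟙 a) r.perm := by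
  induction a with
  | nil =>
    apply Profile.hom_ext
    intro i
    apply Fin.ext
    exact ((Profile.append_val_ge (𝟙 ([] : Profile C)) r.perm i i (Nat.zero_add _).symm).trans
      (Nat.zero_add _)).symm
  | cons c a ih =>
    refine (PermWord.perm_cons c _).trans ?_
    rw [ih]
    exact Profile.append_id_cons c a r.perm

theorem PermWord.perm_appendRight {a a' : Profile C} (r : PermWord C a a') (b : Profile C) :
    PermWord.perm (Reorder.appendRight r b) = Profile.append r.perm (𝟙 b) := by
  induction r with
  | refl l => exact (Profile.append_id l b).symm
  | cons c r ih =>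
    refine (PermWord.perm_cons c _).trans ?_
    rw [ih]
    exact Profile.append_cons_id c _ b
  | swap c d l =>
    apply Profile.hom_ext
    intro i
    apply Fin.ext
    exact (Profile.append_blockSwap_id [c] [d] l b i i rfl).symm
  | act e l => exact e.elim
  | trans r r' ih ih' =>
    refine (PermWord.perm_trans _ _).trans ?_
    rw [ih, ih', ← Profile.append_comp, Category.comp_id]
    rfl

theorem PermWord.perm_move (c : C) (b l : Profile C) :
    PermWord.perm (Reorder.move _ c b l) = Profile.blockSwap [c] b l := by
  induction b with
  | nil => exact (Profile.blockSwap_nil_right c l).symm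
  | cons d b ih =>
    refine Eq.trans ?_ (Profile.blockSwap_cons_right c d b l)
    rw [← ih]
    rfl

theorem PermWord.perm_blockSwap (a b l : Profile C) :
    PermWord.perm (Reorder.blockSwap _ a b l) = Profile.blockSwap a b l := by
  induction a with
  | nil => exact (Profile.blockSwap_nil_left b l).symm
  | cons c a ih =>
    refine Eq.trans ?_ (Profile.blockSwap_cons_left c a b l)
    rw [← ih, ← PermWord.perm_move]
    rfl

/-- Reorderings of the inputs of an operation by words in elementary transpositions. -/
inductive ArityPermWord : Arity C → Arity C → Type v
  | mk (t : C) {a b : Profile C} (r : PermWord C a b) : ArityPermWord (t, a) (t, b)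

namespace ArityPermWord

/-- The underlying permutation of the inputs. -/
def hom : {p q : Arity C} → ArityPermWord p q → ArityHom p q
  | _, _, .mk t r => .mk t r.perm

/-- The underlying word. -/
def word : {p q : Arity C} → ArityPermWord p q → PermWord C p.2 q.2
  | _, _, .mk _ r => r

end ArityPermWord

/-- Forget that the permutations of the inputs of the entries are given by words. -/
def toArityWord : {L L' : List (Arity C)} → Reorder ArityPermWord L L' → ArityWord C L L'
  | _, _, .refl L => .refl L
  | _, _, .cons k r => .cons k (toArityWord r)
  | _, _, .swap k k' L => .swap k k' L
  | _, _, .act e L => .act e.hom L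
  | _, _, .trans r r' => .trans (toArityWord r) (toArityWord r')

/-- The word describing the permutation of the concatenated inputs. -/
def inputsWord {L L' : List (Arity C)} (r : Reorder ArityPermWord L L') :
    PermWord C (inputs L) (inputs L') :=
  Reorder.flatMap Prod.snd (fun e => e.word) r

/-- Equivariance of an operad speaks of the permutation of the concatenated inputs, while labels can
only be moved by a word. This identifies the two. -/
theorem perm_inputsWord {L L' : List (Arity C)} (r : Reorder ArityPermWord L L') :
    (inputsWord r).perm = (toArityWord r).inputs := by
  induction r with
  | refl L => rfl
  | cons k r ih =>
    refine (PermWord.perm_appendLeft k.2 (inputsWord r)).trans ?_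
    rw [ih]
    rfl
  | swap k k' L => exact PermWord.perm_blockSwap k.2 k'.2 (inputs L)
  | act e L =>
    cases e with
    | mk t r => exact PermWord.perm_appendRight r (inputs L)
  | trans r r' ih ih' =>
    refine (PermWord.perm_trans (inputsWord r) (inputsWord r')).trans ?_
    rw [ih, ih']
    rfl

end WordPerm

/-! ### Reorderings acting on concatenated tensor products -/

section WordTensor

variable {M : Type u} [Category.{v} M] [MonoidalCategory M] [SymmetricCategory M]
variable {K : Type w} {E : K → K → Type w} (F : K → M) (φ : ∀ {k k' : K}, E k k' → (F k ⟶ F k'))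

theorem Reorder.tensor_appendLeft (a : List K) {l l' : List K} (r : Reorder E l l') :
    tensorListAppend F a l ≫ (Reorder.appendLeft a r).tensor F φ =
      tensorList F a ◁ r.tensor F φ ≫ tensorListAppend F a l' := by
  induction a with
  | nil => exact (leftUnitor_naturality _).symm
  | cons k a ih =>
    have := append_step (f := 𝟙 (F k)) (x := 𝟙 _) (y := r.tensor F φ)
      (ih.trans (by rw [id_tensorHom]))
    rw [id_tensorHom_id, id_tensorHom, id_tensorHom] at this
    exact this

theorem append_step_swap (A B X Y Z : M) (a : X ⊗ Y ⟶ Z) :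
    ((α_ A (B ⊗ X) Y).hom ≫ A ◁ ((α_ B X Y).hom ≫ B ◁ a)) ≫ swapTwo A B Z =
      swapTwo A B X ▷ Y ≫ (α_ B (A ⊗ X) Y).hom ≫ B ◁ ((α_ A X Y).hom ≫ A ◁ a) := by
  have h := swap_step (𝟙 A) (𝟙 B) a
  simp only [id_tensorHom] at h
  have h' : swapTwo A B (X ⊗ Y) =
      A ◁ (α_ B X Y).inv ≫ (α_ A (B ⊗ X) Y).inv ≫ swapTwo A B X ▷ Y ≫ (α_ B (A ⊗ X) Y).hom ≫
        B ◁ (α_ A X Y).hom := by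
    simp only [swapTwo]
    monoidal
  change A ◁ B ◁ a ≫ swapTwo A B Z = swapTwo A B (X ⊗ Y) ≫ B ◁ A ◁ a at h
  rw [whiskerLeft_comp, Category.assoc, Category.assoc, h, h']
  simp

theorem Reorder.tensor_appendRight {l l' : List K} (r : Reorder E l l') (m : List K) :
    tensorListAppend F l m ≫ (Reorder.appendRight r m).tensor F φ =
      r.tensor F φ ▷ tensorList F m ≫ tensorListAppend F l' m := by
  induction r with
  | refl l =>
    change tensorListAppend F l m ≫ 𝟙 _ = 𝟙 (tensorList F l) ▷ _ ≫ tensorListAppend F l m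
    rw [id_whiskerRight, Category.id_comp, Category.comp_id]
  | cons k r ih =>
    have := append_step (f := 𝟙 (F k)) (x := r.tensor F φ) (y := 𝟙 _)
      (ih.trans (by rw [tensorHom_id]))
    rw [tensorHom_id, id_tensorHom, id_tensorHom] at this
    exact this
  | swap k k' l => exact append_step_swap _ _ _ _ _ _
  | act e l =>
    have := append_step (f := φ e) (x := 𝟙 _) (y := 𝟙 _) (z := 𝟙 _)
      (a := tensorListAppend F l m) (a' := tensorListAppend F l m) (by simp)
    rw [tensorHom_id, tensorHom_id, tensorHom_id] at this
    exact this
  | trans r r' ih ih' =>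
    change _ ≫ (_ ≫ _) = (_ ≫ _) ▷ _ ≫ _
    rw [reassoc_of% ih, ih', comp_whiskerRight, Category.assoc]

theorem move_step {A B X Y Z W : M} {a : X ⊗ Y ⟶ Z} {m : A ⊗ Z ⟶ W} {c : X ⊗ (A ⊗ Y) ⟶ W}
    (h : A ◁ a ≫ m = swapTwo A X Y ≫ c) :
    A ◁ ((α_ B X Y).hom ≫ B ◁ a) ≫ swapTwo A B Z ≫ B ◁ m =
      swapTwo A (B ⊗ X) Y ≫ (α_ B X (A ⊗ Y)).hom ≫ B ◁ c := by
  have h1 := swap_step (𝟙 A) (𝟙 B) a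
  simp only [id_tensorHom] at h1
  change A ◁ B ◁ a ≫ swapTwo A B Z = swapTwo A B (X ⊗ Y) ≫ B ◁ A ◁ a at h1
  rw [whiskerLeft_comp_assoc, reassoc_of% h1, ← whiskerLeft_comp, h, whiskerLeft_comp,
    reassoc_of% (swapTwo_tensor_right A B X Y)]

/-- By induction on the block, using the hexagon `swapTwo_tensor_right`. -/
theorem Reorder.tensor_move (k : K) (b m : List K) :
    F k ◁ tensorListAppend F b m ≫ (Reorder.move E k b m).tensor F φ =
      swapTwo (F k) (tensorList F b) (tensorList F m) ≫ tensorListAppend F b (k :: m) := by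
  induction b with
  | nil =>
    change F k ◁ (λ_ (tensorList F m)).hom ≫ 𝟙 _ =
      swapTwo (F k) (𝟙_ M) (tensorList F m) ≫ (λ_ (F k ⊗ tensorList F m)).hom
    rw [swapTwo_unit_left]
    simp
  | cons k' b ih => exact move_step ih

theorem blockSwap_step {A B X Y Z W T U V : M} {b : B ⊗ Y ⟶ Z} {a : X ⊗ Z ⟶ W} {s : W ⟶ T}
    {a' : X ⊗ Y ⟶ U} {b' : B ⊗ U ⟶ T} (h : X ◁ b ≫ a ≫ s = swapTwo X B Y ≫ B ◁ a' ≫ b')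
    {m : A ⊗ T ⟶ V} {c : B ⊗ (A ⊗ U) ⟶ V} (hm : A ◁ b' ≫ m = swapTwo A B U ≫ c) :
    (A ⊗ X) ◁ b ≫ ((α_ A X Z).hom ≫ A ◁ a) ≫ A ◁ s ≫ m =
      swapTwo (A ⊗ X) B Y ≫ B ◁ ((α_ A X Y).hom ≫ A ◁ a') ≫ c := by
  have h1 := swap_step (𝟙 A) (𝟙 B) a'
  simp only [id_tensorHom] at h1
  change A ◁ B ◁ a' ≫ swapTwo A B U = swapTwo A B (X ⊗ Y) ≫ B ◁ A ◁ a' at h1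
  rw [Category.assoc, associator_naturality_right_assoc, ← whiskerLeft_comp_assoc,
    ← whiskerLeft_comp_assoc, Category.assoc, h, whiskerLeft_comp_assoc, whiskerLeft_comp_assoc,
    hm, reassoc_of% h1, reassoc_of% (swapTwo_tensor_left A X B Y), whiskerLeft_comp_assoc]

/-- The word built from single moves acts as one braiding of blocks; the inductive step is the
hexagon `swapTwo_tensor_left`. -/
theorem Reorder.tensor_blockSwap (a b m : List K) :
    tensorList F a ◁ tensorListAppend F b m ≫ tensorListAppend F a (b ++ m) ≫
        (Reorder.blockSwap E a b m).tensor F φ =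
      swapTwo (tensorList F a) (tensorList F b) (tensorList F m) ≫
        tensorList F b ◁ tensorListAppend F a m ≫ tensorListAppend F b (a ++ m) := by
  induction a with
  | nil =>
    change 𝟙_ M ◁ tensorListAppend F b m ≫ (λ_ _).hom ≫ 𝟙 _ =
      swapTwo (𝟙_ M) (tensorList F b) (tensorList F m) ≫ tensorList F b ◁ (λ_ _).hom ≫
        tensorListAppend F b m
    rw [swapTwo_unit]
    simp
  | cons k a ih => exact blockSwap_step ih (Reorder.tensor_move F φ k b (a ++ m))

variable {K' : Type w} {E' : K' → K' → Type w} (G : K' → M)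
  (ψ : ∀ {x x' : K'}, E' x x' → (G x ⟶ G x')) (s : K → List K')
  (e : ∀ {k k' : K}, E k k' → Reorder E' (s k) (s k'))

/-- Induction on the word. Separating operations from labels turns a reordering of labelled
operations into one of the operations and one of the concatenated labels; the transposition case
carries the symmetric coherence. -/
theorem Reorder.tensor_shuffle {l l' : List K} (r : Reorder E l l') :
    tensorListShuffle F G s l ≫
        (r.tensor F φ ⊗ₘ (Reorder.flatMap s e r).tensor G ψ) =
      r.tensor (fun k => F k ⊗ tensorList G (s k)) (fun x => φ x ⊗ₘ (e x).tensor G ψ) ≫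
        tensorListShuffle F G s l' := by
  induction r with
  | refl l =>
    change _ ≫ (𝟙 _ ⊗ₘ 𝟙 _) = 𝟙 _ ≫ _
    rw [id_tensorHom_id, Category.comp_id, Category.id_comp]
  | cons k r ih =>
    have := shuffle_step (f := 𝟙 (F k)) (b := 𝟙 _)
      ((Reorder.tensor_appendLeft G ψ (s k) (Reorder.flatMap s e r)).trans
        (by rw [id_tensorHom])) ih
    rw [id_tensorHom_id, id_tensorHom, id_tensorHom] at this
    exact this
  | swap k k' l => exact shuffle_step_swap (Reorder.tensor_blockSwap G ψ (s k) (s k') (l.flatMap s))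
  | act x l =>
    have := shuffle_step (f := φ x) (x := 𝟙 _) (y := 𝟙 _) (h := 𝟙 _)
      (s := tensorListShuffle F G s l) (s' := tensorListShuffle F G s l)
      ((Reorder.tensor_appendRight G ψ (e x) (l.flatMap s)).trans
        (by rw [tensorHom_id])) (by simp)
    rw [tensorHom_id, tensorHom_id] at this
    exact this
  | trans r r' ih ih' =>
    change _ ≫ (_ ≫ _ ⊗ₘ _ ≫ _) = (_ ≫ _) ≫ _
    rw [← tensorHom_comp_tensorHom, reassoc_of% ih, ih', Category.assoc]

end WordTensor
-- Associativity of concatenation: inductive steps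
section AppendAssoc

variable {M : Type u} [Category.{v} M] [MonoidalCategory M] {K : Type v}

theorem append_step_assoc {A X Y Z V W U R : M} {a : Y ⊗ Z ⟶ V} {b : X ⊗ V ⟶ W} {c : W ⟶ U}
    {d : X ⊗ Y ⟶ R} {e : R ⊗ Z ⟶ U} (h : X ◁ a ≫ b ≫ c = (α_ X Y Z).inv ≫ d ▷ Z ≫ e) :
    (A ⊗ X) ◁ a ≫ ((α_ A X V).hom ≫ A ◁ b) ≫ A ◁ c =
      (α_ (A ⊗ X) Y Z).inv ≫ ((α_ A X Y).hom ≫ A ◁ d) ▷ Z ≫ (α_ A R Z).hom ≫ A ◁ e := by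
  rw [Category.assoc, associator_naturality_right_assoc, ← whiskerLeft_comp, ← whiskerLeft_comp, h]
  simp only [comp_whiskerRight, Category.assoc, associator_naturality_middle_assoc,
    whiskerLeft_comp]
  monoidal

theorem append_nil_step {A X Z : M} {a : X ⊗ 𝟙_ M ⟶ Z} {c : Z ⟶ X} (h : a ≫ c = (ρ_ X).hom) :
    ((α_ A X (𝟙_ M)).hom ≫ A ◁ a) ≫ A ◁ c = (ρ_ (A ⊗ X)).hom := by
  rw [Category.assoc, ← whiskerLeft_comp, h, rightUnitor_tensor_hom]

end AppendAssoc

/-! ### Unit and associativity laws of the shuffle -/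

section ShuffleAssoc

variable {M : Type u} [Category.{v} M] [MonoidalCategory M] [SymmetricCategory M]
variable {K K' K'' : Type v}

theorem tensorListAppend_assoc (F : K → M) (a b c : List K) :
    tensorList F a ◁ tensorListAppend F b c ≫ tensorListAppend F a (b ++ c) ≫
        tensorListCast F (List.append_assoc a b c).symm =
      (α_ _ _ _).inv ≫ tensorListAppend F a b ▷ tensorList F c ≫
        tensorListAppend F (a ++ b) c := by
  induction a with
  | nil =>
    change 𝟙_ M ◁ tensorListAppend F b c ≫ (λ_ _).hom ≫ 𝟙 _ =
      (α_ (𝟙_ M) _ _).inv ≫ (λ_ _).hom ▷ tensorList F c ≫ tensorListAppend F b c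
    rw [Category.comp_id, leftUnitor_naturality, ← leftUnitor_tensor_hom_assoc]
  | cons k a ih =>
    have := append_step_assoc (A := F k) ih
    rw [← tensorListCast_cons] at this
    exact this

theorem tensorListAppend_nil (F : K → M) (a : List K) :
    tensorListAppend F a [] ≫ tensorListCast F (List.append_nil a) = (ρ_ (tensorList F a)).hom := by
  induction a with
  | nil =>
    change (λ_ (𝟙_ M)).hom ≫ 𝟙 _ = (ρ_ (𝟙_ M)).hom
    rw [Category.comp_id, unitors_equal]
  | cons k a ih =>
    have := append_nil_step (A := F k) ih
    rw [← tensorListCast_cons] at this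
    exact this

theorem shuffle_single_step {A X Z : M} {a : X ⊗ 𝟙_ M ⟶ Z} {c : Z ⟶ X} (h : a ≫ c = (ρ_ X).hom) :
    ((A ⊗ X) ◁ (λ_ (𝟙_ M)).inv ≫ tensorμ A X (𝟙_ M) (𝟙_ M) ≫ (A ⊗ 𝟙_ M) ◁ a) ≫
      (A ⊗ 𝟙_ M) ◁ c = (ρ_ (A ⊗ X)).hom ≫ (ρ_ A).inv ▷ X := by
  rw [tensor_right_unitality, Category.assoc, Category.assoc, ← whiskerLeft_comp, h,
    Category.assoc, Category.assoc, tensorHom_comp_whiskerRight, Iso.hom_inv_id, id_tensorHom]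

/-- For one block the shuffle only inserts a unit object. This serves the unit axiom of the free
algebra. -/
theorem tensorListShuffle_single (F : K → M) (G : K' → M) (s : K → List K') (k : K) :
    tensorListShuffle F G s [k] ≫ tensorList F [k] ◁ tensorListCast G (List.append_nil (s k)) =
      (ρ_ (F k ⊗ tensorList G (s k))).hom ≫ (ρ_ (F k)).inv ▷ tensorList G (s k) :=
  shuffle_single_step (tensorListAppend_nil G (s k))

theorem shuffle_append_step {A B P Q R V U V' U' W Y Z T N L : M} {ap : P ⊗ Q ⟶ R}
    {sh : P ⟶ V ⊗ U} {sh' : Q ⟶ V' ⊗ U'} {apF : V ⊗ V' ⟶ W} {apG : U ⊗ U' ⟶ Y}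
    {shR : R ⟶ W ⊗ Z} {c : Z ⟶ Y} {b : B ⊗ Z ⟶ T} {d : T ⟶ N} {b' : B ⊗ U ⟶ L} {e : B ⊗ Y ⟶ N}
    {b'' : L ⊗ U' ⟶ N}
    (h : ap ≫ shR ≫ W ◁ c = (sh ⊗ₘ sh') ≫ tensorμ V U V' U' ≫ (apF ⊗ₘ apG))
    (hb : b ≫ d = B ◁ c ≫ e) (he : B ◁ apG ≫ e = (α_ B U U').inv ≫ b' ▷ U' ≫ b'') :
    ((α_ (A ⊗ B) P Q).hom ≫ (A ⊗ B) ◁ ap) ≫ ((A ⊗ B) ◁ shR ≫ tensorμ A B W Z ≫ (A ⊗ W) ◁ b) ≫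
        (A ⊗ W) ◁ d =
      (((A ⊗ B) ◁ sh ≫ tensorμ A B V U ≫ (A ⊗ V) ◁ b') ⊗ₘ sh') ≫
        tensorμ (A ⊗ V) L V' U' ≫ (((α_ A V V').hom ≫ A ◁ apF) ⊗ₘ b'') := by
  have n1 : (A ⊗ B) ◁ W ◁ c ≫ tensorμ A B W Y = tensorμ A B W Z ≫ (A ⊗ W) ◁ B ◁ c := by
    have := tensorμ_natural_right A B (𝟙 W) c
    simpa using this
  have n2 := tensorμ_natural_right A B apF apG
  have h1 := tensor_associativity A B V U V' U'
  have n3 := tensorμ_natural_left (𝟙 (A ⊗ V)) b' V' U'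
  simp only [id_tensorHom, id_whiskerRight] at n3
  have e1 : (A ⊗ W) ◁ b ≫ (A ⊗ W) ◁ d = (A ⊗ W) ◁ B ◁ c ≫ (A ⊗ W) ◁ e := by
    rw [← whiskerLeft_comp, hb, whiskerLeft_comp]
  have e2 : (A ◁ apF ⊗ₘ B ◁ apG) ≫ (A ⊗ W) ◁ e =
      (𝟙 _ ⊗ₘ (α_ B U U').inv) ≫ (A ◁ apF ⊗ₘ (b' ▷ U' ≫ b'')) := by
    rw [tensorHom_comp_whiskerLeft, he, tensorHom_comp_tensorHom, Category.id_comp]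
  have e3 : ((A ⊗ B) ◁ sh ≫ tensorμ A B V U ≫ (A ⊗ V) ◁ b') ⊗ₘ sh' =
      ((A ⊗ B) ◁ sh ⊗ₘ sh') ≫ tensorμ A B V U ▷ (V' ⊗ U') ≫ ((A ⊗ V) ◁ b') ▷ (V' ⊗ U') := by
    rw [tensorHom_comp_whiskerRight_assoc, tensorHom_comp_whiskerRight, Category.assoc]
  have e4 : (α_ (A ⊗ B) P Q).hom ≫ (A ⊗ B) ◁ (sh ⊗ₘ sh') =
      ((A ⊗ B) ◁ sh ⊗ₘ sh') ≫ (α_ _ _ _).hom := by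
    rw [← id_tensorHom, ← id_tensorHom, associator_naturality]
  simp only [Category.assoc]
  rw [e1, ← reassoc_of% n1, ← whiskerLeft_comp_assoc, ← whiskerLeft_comp_assoc, Category.assoc, h,
    e3, whiskerLeft_comp_assoc, whiskerLeft_comp_assoc, reassoc_of% n2, reassoc_of% e4, e2,
    ← reassoc_of% h1, Category.assoc, Category.assoc, reassoc_of% n3,
    tensorHom_comp_tensorHom_assoc, Category.comp_id, Iso.hom_inv_id, tensorHom_comp_tensorHom,
    Category.id_comp, whiskerLeft_comp_tensorHom]

/-- The shuffle is multiplicative for concatenation; the inductive step is associativity of the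
interchange `tensorμ`. -/
theorem tensorListShuffle_append (F : K → M) (G : K' → M) (s : K → List K') (l l' : List K) :
    tensorListAppend (fun k => F k ⊗ tensorList G (s k)) l l' ≫
        tensorListShuffle F G s (l ++ l') ≫
          tensorList F (l ++ l') ◁ tensorListCast G List.flatMap_append =
      (tensorListShuffle F G s l ⊗ₘ tensorListShuffle F G s l') ≫
        tensorμ _ _ _ _ ≫ (tensorListAppend F l l' ⊗ₘ
          tensorListAppend G (l.flatMap s) (l'.flatMap s)) := by
  induction l with
  | nil =>
    change (λ_ _).hom ≫ tensorListShuffle F G s l' ≫ _ ◁ 𝟙 _ =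
      ((λ_ (𝟙_ M)).inv ⊗ₘ tensorListShuffle F G s l') ≫
        tensorμ (𝟙_ M) (𝟙_ M) _ _ ≫ ((λ_ _).hom ⊗ₘ (λ_ _).hom)
    rw [whiskerLeft_id, Category.comp_id, MonoidalCategory.tensorHom_def', Category.assoc,
      ← tensor_left_unitality, leftUnitor_naturality]
  | cons k l ih =>
    have h1 := tensorListCast_append G (s k) (List.flatMap_append (f := s) (xs := l) (ys := l'))
    have h2 := tensorListAppend_assoc G (s k) (l.flatMap s) (l'.flatMap s)
    have h3 : tensorListAppend G (s k) ((l ++ l').flatMap s) ≫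
        tensorListCast G (List.flatMap_append (f := s) (xs := k :: l) (ys := l')) =
        tensorList G (s k) ◁ tensorListCast G List.flatMap_append ≫
          tensorListAppend G (s k) (l.flatMap s ++ l'.flatMap s) ≫
            tensorListCast G (List.append_assoc _ _ _).symm := by
      rw [← reassoc_of% h1, tensorListCast_trans]
    exact shuffle_append_step ih h3 h2

theorem shuffle_assoc_step {A B C Y V Y' W U X' X'' R T S P P' Q N : M} {p : X' ⟶ V ⊗ Y'}
    {ap : Y ⊗ Y' ⟶ P} {shk : Y ⟶ B ⊗ C} {sh' : Y' ⟶ W ⊗ U} {shP : P ⟶ Q ⊗ P'}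
    {c' : P' ⟶ T} {apG : B ⊗ W ⟶ Q} {apH : C ⊗ U ⟶ T} {d' : T ⟶ N} {c : U ⟶ S}
    {apH' : C ⊗ S ⟶ N} {r : X' ⟶ X''} {sh2 : X'' ⟶ R ⊗ S} {sh3 : R ⟶ V ⊗ W}
    (h1 : ap ≫ shP ≫ Q ◁ c' = (shk ⊗ₘ sh') ≫ tensorμ B C W U ≫ (apG ⊗ₘ apH))
    (h2 : apH ≫ d' = C ◁ c ≫ apH')
    (h3 : p ≫ V ◁ sh' ≫ V ◁ W ◁ c = r ≫ sh2 ≫ sh3 ▷ S ≫ (α_ V W S).hom) :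
    ((A ⊗ Y) ◁ p ≫ tensorμ A Y V Y' ≫ (A ⊗ V) ◁ ap) ≫ (A ⊗ V) ◁ shP ≫
        (A ⊗ V) ◁ Q ◁ (c' ≫ d') =
      ((A ◁ shk ≫ (α_ A B C).inv) ⊗ₘ r) ≫
        (((A ⊗ B) ⊗ C) ◁ sh2 ≫ tensorμ (A ⊗ B) C R S ≫ ((A ⊗ B) ⊗ R) ◁ apH') ≫
          ((A ⊗ B) ◁ sh3 ≫ tensorμ A B V W ≫ (A ⊗ V) ◁ apG) ▷ N ≫ (α_ (A ⊗ V) Q N).hom := by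
  have a1 := associator_monoidal A B C V W S
  have n1 : tensorμ A Y V Y' ≫ (A ⊗ V) ◁ (shk ⊗ₘ sh') =
      (A ◁ shk ⊗ₘ V ◁ sh') ≫ tensorμ A (B ⊗ C) V (W ⊗ U) := by
    have := tensorμ_natural (𝟙 A) shk (𝟙 V) sh'
    simpa using this.symm
  have n2 : tensorμ A (B ⊗ C) V (W ⊗ U) ≫ (A ⊗ V) ◁ ((B ⊗ C) ◁ W ◁ c) =
      (A ⊗ (B ⊗ C)) ◁ V ◁ W ◁ c ≫ tensorμ A (B ⊗ C) V (W ⊗ S) := by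
    have := tensorμ_natural_right A (B ⊗ C) (𝟙 V) (W ◁ c)
    simpa using this.symm
  have n3 : tensorμ B C W U ≫ (B ⊗ W) ◁ C ◁ c = (B ⊗ C) ◁ W ◁ c ≫ tensorμ B C W S := by
    have := tensorμ_natural_right B C (𝟙 W) c
    simpa using this.symm
  have n4 : tensorμ (A ⊗ B) C R S ≫ ((A ⊗ B) ◁ sh3) ▷ (C ⊗ S) =
      ((A ⊗ B) ⊗ C) ◁ (sh3 ▷ S) ≫ tensorμ (A ⊗ B) C (V ⊗ W) S := by
    have := tensorμ_natural_right (A ⊗ B) C sh3 (𝟙 S)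
    simpa using this.symm
  have e1 : ap ≫ shP ≫ Q ◁ (c' ≫ d') = (shk ⊗ₘ sh') ≫ (B ⊗ C) ◁ W ◁ c ≫ tensorμ B C W S ≫
      (apG ⊗ₘ apH') := by
    rw [whiskerLeft_comp, reassoc_of% h1, tensorHom_comp_whiskerLeft, h2, ← reassoc_of% n3,
      whiskerLeft_comp_tensorHom]
  have e2 : ((A ⊗ V) ◁ apG) ▷ (C ⊗ S) ≫ ((A ⊗ V) ⊗ Q) ◁ apH' ≫ (α_ (A ⊗ V) Q N).hom =
      (α_ (A ⊗ V) (B ⊗ W) (C ⊗ S)).hom ≫ (A ⊗ V) ◁ (apG ⊗ₘ apH') := by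
    rw [associator_naturality_right, associator_naturality_middle_assoc,
      MonoidalCategory.tensorHom_def, whiskerLeft_comp]
  have e3 : ((A ◁ shk ≫ (α_ A B C).inv) ⊗ₘ r) ≫ ((A ⊗ B) ⊗ C) ◁ sh2 ≫
      ((A ⊗ B) ⊗ C) ◁ (sh3 ▷ S) ≫ ((α_ A B C).hom ⊗ₘ (α_ V W S).hom) =
      (A ⊗ Y) ◁ p ≫ (A ◁ shk ⊗ₘ V ◁ sh') ≫ (A ⊗ (B ⊗ C)) ◁ V ◁ W ◁ c := by
    simp only [tensorHom_comp_whiskerLeft, whiskerLeft_comp_tensorHom, tensorHom_comp_tensorHom,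
      Category.assoc, Iso.inv_hom_id, Category.comp_id, h3]
  simp only [Category.assoc]
  rw [← whiskerLeft_comp, ← whiskerLeft_comp, e1, whiskerLeft_comp, whiskerLeft_comp,
    reassoc_of% n1, reassoc_of% n2, ← reassoc_of% e3, whiskerLeft_comp, ← reassoc_of% a1,
    whisker_exchange_assoc,
    comp_whiskerRight_assoc, comp_whiskerRight_assoc, e2, reassoc_of% n4]

/-- With three levels of factors, the outer or the inner pair of levels may be separated first. In
the application the levels are the middle operations, the top operations and the labels. -/
theorem tensorListShuffle_assoc (F : K → M) (G : K' → M) (H : K'' → M) (s : K → List K')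
    (u : K' → List K'') (l : List K) :
    tensorListShuffle F (fun x => G x ⊗ tensorList H (u x)) s l ≫
        tensorList F l ◁ tensorListShuffle G H u (l.flatMap s) ≫
          tensorList F l ◁ tensorList G (l.flatMap s) ◁ tensorListCast H List.flatMap_assoc =
      tensorListHom (fun k => F k ◁ tensorListShuffle G H u (s k) ≫ (α_ _ _ _).inv) l ≫
        tensorListShuffle (fun k => F k ⊗ tensorList G (s k)) H (fun k => (s k).flatMap u) l ≫
          tensorListShuffle F G s l ▷ tensorList H (l.flatMap fun k => (s k).flatMap u) ≫
            (α_ _ _ _).hom := by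
  induction l with
  | nil =>
    change (λ_ (𝟙_ M)).inv ≫ 𝟙_ M ◁ (λ_ (𝟙_ M)).inv ≫ 𝟙_ M ◁ 𝟙_ M ◁ 𝟙 (𝟙_ M) =
      𝟙 (𝟙_ M) ≫ (λ_ (𝟙_ M)).inv ≫ (λ_ (𝟙_ M)).inv ▷ 𝟙_ M ≫ (α_ (𝟙_ M) (𝟙_ M) (𝟙_ M)).hom
    monoidal
  | cons k l ih =>
    have h1 := tensorListShuffle_append G H u (s k) (l.flatMap s)
    have h2 := tensorListCast_append H ((s k).flatMap u)
      (List.flatMap_assoc (l := l) (f := s) (g := u))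
    have h := shuffle_assoc_step (A := F k) h1 h2 ih
    rw [tensorListCast_trans] at h
    exact h

/-- Inserting units: the comparison of `⨂ A` with `⨂ (O (c ; c) ⊗ (A c ⊗ I))`. -/
theorem unit_shuffle_step {A O₁ V Y Z W : M} {e : 𝟙_ M ⟶ O₁} {t : Y ⟶ Z} {sh : Z ⟶ V ⊗ W}
    {n : 𝟙_ M ⟶ V} {c : Y ⟶ W} (h : t ≫ sh = (λ_ Y).inv ≫ (n ⊗ₘ c)) :
    (((λ_ A).inv ≫ (e ⊗ₘ (ρ_ A).inv)) ⊗ₘ t) ≫ (O₁ ⊗ (A ⊗ 𝟙_ M)) ◁ sh ≫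
        tensorμ O₁ (A ⊗ 𝟙_ M) V W ≫ (O₁ ⊗ V) ◁ ((α_ A (𝟙_ M) W).hom ≫ A ◁ (λ_ W).hom) =
      (λ_ (A ⊗ Y)).inv ≫ (((λ_ (𝟙_ M)).inv ≫ (e ⊗ₘ n)) ⊗ₘ A ◁ c) := by
  have h1 : ((λ_ A).inv ⊗ₘ (λ_ Y).inv) ≫ tensorμ (𝟙_ M) A (𝟙_ M) Y =
      (λ_ (A ⊗ Y)).inv ≫ (λ_ (𝟙_ M)).inv ▷ (A ⊗ Y) := by
    have := leftUnitor_monoidal A Y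
    rw [← cancel_mono ((λ_ (𝟙_ M)).hom ▷ (A ⊗ Y)), ← cancel_mono (λ_ (A ⊗ Y)).hom, Category.assoc,
      Category.assoc, ← this, tensorHom_comp_tensorHom]
    simp
  have h2 : ((ρ_ A).inv ⊗ₘ c) ≫ (α_ A (𝟙_ M) W).hom ≫ A ◁ (λ_ W).hom = A ◁ c := by
    rw [MonoidalCategory.tensorHom_def, Category.assoc, associator_naturality_right_assoc]
    simp
  rw [tensorHom_comp_whiskerLeft_assoc, h, ← tensorHom_comp_tensorHom_assoc,
    tensorμ_natural_assoc, reassoc_of% h1, tensorHom_comp_whiskerLeft, h2,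
    whiskerRight_comp_tensorHom]

/-- When each label carries the unit operation of its color, the shuffle returns the list of units
and the unchanged labels. It is used to express generating terms of the free algebra through its
generators. -/
theorem shuffle_unaries {C : Type v} (O : SymSeq M C) (one : ∀ c, 𝟙_ M ⟶ O.val (c, [c]))
    (X : C → M) (a : Profile C) :
    tensorListMap (G := fun p : Arity C => O.val p ⊗ tensorList X p.2) (fun c => (c, [c]))
        (fun c => (λ_ (X c)).inv ≫ (one c ⊗ₘ (ρ_ (X c)).inv)) a ≫
          tensorListShuffle O.val X Prod.snd (unaries a) =
      (λ_ (tensorList X a)).inv ≫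
        (unitsList O one a ⊗ₘ tensorListCast X (inputs_unaries a).symm) := by
  induction a with
  | nil =>
    change 𝟙 (𝟙_ M) ≫ (λ_ (𝟙_ M)).inv = (λ_ (𝟙_ M)).inv ≫ (𝟙 (𝟙_ M) ⊗ₘ 𝟙 (𝟙_ M))
    simp
  | cons c a ih =>
    have h := unit_shuffle_step (A := X c) (e := one c) ih
    rw [← tensorListCast_cons] at h
    exact h

end ShuffleAssoc

/-! ### Functoriality of tensor products over maps of index sets -/

section Composition

variable {M : Type u} [Category.{v} M] [MonoidalCategory M] {K K' K'' : Type v}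

theorem tensorHom_comp_step {A B W Y Z V U : M} {f : A ⟶ B} {g : B ⟶ W} {h : Y ⟶ Z} {k : Z ⟶ V}
    {c : V ⟶ U} {r : Y ⟶ U} (e : h ≫ k ≫ c = r) :
    (f ⊗ₘ h) ≫ (g ⊗ₘ k) ≫ W ◁ c = ((f ≫ g) ⊗ₘ r) := by
  rw [tensorHom_comp_whiskerLeft, tensorHom_comp_tensorHom, e]

variable [SymmetricCategory M]

theorem tensorListMap_comp {F : K → M} {G : K' → M} {H : K'' → M} (u : K → K') (π : K' → K'')
    (f : ∀ k, F k ⟶ G (u k)) (g : ∀ x, G x ⟶ H (π x)) (l : List K) :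
    tensorListMap u f l ≫ tensorListMap π g (l.map u) ≫
        tensorListCast H (List.map_map (f := u) (g := π) (l := l)) =
      tensorListMap (fun k => π (u k)) (fun k => f k ≫ g (u k)) l := by
  induction l with
  | nil =>
    change 𝟙 (𝟙_ M) ≫ 𝟙 (𝟙_ M) ≫ 𝟙 (𝟙_ M) = 𝟙 (𝟙_ M)
    simp
  | cons k l ih =>
    have h := tensorHom_comp_step (f := f k) (g := g (u k)) ih
    rw [← tensorListCast_cons] at h
    exact h

theorem tensorListMap_id {F G : K → M} (f : ∀ k, F k ⟶ G k) (l : List K) :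
    tensorListMap (fun k => k) f l ≫ tensorListCast G (List.map_id' l) = tensorListHom f l := by
  induction l with
  | nil => exact Category.comp_id (𝟙 (𝟙_ M))
  | cons k l ih =>
    have h : (f k ⊗ₘ _) ≫ G k ◁ _ = (f k ⊗ₘ _) :=
      (tensorHom_comp_whiskerLeft _ _ _).trans (congrArg _ ih)
    rw [← tensorListCast_cons] at h
    exact h

theorem tensorListMap_append {F : K → M} {G : K' → M} (u : K → K') (f : ∀ k, F k ⟶ G (u k))
    (l l' : List K) :
    tensorListAppend F l l' ≫ tensorListMap u f (l ++ l') ≫ tensorListCast G List.map_append =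
      (tensorListMap u f l ⊗ₘ tensorListMap u f l') ≫ tensorListAppend G (l.map u) (l'.map u) := by
  induction l with
  | nil =>
    change (λ_ _).hom ≫ tensorListMap u f l' ≫ 𝟙 _ = (𝟙 (𝟙_ M) ⊗ₘ tensorListMap u f l') ≫ (λ_ _).hom
    rw [id_tensorHom, leftUnitor_naturality, Category.comp_id]
  | cons k l ih =>
    have h := append_step (f := f k) ih
    have e : ∀ {A A' X X' Z : M} (f : A ⟶ A') (x : X ⟶ X') (z : X' ⟶ Z),
        (f ⊗ₘ x) ≫ A' ◁ z = f ⊗ₘ (x ≫ z) := fun f x z => tensorHom_comp_whiskerLeft _ _ _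
    rw [← e, ← tensorListCast_cons] at h
    exact h

end Composition

/-! ### Jointly epimorphic families -/

section JointlyEpi

variable {M : Type u} [Category.{v} M]

/-- A family of morphisms with common target that is jointly epimorphic. -/
def JointlyEpi {I : Type*} {A : I → M} {B : M} (e : ∀ i, A i ⟶ B) : Prop :=
  ∀ ⦃Z : M⦄ (f g : B ⟶ Z), (∀ i, e i ≫ f = e i ≫ g) → f = g

/-- A family of morphisms `e i : A i ⟶ B (π i)` over a map `π` of index sets that is jointly
epimorphic over each fibre of `π`. -/
def FibrewiseEpi {I : Type*} {K : Type*} (π : I → K) {A : I → M} {B : K → M}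
    (e : ∀ i, A i ⟶ B (π i)) : Prop :=
  ∀ k : K, JointlyEpi (fun i : {i // π i = k} => e i.1 ≫ eqToHom (congrArg B i.2))

variable [MonoidalCategory M] [MonoidalClosed M]

theorem JointlyEpi.whiskerLeft {I : Type*} {A : I → M} {B : M} {e : ∀ i, A i ⟶ B}
    (he : JointlyEpi e) (X : M) : JointlyEpi (fun i => X ◁ e i) := by
  intro Z f g h
  apply MonoidalClosed.curry_injective
  apply he
  intro i
  rw [← MonoidalClosed.curry_natural_left, ← MonoidalClosed.curry_natural_left, h]

variable [SymmetricCategory M]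

theorem JointlyEpi.whiskerRight {I : Type*} {A : I → M} {B : M} {e : ∀ i, A i ⟶ B}
    (he : JointlyEpi e) (X : M) : JointlyEpi (fun i => e i ▷ X) := by
  intro Z f g h
  rw [← cancel_epi (β_ X B).hom]
  apply he.whiskerLeft X
  intro i
  rw [BraidedCategory.braiding_naturality_right_assoc, h,
    BraidedCategory.braiding_naturality_right_assoc]

theorem JointlyEpi.tensor {I I' : Type*} {A : I → M} {A' : I' → M} {B B' : M} {e : ∀ i, A i ⟶ B}
    {e' : ∀ i, A' i ⟶ B'} (he : JointlyEpi e) (he' : JointlyEpi e') :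
    JointlyEpi (fun p : I × I' => e p.1 ⊗ₘ e' p.2) := by
  intro Z f g h
  apply he.whiskerRight B'
  intro i
  apply he'.whiskerLeft (A i)
  intro i'
  have : (e i ⊗ₘ e' i') ≫ f = (e i ⊗ₘ e' i') ≫ g := h (i, i')
  change A i ◁ e' i' ≫ e i ▷ B' ≫ f = A i ◁ e' i' ≫ e i ▷ B' ≫ g
  rw [MonoidalCategory.tensorHom_def'] at this
  simpa only [Category.assoc] using this

/-- A list over `l` is a choice of an index over each entry of `l`, and closedness makes tensor
products of jointly epimorphic families jointly epimorphic. -/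
theorem FibrewiseEpi.tensorList {I K : Type v} {π : I → K} {A : I → M} {B : K → M}
    {e : ∀ i, A i ⟶ B (π i)} (he : FibrewiseEpi π e) :
    FibrewiseEpi (B := StarOp.tensorList B) (List.map π) (tensorListMap π e) := by
  intro l
  induction l with
  | nil =>
    intro Z f g h
    have := h ⟨[], rfl⟩
    change (𝟙 _ ≫ 𝟙 _) ≫ f = (𝟙 _ ≫ 𝟙 _) ≫ g at this
    simpa using this
  | cons k l ih =>
    intro Z f g h
    apply JointlyEpi.tensor (he k) ih
    rintro ⟨⟨i, rfl⟩, ⟨L, rfl⟩⟩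
    have := h ⟨i :: L, rfl⟩
    simp only [eqToHom_refl, Category.comp_id] at this ⊢
    exact this

end JointlyEpi
-- The shuffle under a change of index sets
section ShuffleMap

variable {M : Type u} [Category.{v} M] [MonoidalCategory M]
variable {K K' L L' : Type v}

theorem map_append_step {X Y Z X₁ Y₁ Z₁ W X₂ Y₂ Z₂ : M} {a : X ⊗ Y ⟶ Z} {m : Z ⟶ Z₁} {c : Z₁ ⟶ W}
    {x : X ⟶ X₁} {y : Y ⟶ Y₁} {a₁ : X₁ ⊗ Y₁ ⟶ W} {d : W ⟶ Z₂} {x' : X₁ ⟶ X₂} {y' : Y₁ ⟶ Y₂}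
    {a₂ : X₂ ⊗ Y₂ ⟶ Z₂} (h : a ≫ m ≫ c = (x ⊗ₘ y) ≫ a₁) (h' : a₁ ≫ d = (x' ⊗ₘ y') ≫ a₂) :
    a ≫ m ≫ c ≫ d = ((x ≫ x') ⊗ₘ (y ≫ y')) ≫ a₂ := by
  rw [reassoc_of% h, h', tensorHom_comp_tensorHom_assoc]

theorem desc_cons_step {X A B B' F Z : M} {q : A ⟶ F} {m : B ⟶ B'} {k : X ⊗ (F ⊗ B') ⟶ Z}
    {k' : (X ⊗ A) ⊗ B' ⟶ Z} {g : X ⊗ (A ⊗ B) ⟶ Z}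
    (h : X ◁ (q ▷ B') ≫ k = (α_ X A B').inv ≫ k')
    (h' : (X ⊗ A) ◁ m ≫ k' = (α_ X A B).hom ≫ g) : X ◁ (q ⊗ₘ m) ≫ k = g := by
  rw [MonoidalCategory.tensorHom_def', whiskerLeft_comp, Category.assoc, h,
    ← cancel_epi (α_ X A B).hom, ← h']
  simp

theorem tensorListMap_cons_cast {F : K → M} {G : K' → M} (u : K → K') (f : ∀ k, F k ⟶ G (u k))
    (k : K) (l : List K) {l' : List K'} (h : List.map u (k :: l) = u k :: l')
    (h' : List.map u l = l') :
    tensorListMap u f (k :: l) ≫ tensorListCast G h =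
      (f k ⊗ₘ (tensorListMap u f l ≫ tensorListCast G h')) := by
  subst h'
  exact (Category.comp_id _).trans (congrArg _ (Category.comp_id _).symm)

theorem tensorListCast_append_append (F : K → M) {a a' l l' : List K} (h : a = a') (h' : l = l') :
    tensorListAppend F a l ≫ tensorListCast F (congrArg₂ (· ++ ·) h h') =
      (tensorListCast F h ⊗ₘ tensorListCast F h') ≫ tensorListAppend F a' l' := by
  subst h h'
  simp [tensorListCast]

variable [SymmetricCategory M]

/-- The shuffle is compatible with a change of both index sets. -/
theorem tensorListShuffle_map {F : K → M} {F' : K' → M} {G : L → M} {G' : L' → M} {s : K → List L}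
    {s' : K' → List L'} (p : K → K') (q : L → L') (φ : ∀ k, F k ⟶ F' (p k))
    (ψ : ∀ x, G x ⟶ G' (q x)) (e : ∀ k, List.map q (s k) = s' (p k)) (l : List K)
    (h : List.map q (l.flatMap s) = (l.map p).flatMap s') :
    tensorListShuffle F G s l ≫
        (tensorListMap p φ l ⊗ₘ (tensorListMap q ψ (l.flatMap s) ≫ tensorListCast G' h)) =
      tensorListMap (G := fun k => F' k ⊗ tensorList G' (s' k)) p
          (fun k => φ k ⊗ₘ (tensorListMap q ψ (s k) ≫ tensorListCast G' (e k))) l ≫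
        tensorListShuffle F' G' s' (l.map p) := by
  induction l with
  | nil =>
    change (λ_ (𝟙_ M)).inv ≫ (𝟙 (𝟙_ M) ⊗ₘ (𝟙 (𝟙_ M) ≫ 𝟙 (𝟙_ M))) = 𝟙 (𝟙_ M) ≫ (λ_ (𝟙_ M)).inv
    simp
  | cons k l ih =>
    have h₀ : List.map q (l.flatMap s) = (l.map p).flatMap s' := by
      rw [List.map_flatMap, List.flatMap_map]
      simp only [e]
    refine shuffle_step ?_ (ih h₀)
    have h1 := map_append_step (tensorListMap_append q ψ (s k) (l.flatMap s))
      (tensorListCast_append_append G' (e k) h₀)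
    rw [tensorListCast_trans] at h1
    exact h1

end ShuffleMap

/-! ### Colimits over profiles and maps out of their tensor products -/

section Orbits

variable {M : Type u} [Category.{v} M] {C : Type v} (T : Arity C → M)
  (φ : ∀ {p q : Arity C}, ArityPermWord p q → (T p ⟶ T q))

/-- The diagram of the objects `T (t, a)` and the actions of words on them. -/
def orbitsIndex (t : C) : Limits.MultispanIndex
    ⟨(a : Profile C) × (b : Profile C) × PermWord C a b, Profile C, fun x => x.1,
      fun x => x.2.1⟩ M where
  left x := T (t, x.1)
  right a := T (t, a)
  fst _ := 𝟙 _
  snd x := φ (.mk t x.2.2)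

variable [Limits.HasColimits M]

/-- The colimit of the objects `T (t, a)` over the groupoid of profiles `a`. -/
noncomputable def orbits (t : C) : M := Limits.multicoequalizer (orbitsIndex T φ t)

/-- The colimit cocone. -/
noncomputable def toOrbits (p : Arity C) : T p ⟶ orbits T φ p.1 :=
  Limits.Multicoequalizer.π (orbitsIndex T φ p.1) p.2

theorem act_toOrbits (t : C) {a b : Profile C} (r : PermWord C a b) :
    φ (.mk t r) ≫ toOrbits T φ (t, b) = toOrbits T φ (t, a) :=
  ((Category.id_comp _).symm.trans
    (Limits.Multicoequalizer.condition (orbitsIndex T φ t) ⟨a, b, r⟩)).symm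

theorem orbits_jointlyEpi (t : C) :
    JointlyEpi (B := orbits T φ t) (fun a : Profile C => toOrbits T φ (t, a)) := fun _ f g h =>
  Limits.Multicoequalizer.hom_ext (orbitsIndex T φ t) f g h

theorem toOrbits_fibrewiseEpi : FibrewiseEpi Prod.fst (toOrbits T φ) := by
  intro t Z f g h
  apply orbits_jointlyEpi T φ t
  intro a
  have := h ⟨(t, a), rfl⟩
  simpa only [eqToHom_refl, Category.comp_id] using this

/-- The morphism out of the orbits determined by an invariant family. -/
noncomputable def orbitsDesc (t : C) {Z : M} (g : ∀ a, T (t, a) ⟶ Z)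
    (h : ∀ {a b} (r : PermWord C a b), φ (.mk t r) ≫ g b = g a) : orbits T φ t ⟶ Z :=
  Limits.Multicoequalizer.desc (orbitsIndex T φ t) Z g
    (fun x => (Category.id_comp _).trans (h x.2.2).symm)

theorem toOrbits_desc (t : C) {Z : M} (g : ∀ a, T (t, a) ⟶ Z)
    (h : ∀ {a b} (r : PermWord C a b), φ (.mk t r) ≫ g b = g a) (a : Profile C) :
    toOrbits T φ (t, a) ≫ orbitsDesc T φ t g h = g a :=
  Limits.Multicoequalizer.π_desc (orbitsIndex T φ t) Z g _ a

variable [MonoidalCategory M] [MonoidalClosed M] [SymmetricCategory M]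

/-- Up to symmetry `X ⊗ (- ⊗ Y)` is tensoring with `X ⊗ Y`, a left adjoint, so it preserves the
colimit of orbits. -/
theorem exists_orbitsDesc_whisker (t : C) {X Y Z : M} (g : ∀ a, X ⊗ (T (t, a) ⊗ Y) ⟶ Z)
    (h : ∀ {a b} (r : PermWord C a b), X ◁ (φ (.mk t r) ▷ Y) ≫ g b = g a) :
    ∃ k : X ⊗ (orbits T φ t ⊗ Y) ⟶ Z, ∀ a, X ◁ (toOrbits T φ (t, a) ▷ Y) ≫ k = g a := by
  let e : ∀ U : M, X ⊗ (U ⊗ Y) ≅ (X ⊗ Y) ⊗ U := fun U =>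
    whiskerLeftIso X (β_ U Y) ≪≫ (α_ X Y U).symm
  have he : ∀ {U V : M} (f : U ⟶ V), X ◁ (f ▷ Y) ≫ (e V).hom = (e U).hom ≫ (X ⊗ Y) ◁ f := by
    intro U V f
    change X ◁ (f ▷ Y) ≫ X ◁ (β_ V Y).hom ≫ (α_ X Y V).inv =
      (X ◁ (β_ U Y).hom ≫ (α_ X Y U).inv) ≫ (X ⊗ Y) ◁ f
    rw [← whiskerLeft_comp_assoc, BraidedCategory.braiding_naturality_left, Category.assoc,
      ← associator_inv_naturality_right, whiskerLeft_comp_assoc]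
  have he' : ∀ {U V : M} (f : U ⟶ V), (X ⊗ Y) ◁ f ≫ (e V).inv = (e U).inv ≫ X ◁ (f ▷ Y) := by
    intro U V f
    rw [Iso.comp_inv_eq, Category.assoc, he, Iso.inv_hom_id_assoc]
  refine ⟨(e _).hom ≫ MonoidalClosed.uncurry (orbitsDesc T φ t
    (fun a => MonoidalClosed.curry ((e _).inv ≫ g a)) ?_), ?_⟩
  · intro a b r
    rw [← MonoidalClosed.curry_natural_left, reassoc_of% he', h]
  · intro a
    rw [reassoc_of% he, ← MonoidalClosed.uncurry_natural_left, toOrbits_desc,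
      MonoidalClosed.uncurry_curry, Iso.hom_inv_id_assoc]

/-- Reorderings that consist of a single edge. -/
inductive EntryStep {K : Type v} (E : K → K → Type v) : List K → List K → Type v
  | head {k k' : K} (e : E k k') (l : List K) : EntryStep E (k :: l) (k' :: l)
  | cons (k : K) {l l' : List K} (s : EntryStep E l l') : EntryStep E (k :: l) (k :: l')

/-- The reordering given by a single edge. -/
def EntryStep.word {K : Type v} {E : K → K → Type v} : {l l' : List K} → EntryStep E l l' →
    Reorder E l l'
  | _, _, .head e l => .act e l
  | _, _, .cons k s => .cons k s.word

/-- A list `K` of arities with outputs `l` selects one term of the colimit in each tensor factor. As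
colimits are preserved in each variable, it suffices that the family be invariant under acting on
one entry at a time. -/
theorem exists_orbitsDesc_tensorList (l : Profile C) : ∀ {X Z : M}
    (g : ∀ K, outputs K = l → (X ⊗ tensorList T K ⟶ Z)),
    (∀ {K K'} (s : EntryStep ArityPermWord K K') (h : outputs K = l) (h' : outputs K' = l),
      X ◁ s.word.tensor T φ ≫ g K' h' = g K h) →
    ∃ k : X ⊗ tensorList (orbits T φ) l ⟶ Z, ∀ K (h : outputs K = l),
      X ◁ (tensorListMap Prod.fst (toOrbits T φ) K ≫ tensorListCast (orbits T φ) h) ≫ k =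
        g K h := by
  induction l with
  | nil =>
    intro X Z g _
    refine ⟨g [] rfl, fun K h => ?_⟩
    obtain rfl := List.map_eq_nil_iff.1 h
    have e : tensorListMap Prod.fst (toOrbits T φ) [] ≫ tensorListCast (orbits T φ) h =
      𝟙 (tensorList T []) := Category.comp_id _
    rw [e]
    exact whiskerLeft_id_step rfl _
  | cons c l ih =>
    intro X Z g hg
    -- `G` is the family with its head entry split off, kept opaque and accessible only through
    -- `hG`.
    obtain ⟨G, hG⟩ : ∃ G : ∀ a K, outputs K = l → (X ⊗ (T (c, a) ⊗ tensorList T K) ⟶ Z),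
        ∀ a K h, G a K h = g ((c, a) :: K) (congrArg (c :: ·) h) := ⟨_, fun _ _ _ => rfl⟩
    have hG₁ : ∀ {a b : Profile C} (r : PermWord C a b) K h,
        X ◁ (φ (.mk c r) ▷ tensorList T K) ≫ G b K h = G a K h := by
      intro a b r K h
      rw [hG, hG]
      exact hg (K := (c, a) :: K) (K' := (c, b) :: K) (.head (.mk c r) K) (congrArg (c :: ·) h) (congrArg (c :: ·) h)
    have hG₂ : ∀ a {K K'} (s : EntryStep ArityPermWord K K') h h',
        X ◁ (T (c, a) ◁ s.word.tensor T φ) ≫ G a K' h' = G a K h := by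
      intro a K K' s h h'
      rw [hG, hG]
      exact hg (.cons (c, a) s) (congrArg (c :: ·) h) (congrArg (c :: ·) h')
    -- For a fixed head term, descend in the tail with the head absorbed into the context.
    have hk : ∀ a : Profile C, ∃ k : (X ⊗ T (c, a)) ⊗ tensorList (orbits T φ) l ⟶ Z,
        ∀ K (h : outputs K = l), (X ⊗ T (c, a)) ◁
          (tensorListMap Prod.fst (toOrbits T φ) K ≫ tensorListCast (orbits T φ) h) ≫ k =
          (α_ _ _ _).hom ≫ G a K h := by
      intro a
      refine ih (fun K h => (α_ _ _ _).hom ≫ G a K h) ?_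
      intro K K' s h h'
      rw [associator_naturality_right_assoc, hG₂ a s h h']
    choose k hk using hk
    obtain ⟨k', hk'⟩ := exists_orbitsDesc_whisker T φ c (fun a => (α_ _ _ _).inv ≫ k a) (by
      intro a b r
      rw [associator_inv_naturality_middle_assoc]
      congr 1
      -- The morphisms `k a` were merely chosen; their compatibility in `a` is tested on the
      -- generating terms of the tail, which are jointly epi.
      apply ((toOrbits_fibrewiseEpi T φ).tensorList l).whiskerLeft
      rintro ⟨K, h⟩
      change (X ⊗ T (c, a)) ◁ (tensorListMap Prod.fst (toOrbits T φ) K ≫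
        tensorListCast (orbits T φ) h) ≫ _ = (X ⊗ T (c, a)) ◁
          (tensorListMap Prod.fst (toOrbits T φ) K ≫ tensorListCast (orbits T φ) h) ≫ _
      rw [hk, whisker_exchange_assoc, hk, ← hG₁ r, associator_naturality_middle_assoc])
    refine ⟨k', fun K h => ?_⟩
    obtain ⟨⟨c', a⟩, K, rfl, h₁, h₂⟩ := List.map_eq_cons_iff.1 h
    dsimp at h₁
    subst h₁
    rw [tensorListMap_cons_cast _ _ _ _ h h₂]
    exact desc_cons_step (hk' a) ((hk a K h₂).trans (congrArg _ (hG a K h₂)))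

end Orbits

/-! ### The free algebra: action, equivariance and unit -/

section FreeAlgebra

variable {M : Type u} [Category.{v} M] [MonoidalCategory M]

theorem mul_reorder_step {Y Y' P P' V V' W W' Z Z' : M} {sh : P ⟶ V ⊗ W} {sh' : P' ⟶ V' ⊗ W'}
    {f : V ⟶ V'} {g : W ⟶ W'} {p : P ⟶ P'} {y : Y ⟶ Y'} {c : Y ⊗ V ⟶ Z} {c' : Y' ⊗ V' ⟶ Z'}
    {z : Z ⟶ Z'} (h : sh ≫ (f ⊗ₘ g) = p ≫ sh') (h' : (y ⊗ₘ f) ≫ c' = c ≫ z) :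
    (y ⊗ₘ p) ≫ Y' ◁ sh' ≫ (α_ Y' V' W').inv ≫ c' ▷ W' =
      (Y ◁ sh ≫ (α_ Y V W).inv ≫ c ▷ W) ≫ (z ⊗ₘ g) := by
  rw [tensorHom_comp_whiskerLeft_assoc, ← h, ← whiskerLeft_comp_tensorHom_assoc,
    associator_inv_naturality_assoc, tensorHom_comp_whiskerRight, h']
  simp only [Category.assoc, whiskerRight_comp_tensorHom]

theorem invariant_step {X Y Y' W W' V V' Z : M} {w : W ⟶ W'} {i : X ⟶ Y} {p : Y ⟶ Y'}
    {i' : X ⟶ Y'} {m : Y ⊗ W ⟶ V} {m' : Y' ⊗ W' ⟶ V'} {r : V ⟶ V'} {q : V ⟶ Z} {q' : V' ⟶ Z}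
    (h : (p ⊗ₘ w) ≫ m' = m ≫ r) (hi : i' = i ≫ p) (hq : r ≫ q' = q) :
    X ◁ w ≫ i' ▷ W' ≫ m' ≫ q' = i ▷ W ≫ m ≫ q := by
  rw [← hq, ← reassoc_of% h, hi, whisker_exchange_assoc, ← tensorHom_id, ← id_tensorHom,
    ← tensorHom_id, tensorHom_comp_tensorHom_assoc, tensorHom_comp_tensorHom_assoc]
  simp only [Category.id_comp, Category.comp_id]

theorem equivariance_step {Y Y' Y'' F F' P P' T' Z : M} {y : Y ⟶ Y'} {r : F ⟶ F'} {q : P ⟶ F}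
    {w : P ⟶ P'} {q' : P' ⟶ F'} {i : Y'' ⟶ Y} {i' : T' ⟶ Y'} {p : Y'' ⟶ T'} {k : Y' ⊗ F' ⟶ Z}
    {k' : Y ⊗ F ⟶ Z} [IsIso i] {m : Y'' ⊗ P ⟶ Z} {m' : T' ⊗ P' ⟶ Z}
    (h : w ≫ q' = q ≫ r) (h' : p ≫ i' = i ≫ y) (hk : (i' ⊗ₘ q') ≫ k = m')
    (hk' : (i ⊗ₘ q) ≫ k' = m) (hm : (p ⊗ₘ w) ≫ m' = m) : Y ◁ q ≫ (y ⊗ₘ r) ≫ k = Y ◁ q ≫ k' := by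
  have e : i ▷ P ≫ Y ◁ q = (i ⊗ₘ q) := (MonoidalCategory.tensorHom_def _ _).symm
  rw [← cancel_epi (i ▷ P), reassoc_of% e, reassoc_of% e, hk', ← hm, ← hk,
    tensorHom_comp_tensorHom_assoc, tensorHom_comp_tensorHom_assoc, h, h']

theorem free_one_step {A B F Y V Z : M} {o : 𝟙_ M ⟶ Y} {q : A ⊗ B ⟶ F}
    {s : (A ⊗ B) ⊗ 𝟙_ M ⟶ (A ⊗ 𝟙_ M) ⊗ V} {c : Y ⊗ (A ⊗ 𝟙_ M) ⟶ Z} {act : Y ⊗ (F ⊗ 𝟙_ M) ⟶ F}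
    {k : Z ⊗ V ⟶ F} {i : V ⟶ B} {z : Z ⟶ A}
    (hact : Y ◁ (q ⊗ₘ 𝟙 (𝟙_ M)) ≫ act = (Y ◁ s ≫ (α_ _ _ _).inv ≫ c ▷ V) ≫ k)
    (hs : s ≫ (A ⊗ 𝟙_ M) ◁ i = (ρ_ _).hom ≫ (ρ_ A).inv ▷ B)
    (hc : (λ_ A).inv ≫ (o ⊗ₘ (ρ_ A).inv) ≫ c ≫ z = 𝟙 A) (hk : (z ⊗ₘ i) ≫ q = k) :
    q ≫ (λ_ F).inv ≫ (o ⊗ₘ (ρ_ F).inv) ≫ act = q := by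
  have h₁ : q ≫ (λ_ F).inv ≫ (o ⊗ₘ (ρ_ F).inv) = (λ_ _).inv ≫ (o ⊗ₘ (ρ_ _).inv) ≫
      Y ◁ (q ⊗ₘ 𝟙 (𝟙_ M)) := by
    rw [leftUnitor_inv_naturality_assoc, tensorHom_comp_whiskerLeft, tensorHom_id,
      ← rightUnitor_inv_naturality, whiskerLeft_comp_tensorHom]
  have h₃ : (λ_ (A ⊗ B)).inv ≫ (o ⊗ₘ (ρ_ (A ⊗ B)).inv) ≫ Y ◁ s ≫ Y ◁ (A ⊗ 𝟙_ M) ◁ i =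
      ((λ_ A).inv ≫ (o ⊗ₘ (ρ_ A).inv)) ▷ B ≫ (α_ _ _ _).hom := by
    rw [← whiskerLeft_comp, hs, tensorHom_comp_whiskerLeft, Iso.inv_hom_id_assoc,
      comp_whiskerRight, Category.assoc, MonoidalCategory.tensorHom_def,
      MonoidalCategory.tensorHom_def]
    monoidal
  have h₄ : c ▷ V ≫ (z ⊗ₘ i) = (Y ⊗ A ⊗ 𝟙_ M) ◁ i ≫ (c ≫ z) ▷ B := by
    rw [whiskerRight_comp_tensorHom, MonoidalCategory.tensorHom_def']
  rw [reassoc_of% h₁, hact, ← hk, Category.assoc, Category.assoc, reassoc_of% h₄,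
    ← associator_inv_naturality_right_assoc, reassoc_of% h₃, Iso.hom_inv_id_assoc,
    ← comp_whiskerRight_assoc, Category.assoc, hc, id_whiskerRight, Category.id_comp]

variable [SymmetricCategory M]
variable {C : Type v} (O : Operad M C) (X : C → M)

/-- The objects `O (t ; a) ⊗ X a₁ ⊗ … ⊗ X aₘ`. -/
abbrev freeTerm (p : Arity C) : M := O.ops.val p ⊗ tensorList X p.2

/-- The diagonal action of words. -/
def freeTermAct {p q : Arity C} (e : ArityPermWord p q) : freeTerm O X p ⟶ freeTerm O X q :=
  O.ops.act e.hom ⊗ₘ e.word.tensor X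

/-- Composition of operations labelled by `X`. -/
def freeMul (t : C) (L : List (Arity C)) :
    O.ops.val (t, outputs L) ⊗ tensorList (freeTerm O X) L ⟶ freeTerm O X (t, inputs L) :=
  O.ops.val (t, outputs L) ◁ tensorListShuffle O.ops.val X Prod.snd L ≫
    (α_ _ _ _).inv ≫ O.comp t L ▷ tensorList X (inputs L)

theorem tensor_toArityWord {L L' : List (Arity C)} (r : Reorder ArityPermWord L L') :
    r.tensor O.ops.val (fun e => O.ops.act e.hom) =
      (toArityWord r).tensor O.ops.val (fun e => O.ops.act e) := by
  induction r with
  | refl L => rfl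
  | cons k r ih => exact congrArg _ ih
  | swap k k' L => rfl
  | act e L => rfl
  | trans r r' ih ih' => exact congrArg₂ _ ih ih'

/-- Equivariance of operadic composition, combined with the compatibility of the shuffle with
reorderings. The labels are moved by the same permutation as the inputs. -/
theorem freeMul_reorder (t : C) {L L' : List (Arity C)} (r : Reorder ArityPermWord L L') :
    ((O.ops t).map (toArityWord r).outputs.perm ⊗ₘ
        r.tensor (freeTerm O X) (fun e => freeTermAct O X e)) ≫ freeMul O X t L' =
      freeMul O X t L ≫ ((O.ops t).map (inputsWord r).perm ⊗ₘ (inputsWord r).tensor X) := by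
  refine mul_reorder_step (f := r.tensor O.ops.val (fun e => O.ops.act e.hom)) ?_ ?_
  · exact Reorder.tensor_shuffle O.ops.val (fun e => O.ops.act e.hom) X (fun e => e.elim)
      Prod.snd (fun e => e.word) r
  · rw [tensor_toArityWord, perm_inputsWord]
    exact O.equivariance t (toArityWord r)

theorem EntryStep.outputs_eq {L L' : List (Arity C)} (s : EntryStep ArityPermWord L L') :
    outputs L = outputs L' := by
  induction s with
  | head e l => cases e; rfl
  | cons k s ih => exact congrArg (k.1 :: ·) ih

theorem Profile.append_ofEq (c : C) {a b : Profile C} (h : a = b) :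
    Profile.append (𝟙 ([c] : Profile C)) (Profile.ofEq h) = Profile.ofEq (congrArg (c :: ·) h) := by
  subst h
  exact Profile.append_id [c] a

/-- An entry step permutes only the inputs of one operation, so the outputs keep their places. -/
theorem EntryStep.outputs_perm {L L' : List (Arity C)} (s : EntryStep ArityPermWord L L') :
    (toArityWord s.word).outputs.perm = Profile.ofEq s.outputs_eq := by
  induction s with
  | head e l => cases e; rfl
  | cons k s ih =>
    refine Eq.trans ?_ (Profile.append_ofEq k.1 s.outputs_eq)
    exact congrArg (Profile.append (𝟙 ([k.1] : Profile C))) ih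

variable [Limits.HasColimits M]

/-- The underlying objects of the free algebra. -/
noncomputable def freeObj (t : C) : M := orbits (freeTerm O X) (fun e => freeTermAct O X e) t

/-- The structure maps `O (t ; a) ⊗ X a₁ ⊗ … ⊗ X aₘ ⟶ F X t`. -/
noncomputable def toFree (p : Arity C) : freeTerm O X p ⟶ freeObj O X p.1 :=
  toOrbits (freeTerm O X) (fun e => freeTermAct O X e) p

theorem perm_toFree (t : C) {a b : Profile C} (r : PermWord C a b) :
    ((O.ops t).map r.perm ⊗ₘ r.tensor X) ≫ toFree O X (t, b) = toFree O X (t, a) :=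
  act_toOrbits (freeTerm O X) (fun e => freeTermAct O X e) t r

theorem cast_toFree (t : C) {a b : Profile C} (h : a = b) :
    ((O.ops t).map (Profile.ofEq h) ⊗ₘ tensorListCast X h) ≫ toFree O X (t, b) =
      toFree O X (t, a) := by
  subst h
  simp [Profile.ofEq, tensorListCast]

theorem free_jointlyEpi (t : C) :
    JointlyEpi (B := freeObj O X t) (fun a : Profile C => toFree O X (t, a)) :=
  orbits_jointlyEpi _ _ t

theorem toFree_fibrewiseEpi : FibrewiseEpi Prod.fst (toFree O X) :=
  toOrbits_fibrewiseEpi _ _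

/-- A permutation of the factors of a tensor product of free objects is realized on generating terms
by permuting the chosen arities as whole blocks. This allows equivariance of the action to be tested
on generating terms. -/
theorem exists_reorder_lift {a b : Profile C} (r : PermWord C a b) : ∀ (K : List (Arity C))
    (h : outputs K = a), ∃ (K' : List (Arity C)) (h' : outputs K' = b)
      (w : Reorder ArityPermWord K K'),
      (toArityWord w).outputs.perm ≫ Profile.ofEq h' = Profile.ofEq h ≫ r.perm ∧
      w.tensor (freeTerm O X) (fun e => freeTermAct O X e) ≫
          (tensorListMap Prod.fst (toFree O X) K' ≫ tensorListCast (freeObj O X) h') =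
        (tensorListMap Prod.fst (toFree O X) K ≫ tensorListCast (freeObj O X) h) ≫
          r.tensor (freeObj O X) := by
  induction r with
  | refl l =>
    intro K h
    exact ⟨K, h, .refl K, (Category.id_comp _).trans (Category.comp_id _).symm,
      (Category.id_comp _).trans (Category.comp_id _).symm⟩
  | cons c r ih =>
    intro K h
    obtain ⟨⟨c', x⟩, K, rfl, h₁, h₂⟩ := List.map_eq_cons_iff.1 h
    dsimp at h₁
    subst h₁
    obtain ⟨K', h', w, e₁, e₂⟩ := ih K h₂
    refine ⟨(c', x) :: K', congrArg (c' :: ·) h', .cons (c', x) w, ?_, ?_⟩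
    · have e' : ∀ {x y z : Profile C} (σ : x ⟶ y) (τ : y ⟶ z),
          Profile.append (𝟙 ([c'] : Profile C)) (σ ≫ τ) =
            Profile.append (𝟙 ([c'] : Profile C)) σ ≫ Profile.append (𝟙 ([c'] : Profile C)) τ := by
        intro x y z σ τ
        rw [← Profile.append_comp, Category.comp_id]
      have e := congrArg (Profile.append (𝟙 ([c'] : Profile C))) e₁
      rw [e', e', Profile.append_ofEq, Profile.append_ofEq] at e
      exact e
    · refine (congrArg _ (tensorListMap_cons_cast _ _ _ _ _ h')).trans (Eq.trans ?_
        (congrArg (· ≫ _) (tensorListMap_cons_cast _ _ _ _ _ h₂)).symm)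
      refine (whiskerLeft_comp_tensorHom _ _ _).trans (Eq.trans ?_
        (tensorHom_comp_whiskerLeft _ _ _).symm)
      exact congrArg _ e₂
  | swap c d l =>
    intro K h
    obtain ⟨⟨c', x⟩, K, rfl, h₁, h₂⟩ := List.map_eq_cons_iff.1 h
    obtain ⟨⟨d', y⟩, K, rfl, h₃, h₄⟩ := List.map_eq_cons_iff.1 h₂
    dsimp at h₁ h₃
    subst h₁ h₃ h₄
    refine ⟨(d', y) :: (c', x) :: K, rfl, .swap _ _ K, ?_, ?_⟩
    · exact (Category.comp_id _).trans (Category.id_comp _).symm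
    · refine (congrArg _ (Category.comp_id _)).trans (Eq.trans ?_
        (congrArg (· ≫ _) (Category.comp_id _)).symm)
      exact (swap_step (toFree O X (c', x)) (toFree O X (d', y))
        (tensorListMap Prod.fst (toFree O X) K)).symm
  | act e l => exact e.elim
  | trans r r' ih ih' =>
    intro K h
    obtain ⟨K', h', w, e₁, e₂⟩ := ih K h
    obtain ⟨K'', h'', w', e₃, e₄⟩ := ih' K' h'
    refine ⟨K'', h'', .trans w w', ?_, ?_⟩
    · refine (Category.assoc _ _ _).trans ((congrArg _ e₃).trans ?_)
      refine (Category.assoc _ _ _).symm.trans ((congrArg (· ≫ _) e₁).trans ?_)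
      exact Category.assoc _ _ _
    · refine (Category.assoc _ _ _).trans ((congrArg _ e₄).trans ?_)
      refine (Category.assoc _ _ _).symm.trans ((congrArg (· ≫ _) e₂).trans ?_)
      exact Category.assoc _ _ _

variable [MonoidalClosed M]

/-- Composition followed by passage to orbits is invariant in each entry: by `freeMul_reorder`, a
permutation inside an entry becomes one of the concatenated inputs, which dies in the orbits. -/
theorem exists_freeAct (t : C) (l : Profile C) :
    ∃ k : O.ops.val (t, l) ⊗ tensorList (freeObj O X) l ⟶ freeObj O X t,
      ∀ K (h : outputs K = l), O.ops.val (t, l) ◁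
        (tensorListMap Prod.fst (toFree O X) K ≫ tensorListCast (freeObj O X) h) ≫ k =
          (O.ops t).map (Profile.ofEq h.symm) ▷ _ ≫ freeMul O X t K ≫ toFree O X (t, inputs K) := by
  refine exists_orbitsDesc_tensorList (freeTerm O X) (fun e => freeTermAct O X e) l
    (Z := freeObj O X t) (fun K h => (O.ops t).map (Profile.ofEq h.symm) ▷ _ ≫ freeMul O X t K ≫
      toFree O X (t, inputs K)) ?_
  intro K K' s h h'
  have e := freeMul_reorder O X t s.word
  rw [s.outputs_perm] at e
  refine invariant_step e ?_ (perm_toFree O X t (inputsWord s.word))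
  rw [← Functor.map_comp]
  exact congrArg _ (eqToHom_trans _ _).symm

/-- The action of the operad on the free algebra. -/
noncomputable def freeAct (t : C) (l : Profile C) :
    O.ops.val (t, l) ⊗ tensorList (freeObj O X) l ⟶ freeObj O X t :=
  (exists_freeAct O X t l).choose

theorem freeAct_spec (t : C) (K : List (Arity C)) :
    O.ops.val (t, outputs K) ◁ tensorListMap Prod.fst (toFree O X) K ≫ freeAct O X t (outputs K) =
      freeMul O X t K ≫ toFree O X (t, inputs K) := by
  have h := (exists_freeAct O X t (outputs K)).choose_spec K rfl
  have e : tensorListMap Prod.fst (toFree O X) K ≫ tensorListCast (freeObj O X) rfl =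
    tensorListMap Prod.fst (toFree O X) K := Category.comp_id _
  rw [e] at h
  refine h.trans ?_
  have e' : (O.ops t).map (Profile.ofEq (rfl : outputs K = outputs K)) = 𝟙 _ :=
    (O.ops t).map_id _
  rw [e', id_whiskerRight, Category.id_comp]

/-- Morphisms out of tensor products of free algebras are determined on the generating terms. -/
theorem free_whiskerLeft_ext {Y Z : M} (l : Profile C) {f g : Y ⊗ tensorList (freeObj O X) l ⟶ Z}
    (h : ∀ K (e : outputs K = l),
      Y ◁ (tensorListMap Prod.fst (toFree O X) K ≫ tensorListCast (freeObj O X) e) ≫ f =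
        Y ◁ (tensorListMap Prod.fst (toFree O X) K ≫ tensorListCast (freeObj O X) e) ≫ g) :
    f = g := by
  apply ((toFree_fibrewiseEpi O X).tensorList l).whiskerLeft
  rintro ⟨K, e⟩
  exact h K e

theorem freeAct_cast_spec (t : C) {l : Profile C} (K : List (Arity C)) (h : outputs K = l) :
    ((O.ops t).map (Profile.ofEq h) ⊗ₘ
      (tensorListMap Prod.fst (toFree O X) K ≫ tensorListCast (freeObj O X) h)) ≫
        freeAct O X t l = freeMul O X t K ≫ toFree O X (t, inputs K) := by
  subst h
  rw [← freeAct_spec]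
  congr 1
  refine congrArg₂ _ ((O.ops t).map_id _) (Category.comp_id _) |>.trans ?_
  exact id_tensorHom _ _

/-- On generating terms the word lifts to a reordering of arities, and the resulting permutation of
concatenated inputs is absorbed by the orbits. -/
theorem freeAct_equivariance (t : C) {a b : Profile C} (r : PermWord C a b) :
    ((O.ops t).map r.perm ⊗ₘ r.tensor (freeObj O X)) ≫ freeAct O X t b = freeAct O X t a := by
  apply free_whiskerLeft_ext
  intro K h
  obtain ⟨K', h', w, e₁, e₂⟩ := exists_reorder_lift O X r K h
  have : IsIso (Profile.ofEq h) := inferInstanceAs (IsIso (eqToHom h))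
  refine equivariance_step (i := (O.ops t).map (Profile.ofEq h))
    (p := (O.ops t).map (toArityWord w).outputs.perm) e₂ ?_ (freeAct_cast_spec O X t K' h')
    (freeAct_cast_spec O X t K h) ?_
  · rw [← Functor.map_comp, ← Functor.map_comp, e₁]
  · have h₁ := freeMul_reorder O X t w
    rw [← perm_toFree O X t (inputsWord w), ← reassoc_of% h₁]

/-- On generating terms this is the left unit law `O.one_comp`, up to identifying `a ++ []` with
`a`. -/
theorem freeAct_one (t : C) : (λ_ (freeObj O X t)).inv ≫
    (O.one t ⊗ₘ (ρ_ (freeObj O X t)).inv) ≫ freeAct O X t [t] = 𝟙 (freeObj O X t) := by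
  apply free_jointlyEpi O X t
  intro a
  rw [Category.comp_id]
  exact free_one_step (freeAct_spec O X t [(t, a)])
    (tensorListShuffle_single O.ops.val X Prod.snd (t, a)) (O.one_comp t a)
    (cast_toFree O X t (inputs_single t a))

end FreeAlgebra

/-! ### Diagram chases for associativity of the free action -/

section FreeAssoc

variable {M : Type u} [Category.{v} M] [MonoidalCategory M]

theorem whisker_assoc_step {Y V R S X X' Z W : M} (s : S ⟶ V ⊗ R) (d : Y ⊗ V ⟶ Z) (c : Z ⊗ R ⟶ W)
    (x : X' ⟶ X) :
    Y ◁ s ▷ X' ≫ Y ◁ (α_ V R X').hom ≫ Y ◁ V ◁ R ◁ x ≫ (α_ Y V (R ⊗ X)).inv ≫ d ▷ (R ⊗ X) ≫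
        (α_ Z R X).inv ≫ c ▷ X =
      (α_ Y S X').inv ≫ (Y ◁ s ≫ (α_ Y V R).inv ≫ d ▷ R ≫ c) ▷ X' ≫ W ◁ x := by
  have h₁ := whisker_exchange (d ▷ R) x
  have h₂ := whisker_exchange c x
  simp only [comp_whiskerRight, Category.assoc]
  rw [← h₂, ← reassoc_of% h₁]
  monoidal

/-- Composing root with middle before acting on the top terms is brought to a normal form: middle
composed with top first, then with the root. Operadic associativity enters as `hO`, associativity of
the shuffle as `hS`. -/
theorem free_assoc_step_left {Y Y₀ Y₂ P Q V V₀ N F F' T Z₁ Z₂ Z₃ Z R R₂ X X' P' P'' : M}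
    {E : P ⟶ Q} {shF : Q ⟶ V ⊗ F} {shT : P ⟶ V₀ ⊗ T} {v : V₀ ⟶ V} {w : T ⟶ F} {c : F ⟶ F'}
    {q : T ⟶ F'} {i : N ⟶ Z₁} {actT : Z₁ ⊗ F' ⟶ Z} {actM : N ⊗ F ⟶ Z} {shX : T ⟶ R ⊗ X}
    {ct : Z₁ ⊗ R ⟶ Z₂} {qT : Z₂ ⊗ X ⟶ Z} {cx : X ⟶ X'} {cx' : X' ⟶ X} {sA : P ⟶ P'}
    {sB : P' ⟶ P'' ⊗ X'} {sC : P'' ⟶ V₀ ⊗ R} {y₁ : Y₀ ⟶ Y} {y₂ : Y₀ ⟶ Y₂} {cm : Y ⊗ V ⟶ N}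
    {b : P'' ⟶ R₂} {cg : Y₂ ⊗ R₂ ⟶ Z₃} {j : Z₃ ⟶ Z₂}
    (hE : E ≫ shF = shT ≫ (v ⊗ₘ w)) (hw : w ≫ c = q) (hact : (i ⊗ₘ c) ≫ actT = actM)
    (hT : Z₁ ◁ q ≫ actT = (Z₁ ◁ shX ≫ (α_ _ _ _).inv ≫ ct ▷ X) ≫ qT)
    (hS : shT ≫ V₀ ◁ shX ≫ V₀ ◁ R ◁ cx = sA ≫ sB ≫ sC ▷ X' ≫ (α_ _ _ _).hom)
    (hx : cx ≫ cx' = 𝟙 X)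
    (hO : Y₀ ◁ sC ≫ (α_ _ _ _).inv ≫ ((y₁ ⊗ₘ v) ≫ cm ≫ i) ▷ R ≫ ct = (y₂ ⊗ₘ b) ≫ cg ≫ j) :
    y₁ ▷ P ≫ Y ◁ E ≫ Y ◁ shF ≫ (α_ _ _ _).inv ≫ cm ▷ F ≫ actM =
      Y₀ ◁ sA ≫ Y₀ ◁ sB ≫ (α_ _ _ _).inv ≫ ((y₂ ⊗ₘ b) ≫ cg ≫ j) ▷ X' ≫ Z₂ ◁ cx' ≫ qT := by
  have hS' : shT ≫ V₀ ◁ shX = sA ≫ sB ≫ sC ▷ X' ≫ (α_ _ _ _).hom ≫ V₀ ◁ R ◁ cx' := by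
    rw [← reassoc_of% hS, ← whiskerLeft_comp, ← whiskerLeft_comp R, hx, whiskerLeft_id,
      whiskerLeft_id, Category.comp_id]
  have h₁ : y₁ ▷ P ≫ Y ◁ E ≫ Y ◁ shF = Y₀ ◁ shT ≫ (y₁ ⊗ₘ (v ⊗ₘ w)) := by
    rw [← whiskerLeft_comp, hE, ← MonoidalCategory.tensorHom_def, whiskerLeft_comp_tensorHom]
  have h₂ : ((y₁ ⊗ₘ v) ⊗ₘ w) ≫ cm ▷ F ≫ actM =
      ((y₁ ⊗ₘ v) ≫ cm ≫ i) ▷ T ≫ (Z₁ ◁ shX ≫ (α_ _ _ _).inv ≫ ct ▷ X) ≫ qT := by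
    rw [← hT, ← hact, whiskerRight_comp_tensorHom_assoc, tensorHom_comp_tensorHom_assoc, hw,
      ← MonoidalCategory.tensorHom_def_assoc]
  rw [reassoc_of% h₁, associator_inv_naturality_assoc, h₂]
  simp only [Category.assoc]
  rw [← whisker_exchange_assoc, ← associator_inv_naturality_right_assoc,
    ← whiskerLeft_comp_assoc, hS', ← hO]
  have h₃ := whisker_assoc_step sC ((y₁ ⊗ₘ v) ≫ cm ≫ i) ct cx'
  simp only [whiskerLeft_comp, Category.assoc]
  rw [← reassoc_of% h₃]

/-- Acting in each block and then with the root reaches the same normal form by naturality and the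
defining equation of the action alone. -/
theorem free_assoc_step_right {Y Y₀ Y₂ P Q F F' F₀ T Z₂ Z₃ Z R₂ X X' X₂ P' P'' : M}
    {E : P ⟶ Q} {n : Q ⟶ F} {c₁ : F ⟶ F₀} {sA : P ⟶ P'} {B : P' ⟶ T} {q : T ⟶ F'} {c₂ : F' ⟶ F₀}
    {sB : P' ⟶ P'' ⊗ X'} {b : P'' ⟶ R₂} {x : X' ⟶ X₂} {sh : T ⟶ R₂ ⊗ X₂} {y₁ : Y₀ ⟶ Y}
    {y₁' : Y ⟶ Y₀} {y₂ : Y₀ ⟶ Y₂} {y₂' : Y₂ ⟶ Y₀} {act : Y ⊗ F ⟶ Z} {act₀ : Y₀ ⊗ F₀ ⟶ Z}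
    {act' : Y₂ ⊗ F' ⟶ Z} {cg : Y₂ ⊗ R₂ ⟶ Z₃} {qg : Z₃ ⊗ X₂ ⟶ Z} {j : Z₃ ⟶ Z₂} {x₂ : X₂ ⟶ X}
    {cx' : X' ⟶ X} {qT : Z₂ ⊗ X ⟶ Z}
    (hN : E ≫ n ≫ c₁ = (sA ≫ B) ≫ q ≫ c₂) (h₁ : (y₁' ⊗ₘ c₁) ≫ act₀ = act) (hy₁ : y₁ ≫ y₁' = 𝟙 _)
    (h₂ : (y₂' ⊗ₘ c₂) ≫ act₀ = act') (hy₂ : y₂ ≫ y₂' = 𝟙 _) (hB : sB ≫ (b ⊗ₘ x) = B ≫ sh)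
    (hg : Y₂ ◁ q ≫ act' = (Y₂ ◁ sh ≫ (α_ _ _ _).inv ≫ cg ▷ X₂) ≫ qg)
    (hq : (j ⊗ₘ x₂) ≫ qT = qg) (hx : x ≫ x₂ = cx') :
    y₁ ▷ P ≫ Y ◁ E ≫ Y ◁ n ≫ act =
      Y₀ ◁ sA ≫ Y₀ ◁ sB ≫ (α_ _ _ _).inv ≫ ((y₂ ⊗ₘ b) ≫ cg ≫ j) ▷ X' ≫ Z₂ ◁ cx' ≫ qT := by
  have e₁ : y₁ ▷ P ≫ Y ◁ E ≫ Y ◁ n ≫ act = Y₀ ◁ (E ≫ n ≫ c₁) ≫ act₀ := by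
    rw [← h₁, ← whiskerLeft_comp_assoc, whiskerLeft_comp_tensorHom_assoc,
      whiskerRight_comp_tensorHom_assoc, hy₁, id_tensorHom, Category.assoc]
  have e₂ : Y₀ ◁ (q ≫ c₂) ≫ act₀ = y₂ ▷ T ≫ Y₂ ◁ q ≫ act' := by
    rw [← h₂, whiskerLeft_comp_tensorHom_assoc, whiskerRight_comp_tensorHom_assoc, hy₂,
      id_tensorHom]
  rw [e₁, hN, whiskerLeft_comp_assoc, e₂, hg, whiskerLeft_comp_assoc]
  congr 1
  simp only [Category.assoc]
  rw [whisker_exchange_assoc, ← whiskerLeft_comp_assoc, ← hB, ← hq, ← hx, whiskerLeft_comp_assoc,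
    ← whisker_exchange_assoc, ← MonoidalCategory.tensorHom_def_assoc,
    associator_inv_naturality_assoc, whiskerRight_comp_tensorHom_assoc,
    tensorHom_comp_tensorHom_assoc, MonoidalCategory.tensorHom_def, Category.assoc]

end FreeAssoc

/-! ### Associativity of the free action -/

section FreeAlgebra

variable {M : Type u} [Category.{v} M] [MonoidalCategory M] [SymmetricCategory M]
  [Limits.HasColimits M] [MonoidalClosed M]
variable {C : Type v} (O : Operad M C) (X : C → M)

/-- These are the generating terms for testing associativity: one middle operation together with a
labelled top operation for each of its inputs. -/
theorem twoLevels_fibrewiseEpi : FibrewiseEpi (I := C × List (Arity C))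
    (A := fun p => O.ops.val (p.1, outputs p.2) ⊗ tensorList (freeTerm O X) p.2)
    (B := fun p : Arity C => O.ops.val p ⊗ tensorList (freeObj O X) p.2)
    (fun p => (p.1, outputs p.2))
    (fun p => O.ops.val (p.1, outputs p.2) ◁ tensorListMap Prod.fst (toFree O X) p.2) := by
  rintro ⟨c, l⟩ Z f g h
  apply free_whiskerLeft_ext O X l
  rintro K rfl
  have e : tensorListMap Prod.fst (toFree O X) K ≫ tensorListCast (freeObj O X) rfl =
    tensorListMap Prod.fst (toFree O X) K := Category.comp_id _
  rw [e]
  have := h ⟨(c, K), rfl⟩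
  simp only [eqToHom_refl, Category.comp_id] at this
  exact this

theorem freeAct_cast (t : C) {a b : Profile C} (h : a = b) :
    ((O.ops t).map (Profile.ofEq h) ⊗ₘ tensorListCast (freeObj O X) h) ≫ freeAct O X t b =
      freeAct O X t a := by
  subst h
  simp [Profile.ofEq, tensorListCast]

theorem freeAct_assoc_twoLevels (t : C) (T : TwoLevels C) :
    O.ops.val (t, outputs T.middle) ◁ tensorListMap
        (G := fun p : Arity C => O.ops.val p ⊗ tensorList (freeObj O X) p.2)
        (fun p : C × List (Arity C) => (p.1, outputs p.2))
        (fun p => O.ops.val (p.1, outputs p.2) ◁ tensorListMap Prod.fst (toFree O X) p.2) T ≫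
      O.ops.val (t, outputs T.middle) ◁
          tensorListShuffle O.ops.val (freeObj O X) Prod.snd T.middle ≫
        (α_ _ _ _).inv ≫ O.comp t T.middle ▷ tensorList (freeObj O X) (inputs T.middle) ≫
          freeAct O X t (inputs T.middle) =
    O.ops.val (t, outputs T.middle) ◁ tensorListMap
        (G := fun p : Arity C => O.ops.val p ⊗ tensorList (freeObj O X) p.2)
        (fun p : C × List (Arity C) => (p.1, outputs p.2))
        (fun p => O.ops.val (p.1, outputs p.2) ◁ tensorListMap Prod.fst (toFree O X) p.2) T ≫
      O.ops.val (t, outputs T.middle) ◁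
          tensorListMap Prod.fst (fun p => freeAct O X p.1 p.2) T.middle ≫
        freeAct O X t (outputs T.middle) := by
  have : IsIso (Profile.ofEq T.outputs_middle.symm) :=
    inferInstanceAs (IsIso (eqToHom T.outputs_middle.symm))
  have ofEq_symm : ∀ {a b : Profile C} (h : a = b),
      (O.ops t).map (Profile.ofEq h.symm) ≫ (O.ops t).map (Profile.ofEq h) = 𝟙 _ := by
    intro a b h
    subst h
    simp [Profile.ofEq]
  have hflat : (T.flatMap fun p => inputs p.2) = inputs T.top := (List.flatMap_assoc).symm
  -- The operad axiom has its root at `List.map Prod.fst T`, which equals the outputs of the middle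
  -- level only propositionally; the identification is invertible and may be precomposed.
  rw [← cancel_epi ((O.ops t).map (Profile.ofEq T.outputs_middle.symm) ▷ _)]
  refine (free_assoc_step_left (w := tensorListMap Prod.fst (toFree O X) T.top ≫
      tensorListCast (freeObj O X) T.inputs_middle.symm)
      (c := tensorListCast (freeObj O X) T.inputs_middle) ?_ ?_
      (freeAct_cast O X t T.inputs_middle) (freeAct_spec O X t T.top)
      (tensorListShuffle_assoc (fun p : C × List (Arity C) => O.ops.val (p.1, outputs p.2))
        O.ops.val X Prod.snd Prod.snd T) (cx' := tensorListCast X hflat) ?_ (O.assoc t T)).trans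
    (free_assoc_step_right (c₁ := tensorListCast (freeObj O X) T.outputs_middle)
      (c₂ := tensorListCast (freeObj O X) T.outputs_merged)
      (x := tensorListCast X (hflat.trans T.inputs_merged.symm))
      (B := tensorListMap (G := freeTerm O X) (fun p => (p.1, inputs p.2))
        (fun p => O.comp p.1 p.2 ▷ tensorList X (inputs p.2)) T)
      ?_ (freeAct_cast O X t T.outputs_middle) (ofEq_symm _)
      (freeAct_cast O X t T.outputs_merged) (ofEq_symm _) ?_ (freeAct_spec O X t T.merged)
      (cast_toFree O X t T.inputs_merged) ?_).symm
  -- Passing from top terms to free objects commutes with splitting off the middle operations.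
  · have h := tensorListShuffle_map (F := fun p : C × List (Arity C) => O.ops.val (p.1, outputs p.2))
      (F' := O.ops.val) (G := freeTerm O X) (G' := freeObj O X) (s := Prod.snd) (s' := Prod.snd)
      (fun p : C × List (Arity C) => (p.1, outputs p.2)) Prod.fst (fun _ => 𝟙 _) (toFree O X)
      (fun _ => rfl) T T.inputs_middle.symm
    refine Eq.trans ?_ h.symm
    congr 1
    congr 1
    funext p
    exact (id_tensorHom _ _).symm.trans (congrArg _ (Category.comp_id _).symm)
  · rw [Category.assoc, tensorListCast_trans]
    exact Category.comp_id _
  · rw [tensorListCast_trans]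
    rfl
  -- Block by block, the defining equation `freeAct_spec` replaces the action on generating terms by
  -- composition followed by the structure map.
  · have h₁ := tensorListMap_comp (F := fun p : C × List (Arity C) =>
        O.ops.val (p.1, outputs p.2) ⊗ tensorList (freeTerm O X) p.2)
      (G := fun p : Arity C => O.ops.val p ⊗ tensorList (freeObj O X) p.2) (H := freeObj O X)
      (fun p : C × List (Arity C) => (p.1, outputs p.2)) Prod.fst
      (fun p => O.ops.val (p.1, outputs p.2) ◁ tensorListMap Prod.fst (toFree O X) p.2)
      (fun p => freeAct O X p.1 p.2) T
    have h₂ := tensorListMap_comp (F := fun p : C × List (Arity C) =>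
        O.ops.val (p.1, outputs p.2) ⊗ tensorList (freeTerm O X) p.2)
      (G := freeTerm O X) (H := freeObj O X)
      (fun p : C × List (Arity C) => (p.1, inputs p.2)) Prod.fst
      (fun p => freeMul O X p.1 p.2) (toFree O X) T
    have h₃ : (fun p : C × List (Arity C) => O.ops.val (p.1, outputs p.2) ◁
        tensorListMap Prod.fst (toFree O X) p.2 ≫ freeAct O X p.1 (outputs p.2)) =
        fun p : C × List (Arity C) => freeMul O X p.1 p.2 ≫ toFree O X (p.1, inputs p.2) :=
      funext fun p => freeAct_spec O X p.1 p.2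
    refine h₁.trans (Eq.trans (congrArg (fun f => tensorListMap (G := freeObj O X)
      (fun p : C × List (Arity C) => p.1) f T) h₃) (h₂.symm.trans ?_))
    congr 1
    rw [tensorListHom_map]
    congr 1
    funext p
    exact (Category.assoc _ _ _).symm
  -- Composing middle with top operations in each block commutes with splitting off the labels.
  · have h := tensorListShuffle_map
      (F := fun p : C × List (Arity C) => O.ops.val (p.1, outputs p.2) ⊗ tensorList O.ops.val p.2)
      (F' := O.ops.val) (G := X) (G' := X) (s := fun p => inputs p.2) (s' := Prod.snd)
      (fun p : C × List (Arity C) => (p.1, inputs p.2)) (fun c => c) (fun p => O.comp p.1 p.2)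
      (fun _ => 𝟙 _) (fun _ => List.map_id' _) T
      ((List.map_id' _).trans (hflat.trans T.inputs_merged.symm))
    have e : ∀ {a b : Profile C} (h : a = b) (h' : List.map (fun c => c) a = b),
        tensorListMap (F := X) (G := X) (fun c => c) (fun _ => 𝟙 _) a ≫ tensorListCast X h' =
          tensorListCast X h := by
      intro a b h h'
      subst h
      exact (tensorListMap_id _ _).trans (tensorListHom_id _ _)
    rw [e (hflat.trans T.inputs_merged.symm)] at h
    refine h.trans ?_
    congr 1
    congr 1
    funext p
    exact (congrArg _ (e rfl _)).trans (tensorHom_id _ _)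
  · exact tensorListCast_trans _ _ _

/-- The list `L` is the middle level; the top levels over it supply a jointly epi family, so every
test has the form `L = T.middle`. -/
theorem freeAct_assoc (t : C) (L : List (Arity C)) :
    O.ops.val (t, outputs L) ◁ tensorListShuffle O.ops.val (freeObj O X) Prod.snd L ≫
      (α_ _ _ _).inv ≫ O.comp t L ▷ tensorList (freeObj O X) (inputs L) ≫
        freeAct O X t (inputs L) =
    O.ops.val (t, outputs L) ◁ tensorListMap Prod.fst (fun p => freeAct O X p.1 p.2) L ≫
      freeAct O X t (outputs L) := by
  apply ((twoLevels_fibrewiseEpi O X).tensorList L).whiskerLeft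
  rintro ⟨T, rfl⟩
  have h := freeAct_assoc_twoLevels O X t T
  simp only [eqToHom_refl, Category.comp_id]
  exact h

/-- The free algebra on a colored object. -/
noncomputable def freeAlgebra : Algebra O where
  obj := freeObj O X
  act := freeAct O X
  equivariance t _ _ r := freeAct_equivariance O X t r
  one_act := freeAct_one O X
  assoc := freeAct_assoc O X

end FreeAlgebra

/-! ### Universal property of free algebras and canonical presentations -/

section FreeUniversal

variable {M : Type u} [Category.{v} M] [MonoidalCategory M]

theorem free_unit_step {Y Y' X X' P N V Z : M} {o : Y ⟶ Y'} {n : X ⟶ P} {s : P ⟶ V ⊗ X'}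
    {m : 𝟙_ M ⟶ V} {c : X ⟶ X'} {c' : X' ⟶ X} {k : Y' ⊗ V ⟶ N} {i : N ⟶ Y} {q : Y ⊗ X ⟶ Z}
    {q' : N ⊗ X' ⟶ Z} (hs : n ≫ s = (λ_ X).inv ≫ (m ⊗ₘ c)) (hc : c ≫ c' = 𝟙 X)
    (hk : (ρ_ Y).inv ≫ (o ⊗ₘ m) ≫ k ≫ i = 𝟙 Y) (hq : (i ⊗ₘ c') ≫ q = q') :
    (o ⊗ₘ n) ≫ (Y' ◁ s ≫ (α_ Y' V X').inv ≫ k ▷ X') ≫ q' = q := by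
  rw [← hq, Category.assoc, Category.assoc, tensorHom_comp_whiskerLeft_assoc, hs,
    ← whiskerLeft_comp_tensorHom_assoc, associator_inv_naturality_assoc,
    whiskerRight_comp_tensorHom_assoc, tensorHom_comp_tensorHom_assoc, hc]
  have h : Y ◁ (λ_ X).inv ≫ (α_ Y (𝟙_ M) X).inv = (ρ_ Y).inv ▷ X := by monoidal
  rw [reassoc_of% h, tensorHom_id, ← comp_whiskerRight_assoc, hk, id_whiskerRight,
    Category.id_comp]

theorem free_desc_step {Y P V X X' W N T Q Z : M} {s : P ⟶ V ⊗ X} {c : Y ⊗ V ⟶ N} {h : X ⟶ X'}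
    {act : N ⊗ X' ⟶ Z} {p : P ⟶ W} {s' : W ⟶ V ⊗ X'} {n : W ⟶ T} {act' : Y ⊗ T ⟶ Z}
    {d : P ⟶ Q} {e : Q ⟶ T} (hs : s ≫ V ◁ h = p ≫ s')
    (ha : Y ◁ s' ≫ (α_ Y V X').inv ≫ c ▷ X' ≫ act = Y ◁ n ≫ act') (hd : d ≫ e = p ≫ n) :
    (Y ◁ s ≫ (α_ Y V X).inv ≫ c ▷ X) ≫ N ◁ h ≫ act = Y ◁ d ≫ Y ◁ e ≫ act' := by
  simp only [Category.assoc]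
  rw [← whisker_exchange_assoc, ← associator_inv_naturality_right_assoc,
    ← whiskerLeft_comp_assoc, hs, whiskerLeft_comp_assoc, ha, ← whiskerLeft_comp_assoc,
    ← whiskerLeft_comp_assoc, hd]

theorem free_desc_one_step {Y A B : M} {o : 𝟙_ M ⟶ Y} {h : A ⟶ B} {act : Y ⊗ (B ⊗ 𝟙_ M) ⟶ B}
    (ha : (λ_ B).inv ≫ (o ⊗ₘ (ρ_ B).inv) ≫ act = 𝟙 B) :
    ((λ_ A).inv ≫ (o ⊗ₘ (ρ_ A).inv)) ≫ Y ◁ (h ⊗ₘ 𝟙 (𝟙_ M)) ≫ act = h := by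
  rw [Category.assoc, tensorHom_comp_whiskerLeft_assoc, tensorHom_id, ← rightUnitor_inv_naturality,
    ← whiskerLeft_comp_tensorHom_assoc, ← leftUnitor_inv_naturality_assoc, ha, Category.comp_id]

variable [SymmetricCategory M] {C : Type v} (O : Operad M C)

theorem freeDesc_invariant {X : C → M} {B : Algebra O} (h : ∀ c, X c ⟶ B.obj c)
    (t : C) {a b : Profile C} (r : PermWord C a b) :
    freeTermAct O X (.mk t r) ≫ O.ops.val (t, b) ◁ tensorListHom h b ≫ B.act t b =
      O.ops.val (t, a) ◁ tensorListHom h a ≫ B.act t a := by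
  rw [← B.equivariance t r]
  have e := PermWord.tensor_natural h r
  refine (tensorHom_comp_whiskerLeft_assoc _ _ _ _).trans (Eq.trans ?_
    (whiskerLeft_comp_tensorHom_assoc _ _ _ _).symm)
  exact congrArg (fun f => (_ ⊗ₘ f) ≫ _) e.symm

variable [Limits.HasColimits M]

/-- The underlying morphisms of the extension of a map of colored objects to the free algebra. -/
noncomputable def freeDescHom {X : C → M} {B : Algebra O} (h : ∀ c, X c ⟶ B.obj c) (t : C) :
    freeObj O X t ⟶ B.obj t :=
  orbitsDesc (freeTerm O X) (fun e => freeTermAct O X e) t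
    (fun a => O.ops.val (t, a) ◁ tensorListHom h a ≫ B.act t a) (freeDesc_invariant O h t)

theorem toFree_desc {X : C → M} {B : Algebra O} (h : ∀ c, X c ⟶ B.obj c) (t : C)
    (a : Profile C) :
    toFree O X (t, a) ≫ freeDescHom O h t = O.ops.val (t, a) ◁ tensorListHom h a ≫ B.act t a :=
  toOrbits_desc (freeTerm O X) (fun e => freeTermAct O X e) t
    (fun a => O.ops.val (t, a) ◁ tensorListHom h a ≫ B.act t a) (freeDesc_invariant O h t) a

variable (X : C → M) [MonoidalClosed M]

/-- The inclusion of the generators into the free algebra. -/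
noncomputable def freeUnit (c : C) : X c ⟶ freeObj O X c :=
  ((λ_ (X c)).inv ≫ (O.one c ⊗ₘ (ρ_ (X c)).inv)) ≫ toFree O X (c, [c])

/-- Every generating term is an operation applied to generators, by the right unit law `O.comp_one`.
Uniqueness of extensions from the generators rests on this. -/
theorem toFree_eq_freeAct (t : C) (a : Profile C) :
    O.ops.val (t, a) ◁ tensorListHom (freeUnit O X) a ≫ freeAct O X t a = toFree O X (t, a) := by
  have h₁ := tensorListMap_comp (G := freeTerm O X) (H := freeObj O X) (fun c => (c, [c])) Prod.fst
    (fun c => (λ_ (X c)).inv ≫ (O.one c ⊗ₘ (ρ_ (X c)).inv)) (toFree O X) a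
  have h₂ := tensorListMap_id (freeUnit O X) a
  have h₃ : tensorListMap (G := freeTerm O X) (fun c => (c, [c]))
      (fun c => (λ_ (X c)).inv ≫ (O.one c ⊗ₘ (ρ_ (X c)).inv)) a ≫
      (tensorListMap Prod.fst (toFree O X) (unaries a) ≫
        tensorListCast (freeObj O X) (outputs_unaries a)) = tensorListHom (freeUnit O X) a := by
    refine Eq.trans ?_ ((congrArg (· ≫ _) h₁).trans h₂)
    rw [Category.assoc, Category.assoc, tensorListCast_trans]
  have h₄ : (O.ops t).map (Profile.ofEq (outputs_unaries a).symm) ≫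
      (O.ops t).map (Profile.ofEq (outputs_unaries a)) = 𝟙 _ := by
    rw [← Functor.map_comp]
    exact (congrArg _ (eqToHom_trans _ _)).trans ((O.ops t).map_id a)
  rw [← h₃, ← id_tensorHom, ← h₄, ← tensorHom_comp_tensorHom_assoc,
    freeAct_cast_spec O X t (unaries a) (outputs_unaries a)]
  exact free_unit_step (shuffle_unaries O.ops O.one X a)
    ((tensorListCast_trans X _ (inputs_unaries a)).trans rfl) (O.comp_one t a)
    (cast_toFree O X t (inputs_unaries a))

/-- Comparing whole families in `l` makes `l` a variable, so the equation `outputs K = l` can be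
eliminated. -/
theorem free_family_ext {Y : Profile C → M} {Z : M}
    (f g : ∀ l, Y l ⊗ tensorList (freeObj O X) l ⟶ Z)
    (h : ∀ K : List (Arity C), Y (outputs K) ◁ tensorListMap Prod.fst (toFree O X) K ≫ f (outputs K) =
      Y (outputs K) ◁ tensorListMap Prod.fst (toFree O X) K ≫ g (outputs K)) (l : Profile C) :
    f l = g l := by
  refine free_whiskerLeft_ext O X l (fun K e => ?_)
  obtain rfl : l = outputs K := e.symm
  have e : tensorListMap Prod.fst (toFree O X) K ≫ tensorListCast (freeObj O X) rfl =
    tensorListMap Prod.fst (toFree O X) K := Category.comp_id _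
  rw [e]
  exact h K

variable {X} {B : Algebra O} (h : ∀ c, X c ⟶ B.obj c)

theorem freeUnit_desc (c : C) : freeUnit O X c ≫ freeDescHom O h c = h c :=
  (Category.assoc _ _ _).trans ((congrArg _ (toFree_desc O h c [c])).trans
    (free_desc_one_step (B.one_act c)))

/-- On generating terms, compatibility with the actions is the associativity axiom of `B`. -/
theorem freeDescHom_act (t : C) (l : Profile C) :
    freeAct O X t l ≫ freeDescHom O h t =
      O.ops.val (t, l) ◁ tensorListHom (freeDescHom O h) l ≫ B.act t l := by
  refine free_family_ext O X (fun l => freeAct O X t l ≫ freeDescHom O h t)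
    (fun l => O.ops.val (t, l) ◁ tensorListHom (freeDescHom O h) l ≫ B.act t l) (fun K => ?_) l
  refine (Category.assoc _ _ _).symm.trans ((congrArg (· ≫ _) (freeAct_spec O X t K)).trans ?_)
  refine (Category.assoc _ _ _).trans ((congrArg _ (toFree_desc O h t (inputs K))).trans ?_)
  refine free_desc_step (p := tensorListHom (fun p => O.ops.val p ◁ tensorListHom h p.2) K) ?_
    (B.assoc t K) ?_
  · have := tensorListShuffle_natural (fun p => 𝟙 (O.ops.val p)) h Prod.snd K
    simp only [tensorListHom_id, id_tensorHom] at this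
    exact this
  · rw [tensorListHom_map, tensorListMap_hom]
    congr 1
    funext p
    exact toFree_desc O h p.1 p.2

/-- The extension of a map of colored objects to the free algebra. -/
noncomputable def freeDesc : freeAlgebra O X ⟶ B := ⟨freeDescHom O h, freeDescHom_act O h⟩

variable {O} in
theorem free_hom_ext {f g : freeAlgebra O X ⟶ B}
    (e : ∀ c, freeUnit O X c ≫ f.hom c = freeUnit O X c ≫ g.hom c) : f = g := by
  -- A morphism of algebras is computed on each generating term from its restriction to the
  -- generators.
  have key : ∀ (f : freeAlgebra O X ⟶ B) (t : C) (a : Profile C), toFree O X (t, a) ≫ f.hom t =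
      O.ops.val (t, a) ◁ tensorListHom (fun c => freeUnit O X c ≫ f.hom c) a ≫ B.act t a := by
    intro f t a
    have h₁ := f.act_hom t a
    have h₂ := tensorListHom_comp (freeUnit O X) f.hom a
    refine (congrArg (· ≫ f.hom t) (toFree_eq_freeAct O X t a).symm).trans ?_
    refine (Category.assoc _ _ _).trans ((congrArg _ h₁).trans ?_)
    exact (whiskerLeft_comp_assoc _ _ _ _).symm.trans (congrArg (fun z => _ ◁ z ≫ _) h₂.symm)
  refine Algebra.Hom.ext (funext fun t => ?_)
  apply free_jointlyEpi O X t
  intro a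
  refine (key f t a).trans (Eq.trans ?_ (key g t a).symm)
  simp only [e]

/-- The forgetful functor from algebras to colored objects. -/
def Algebra.forget : Algebra O ⥤ (C → M) where
  obj A := A.obj
  map f := f.hom
  map_id _ := rfl
  map_comp _ _ := rfl

/-- The universal property of the free algebra. -/
noncomputable def freeHomEquiv (X : C → M) (B : Algebra O) :
    (freeAlgebra O X ⟶ B) ≃ (X ⟶ (Algebra.forget O).obj B) where
  toFun f c := freeUnit O X c ≫ f.hom c
  invFun h := freeDesc O h
  left_inv _ := free_hom_ext fun c => freeUnit_desc O _ c
  right_inv _ := funext fun c => freeUnit_desc O _ c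

theorem freeHomEquiv_comp (X : C → M) {B B' : Algebra O} (f : B ⟶ B') (g : freeAlgebra O X ⟶ B) :
    freeHomEquiv O X B' (g ≫ f) = freeHomEquiv O X B g ≫ (Algebra.forget O).map f :=
  funext fun _ => (Category.assoc _ _ _).symm

/-- The free algebra functor. -/
noncomputable def freeFunctor : (C → M) ⥤ Algebra O :=
  Adjunction.leftAdjointOfEquiv (freeHomEquiv O) (fun X _ _ => freeHomEquiv_comp O X)

/-- The adjunction between free algebras and the forgetful functor. -/
noncomputable def freeAdjunction : freeFunctor O ⊣ Algebra.forget O :=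
  Adjunction.adjunctionOfEquivLeft (freeHomEquiv O) _

instance : (Algebra.forget O).IsRightAdjoint := (freeAdjunction O).isRightAdjoint

/-- Every algebra is the coequalizer of its canonical presentation by free algebras. -/
noncomputable def counitRegularEpi {F : (C → M) ⥤ Algebra O} (adj : F ⊣ Algebra.forget O)
    (A : Algebra O) : RegularEpi (adj.counit.app A) where
  W := F.obj (F.obj A.obj).obj
  left := F.map (adj.counit.app A).hom
  right := adj.counit.app (F.obj A.obj)
  w := adj.counit.naturality (adj.counit.app A)
  isColimit := Limits.Cofork.IsColimit.mk' _ fun s => by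
    -- The unit splits the presentation in each color, though the splitting need not be a morphism
    -- of algebras.
    have hsplit : ∀ c, adj.unit.app A.obj c ≫ (adj.counit.app A).hom c = 𝟙 (A.obj c) := fun c =>
      congrFun (adj.right_triangle_components A) c
    -- The split coequalizer identity: the factorization in each color is the cofork restricted
    -- along the unit.
    have hk : ∀ c, (adj.counit.app A).hom c ≫ adj.unit.app A.obj c ≫ s.π.hom c = s.π.hom c := by
      intro c
      have h₁ : (adj.counit.app A).hom c ≫ adj.unit.app A.obj c =
          adj.unit.app (F.obj A.obj).obj c ≫ (F.map (adj.counit.app A).hom).hom c :=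
        congrFun (adj.unit.naturality (adj.counit.app A).hom) c
      have h₂ : (F.map (adj.counit.app A).hom).hom c ≫ s.π.hom c =
          (adj.counit.app (F.obj A.obj)).hom c ≫ s.π.hom c :=
        congrFun (congrArg Algebra.Hom.hom s.condition) c
      have h₃ : adj.unit.app (F.obj A.obj).obj c ≫ (adj.counit.app (F.obj A.obj)).hom c = 𝟙 _ :=
        congrFun (adj.right_triangle_components (F.obj A.obj)) c
      exact (Category.assoc _ _ _).symm.trans ((congrArg (· ≫ _) h₁).trans
        ((Category.assoc _ _ _).trans ((congrArg _ h₂).trans ((Category.assoc _ _ _).symm.trans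
          ((congrArg (· ≫ _) h₃).trans (Category.id_comp _))))))
    -- Split epimorphisms in each color let `Algebra.act_hom_of_epi` promote that factorization to a
    -- morphism of algebras.
    have : ∀ c, Epi ((adj.counit.app A).hom c) := fun c =>
      (SplitEpi.mk (adj.unit.app A.obj c) (hsplit c)).epi
    refine ⟨⟨fun c => adj.unit.app A.obj c ≫ s.π.hom c,
      Algebra.act_hom_of_epi (adj.counit.app A) s.π _ hk⟩, Algebra.Hom.ext (funext hk), ?_⟩
    intro m hm
    refine Algebra.Hom.ext (funext fun c => ?_)
    rw [← cancel_epi ((adj.counit.app A).hom c)]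
    exact (congrFun (congrArg Algebra.Hom.hom hm) c).trans (hk c).symm

end FreeUniversal

/-! ### Change of colors -/

section Reindex

variable {M : Type u} [Category.{v} M] [Limits.HasColimits M] {C D : Type v}

/-- The left adjoint is left Kan extension along `f` between discrete categories: the coproduct over
each fibre. -/
theorem comap_isRightAdjoint (f : C → D) : (Pi.comap (fun _ : D => M) f).IsRightAdjoint := by
  let e : ∀ (X : C → M) (Y : D → M),
      ((fun d => ∐ fun c : {c // f c = d} => X c.1) ⟶ Y) ≃ (X ⟶ (Pi.comap (fun _ => M) f).obj Y) :=
    fun X Y =>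
    { toFun := fun g c => Limits.Sigma.ι (fun c' : {c' // f c' = f c} => X c'.1) ⟨c, rfl⟩ ≫ g (f c)
      invFun := fun h d => Limits.Sigma.desc fun c => h c.1 ≫ eqToHom (congrArg Y c.2)
      left_inv := fun g => by
        funext d
        refine Limits.Sigma.hom_ext _ _ ?_
        rintro ⟨c, rfl⟩
        simp
      right_inv := fun h => by
        funext c
        simp }
  exact (Adjunction.adjunctionOfEquivLeft e
    (fun _ _ _ _ _ => funext fun _ => (Category.assoc _ _ _).symm)).isRightAdjoint

end Reindex

/-! ### Existence of the operadic left Kan extension -/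

section LeftAdjoint

variable {M : Type u} [Category.{v} M] [MonoidalCategory M] [SymmetricCategory M]
  [MonoidalClosed M] [Limits.HasColimits M] {S : InvMonStr M} {C D : Type v}
  {O : StarOperad S C} {P : StarOperad S D}

/-- The pullback functor along a morphism of colored operads has a left adjoint. -/
theorem StarOperad.Hom.pullFunctor_isRightAdjoint (Φ : StarOperad.Hom O P) :
    Φ.pullFunctor.IsRightAdjoint := by
  have := comap_isRightAdjoint (M := M) Φ.f
  -- Underlying objects of a pullback are reindexed underlying objects, definitionally; so this is a
  -- composite of right adjoints.
  have : (Φ.pullFunctor ⋙ Algebra.forget O.toOperad).IsRightAdjoint :=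
    inferInstanceAs (Algebra.forget P.toOperad ⋙ Pi.comap (fun _ : D => M) Φ.f).IsRightAdjoint
  -- The adjoint triangle theorem; the reflexive coequalizers it uses are those of `P`-algebras.
  exact isRightAdjoint_triangle_lift Φ.pullFunctor (freeAdjunction O.toOperad)
    (counitRegularEpi O.toOperad _)

end LeftAdjoint

/-! ### Left adjoints of involutive functors, and passage to `*`-objects -/

section InvolutiveAdjunction

variable {X : Type*} [Category* X] {Y : Type*} [Category* Y] {S : InvStr X} {T : InvStr Y}
  {F : X ⥤ Y} (R : InvFunctor T S) (κ : R.functor ⋙ S.J ⟶ T.J ⋙ R.functor)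
  (adj : F ⊣ R.functor)

/-- The mate `F J ⟶ J' F` of a natural transformation `J R ⟶ R J'`. -/
def mate : S.J ⋙ F ⟶ F ⋙ T.J where
  app x := F.map (S.J.map (adj.unit.app x)) ≫ F.map (κ.app (F.obj x)) ≫
    adj.counit.app (T.J.obj (F.obj x))
  naturality x y f := by
    have h1 := adj.counit.naturality (T.J.map (F.map f))
    have h2 := κ.naturality (F.map f)
    have h3 := adj.unit.naturality f
    simp only [Functor.comp_obj, Functor.comp_map, Functor.id_obj, Functor.id_map,
      Category.assoc] at h1 h2 h3 ⊢
    rw [← h1, ← F.map_comp_assoc, ← F.map_comp_assoc, ← F.map_comp_assoc, ← F.map_comp_assoc,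
      ← S.J.map_comp, h3, S.J.map_comp, Category.assoc, Category.assoc, h2]

/-- This determines the mate through its adjoint transpose, and replaces its definition in what
follows. -/
theorem unit_mate (x : X) :
    adj.unit.app (S.J.obj x) ≫ R.functor.map ((mate R κ adj).app x) =
      S.J.map (adj.unit.app x) ≫ κ.app (F.obj x) := by
  have h := adj.unit_naturality (S.J.map (adj.unit.app x) ≫ κ.app (F.obj x))
  dsimp only [mate]
  rw [← F.map_comp_assoc, R.functor.map_comp]
  refine (Category.assoc _ _ _).symm.trans ((congrArg (· ≫ _) h).trans
    ((Category.assoc _ _ _).trans ?_))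
  exact (congrArg _ (adj.right_triangle_components _)).trans (Category.comp_id _)

variable {κ}

/-- The left adjoint of an involutive functor with invertible structure, as an involutive
functor. -/
def InvFunctor.leftAdjoint (h' : R.ν ≫ κ = 𝟙 _) : InvFunctor S T where
  functor := F
  ν := mate R κ adj
  map_j x := by
    -- The axiom concerns morphisms out of a value of `F`; after transposition `unit_mate` removes
    -- both occurrences of the mate.
    apply (adj.homEquiv _ _).injective
    simp only [Adjunction.homEquiv_unit, Functor.map_comp]
    have e1 := adj.unit.naturality (S.j.hom.app x)
    have e2 := unit_mate R κ adj (S.J.obj x)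
    have e3 := κ.naturality ((mate R κ adj).app x)
    have e4 := R.map_j (F.obj x)
    have e5 := unit_mate R κ adj x
    have e6 := S.j.hom.naturality (adj.unit.app x)
    have i1 := NatTrans.congr_app h' (T.J.obj (F.obj x))
    have i2 := NatTrans.congr_app h' (F.obj x)
    simp only [Functor.comp_obj, Functor.comp_map, Functor.id_obj, Functor.id_map,
      NatTrans.comp_app, NatTrans.id_app] at e1 e2 e3 e4 e5 e6 i1 i2 ⊢
    -- The axiom for `R`, rewritten for `κ`: composing it with `κ` on the right cancels both
    -- occurrences of `R.ν`.
    have e7 : S.j.hom.app (R.functor.obj (F.obj x)) ≫ S.J.map (κ.app (F.obj x)) ≫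
        κ.app (T.J.obj (F.obj x)) = R.functor.map (T.j.hom.app (F.obj x)) := by
      rw [← e4, Category.assoc, Category.assoc, ← S.J.map_comp_assoc, i2, S.J.map_id,
        Category.id_comp, i1, Category.comp_id]
    rw [← e7, ← reassoc_of% e1, reassoc_of% e2, ← e3, ← S.J.map_comp_assoc, e5,
      S.J.map_comp_assoc, reassoc_of% e6]

/-- The involutive adjunction between an involutive functor with invertible structure and its
left adjoint. -/
def InvFunctor.leftAdjointAdjunction (h : κ ≫ R.ν = 𝟙 _) (h' : R.ν ≫ κ = 𝟙 _) :
    InvAdjunction (R.leftAdjoint adj h') R where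
  adj := adj
  unit_inv x := by
    have e := unit_mate R κ adj x
    have i := NatTrans.congr_app h (F.obj x)
    simp only [Functor.comp_obj, NatTrans.comp_app, NatTrans.id_app] at i
    change adj.unit.app (S.J.obj x) ≫ R.functor.map ((mate R κ adj).app x) ≫
      R.ν.app (F.obj x) = 𝟙 (S.J.obj x) ≫ S.J.map (adj.unit.app x)
    rw [reassoc_of% e, i, Category.id_comp]
    exact Category.comp_id _
  counit_inv y := by
    change adj.counit.app (T.J.obj y) ≫ 𝟙 (T.J.obj y) =
      (F.map (R.ν.app y) ≫ (mate R κ adj).app (R.functor.obj y)) ≫ T.J.map (adj.counit.app y)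
    refine (Category.comp_id (adj.counit.app (T.J.obj y))).trans ?_
    -- The transpose of the left side is the identity by a triangle identity; on the right the mate
    -- becomes `κ`, which cancels `R.ν`.
    apply (adj.homEquiv _ _).injective
    have e1 := adj.unit.naturality (R.ν.app y)
    have e2 := unit_mate R κ adj (R.functor.obj y)
    have e3 := κ.naturality (adj.counit.app y)
    have i := NatTrans.congr_app h' y
    simp only [Functor.comp_obj, Functor.comp_map, Functor.id_obj, Functor.id_map,
      NatTrans.comp_app, NatTrans.id_app] at e1 e2 e3 i
    simp only [Adjunction.homEquiv_unit, Functor.map_comp, Category.assoc]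
    rw [adj.right_triangle_components, ← reassoc_of% e1, reassoc_of% e2, ← e3,
      ← S.J.map_comp_assoc, adj.right_triangle_components, S.J.map_id, Category.id_comp, i]

/-- The adjunction between categories of `*`-objects induced by an involutive adjunction. -/
def InvAdjunction.starObj {L : InvFunctor S T} {R : InvFunctor T S} (A : InvAdjunction L R) :
    L.starObj ⊣ R.starObj where
  unit :=
    { app := fun x => ⟨A.adj.unit.app x.obj, by
        have e := A.unit_inv x.obj
        have n := A.adj.unit.naturality x.star
        simp only [InvFunctor.id, InvFunctor.comp, Category.id_comp, Functor.comp_obj,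
          Functor.comp_map, Functor.id_obj, Functor.id_map] at e n
        change x.star ≫ S.J.map (A.adj.unit.app x.obj) = A.adj.unit.app x.obj ≫
          R.functor.map (L.functor.map x.star ≫ L.ν.app x.obj) ≫ R.ν.app (L.functor.obj x.obj)
        rw [← e, R.functor.map_comp, Category.assoc, ← reassoc_of% n]⟩
      naturality := fun x y f => StarObj.Hom.ext (A.adj.unit.naturality f.hom) }
  counit :=
    { app := fun y => ⟨A.adj.counit.app y.obj, by
        have e := A.counit_inv y.obj
        have n := A.adj.counit.naturality y.star
        simp only [InvFunctor.id, InvFunctor.comp, Category.comp_id, Functor.comp_obj,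
          Functor.comp_map, Functor.id_obj, Functor.id_map] at e n
        change (L.functor.map (R.functor.map y.star ≫ R.ν.app y.obj) ≫
          L.ν.app (R.functor.obj y.obj)) ≫ T.J.map (A.adj.counit.app y.obj) =
            A.adj.counit.app y.obj ≫ y.star
        rw [← n, L.functor.map_comp, Category.assoc, Category.assoc, e, Category.assoc]⟩
      naturality := fun x y f => StarObj.Hom.ext (A.adj.counit.naturality f.hom) }
  left_triangle_components x := StarObj.Hom.ext (A.adj.left_triangle_components x.obj)
  right_triangle_components y := StarObj.Hom.ext (A.adj.right_triangle_components y.obj)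

end InvolutiveAdjunction

end StarOp

theorem theorem6p5 {M : Type u} [Category.{v} M] [MonoidalCategory M] [SymmetricCategory M]
    [MonoidalClosed M] [Limits.HasColimits M] (S : StarOp.InvMonStr M) {C D : Type v}
    (O : StarOp.StarOperad S C) (P : StarOp.StarOperad S D) (Φ : StarOp.StarOperad.Hom O P) :
    ∃ (L : StarOp.InvFunctor O.algInv P.algInv) (A : StarOp.InvAdjunction L Φ.pullback),
      (∀ X : StarOp.Algebra O.toOperad,
        L.ν.app X = L.functor.map (O.algInv.J.map (A.adj.unit.app X)) ≫
          L.functor.map (Φ.pullComm.inv.app (L.functor.obj X)) ≫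
            A.adj.counit.app (P.algInv.J.obj (L.functor.obj X))) ∧
      ∃ B : (L.starObj : O.StarAlg ⥤ P.StarAlg) ⊣ (Φ.pullback.starObj : P.StarAlg ⥤ O.StarAlg),
        (∀ X : O.StarAlg, (B.unit.app X).hom = A.adj.unit.app X.obj) ∧
        (∀ Y : P.StarAlg, (B.counit.app Y).hom = A.adj.counit.app Y.obj) := by
  have := Φ.pullFunctor_isRightAdjoint
  have h : Φ.pullComm.inv ≫ Φ.pullback.ν = 𝟙 _ := Φ.pullComm.inv_hom_id
  have h' : Φ.pullback.ν ≫ Φ.pullComm.inv = 𝟙 _ := Φ.pullComm.hom_inv_id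
  -- Any adjunction will do: the formula for `λ` is the definition of the mate of `Φ.pullComm.inv`,
  -- so it holds by `rfl`.
  have adj : Φ.pullFunctor.leftAdjoint ⊣ Φ.pullback.functor :=
    Adjunction.ofIsRightAdjoint Φ.pullFunctor
  exact ⟨Φ.pullback.leftAdjoint adj h', Φ.pullback.leftAdjointAdjunction adj h h',
    fun _ => rfl, (Φ.pullback.leftAdjointAdjunction adj h h').starObj, fun _ => rfl, fun _ => rfl⟩
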